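/- Let $\mathbb{K}$ be an algebraically closed field, let $l\ge 3$, and let $q\in\mathbb{K}$ be a primitive $l$-th root of unity. Modules are right modules. Let $A=\mathbb{K}_q[X,Y]\rtimes U_q(\mathfrak{sl}_2)$ be the $\mathbb{K}$-algebra generated by $E,F,K,K^{-1},X,Y$ with the relations $$KEK^{-1}=q^2E,\quad KFK^{-1}=q^{-2}F,\quad EF-FE=\frac{K-K^{-1}}{q-q^{-1}},\quad KK^{-1}=K^{-1}K=1,$$ $$EX=qXE,\quad EY=X+q^{-1}YE,\quad FX=YK^{-1}+XF,\quad FY=YF,$$ $$KXK^{-1}=qX,\quad KYK^{-1}=q^{-1}Y,\quad XY=qYX.$$ Put $\varphi=EY-qYE$ and $\psi=XF-q^2FX$, and let $B$ be the subalgebra of $A$ generated by $K^{\pm1},X,Y,\varphi,\psi$. In $A$ one has $\varphi=X-(q-q^{-1})YE$ and $\psi=(1-q^2)XF-q^2YK^{-1}$, so on a space where $X$ and $Y$ are invertible the operators $E$ and $F$ are determined by $K^{\pm1},X,Y,\varphi,\psi$. Let $n=l$ if $l$ is odd and $n=l/2$ if $l$ is even, and consider the vector space with basis $e(a,b)$,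 $0\le a<n$, $0\le b<l$. Let $\xi,\lambda_1,\lambda_2\in\mathbb{K}^*$, $\lambda_3\in\mathbb{K}$ and $\varepsilon\in\{1,-1\}$, and define $$e(a,b)X=e(a,b+1)\ (b<l-1),\qquad e(a,l-1)X=\xi\,e(a,0),\qquad e(a,b)K=\lambda_1q^{\varepsilon a-b}e(a,b),$$ $$e(a,b)Y=\lambda_2q^{\varepsilon a+b}e(a,b-1)\ (b\ne0),\qquad e(a,0)Y=\xi^{-1}\lambda_2q^{\varepsilon a}e(a,l-1).$$ * $N_1(\alpha,\xi,\lambda_1,\lambda_2,\lambda_3)$ ($l$ odd, $\alpha\ne0$) and $N_4(\alpha',\xi,\lambda_1,\lambda_2,\lambda_3)$ ($l$ even, $\alpha'\ne0$): here $\varepsilon=-1$, $e(a,b)\varphi=e(a+1,b)$ for $a<n-1$, and $e(a,b)\psi=(\lambda_3-q^3(q^{-2a}-1)\lambda_1\lambda_2)\,e(a-1,b)$ for $a\neq0$. For $N_1$, $e(l-1,b)\varphi=\alpha e(0,b)$ and $e(0,b)\psi=\alpha^{-1}\lambda_3e(l-1,b)$. For $N_4$, $e(\tfrac l2-1,b)\varphi=\xi^{-1}\alpha'e(0,b)X^{l/2}$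 and $e(0,b)\psi=\alpha'^{-1}\lambda_3e(\tfrac l2-1,b)X^{l/2}$. * $N_2(\beta,\xi,\lambda_1,\lambda_2,\lambda_3)$ ($l$ odd, $\beta\ne0$): here $\varepsilon=1$, $e(a,b)\psi=e(a+1,b)$ for $a<l-1$, $e(l-1,b)\psi=\beta e(0,b)$, $e(a,b)\varphi=(\lambda_3+q^3(1-q^{2a-2})\lambda_1\lambda_2)\,e(a-1,b)$ for $a\ne0$, and $e(0,b)\varphi=\beta^{-1}(\lambda_3-q(1-q^2)\lambda_1\lambda_2)\,e(l-1,b)$. * $N_3(\xi,\lambda_1,\lambda_2)$ ($l$ odd), $N_5(\beta',\xi,\lambda_1,\lambda_2)$ ($l$ even, $\beta'\neq0$) and $N_6(\xi,\lambda_1,\lambda_2)$ ($l$ even): here $\varepsilon=1$, $e(a,b)\psi=e(a+1,b)$ for $a<n-1$, $e(a,b)\varphi=q(1-q^{2a})\lambda_1\lambda_2\,e(a-1,b)$ for $a\neq 0$, and $e(0,b)\varphi=0$. Moreover $e(n-1,b)\psi=0$ for $N_3$ and $N_6$, and $e(\tfrac l2-1,b)\psi=\xi^{-1}\beta'e(0,b)X^{l/2}$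 for $N_5$. Then: 1. For all admissible parameters these formulas define right $A$-modules (and so, by restriction, $B$-modules) on which $X$ and $Y$ act invertibly; $N_1,N_2,N_3$ for $l$ odd and $N_4,N_5,N_6$ for $l$ even are simple as $B$-modules and as $A$-modules. 2. Let $M$ be a simple right $A$-module on which $X$ and $Y$ act invertibly. Then $M$ is simple as a $B$-module, and it is isomorphic as an $A$-module (hence as a $B$-module), for suitable parameters, to one of $N_1$, $N_2$ with $N_2\varphi^l=0$, $N_3$ if $l$ is odd, and to one of $N_4,N_5,N_6$ if $l$ is even. 3. Every such $M$ is finite dimensional with $\dim_{\mathbb{K}}M=\mathrm{PIdeg}(A)$, and this dimension is maximal: every simple right $A$-module $V$ is finite dimensional with $\dim_{\mathbb{K}}V\le\dim_{\mathbb{K}}M$. Here $\mathrm{PIdeg}(A)$ is half the least degree of a monic polynomial identity of $A$, and it equals $l^2$ if $l$ is odd and $l^2/2$ if $l$ is even. -/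

import Mathlib

open MulOpposite

/-! ## PI degree -/

/-- `R` satisfies a monic polynomial identity of degree `d`: there is a noncommutative polynomial
over `ℤ` of degree `d`, one of whose monomials of degree `d` has coefficient `1`, that vanishes
under every evaluation in `R`. -/
def HasMonicIdentity (R : Type*) [Ring R] (d : ℕ) : Prop :=
  ∃ f : MonoidAlgebra ℤ (FreeMonoid ℕ),
    (∀ w : FreeMonoid ℕ, f.coeff w ≠ 0 → w.length ≤ d) ∧
    (∃ w : FreeMonoid ℕ, w.length = d ∧ f.coeff w = 1) ∧
    ∀ x : ℕ → R, MonoidAlgebra.lift ℤ R (FreeMonoid ℕ) (FreeMonoid.lift x) f = 0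

/-- The minimal degree of a PI ring. -/
noncomputable def minimalDegree (R : Type*) [Ring R] : ℕ := sInf {d | HasMonicIdentity R d}

/-- The PI degree of a prime PI ring: half of its minimal degree (which is even). -/
noncomputable def PIdeg (R : Type*) [Ring R] : ℕ := minimalDegree R / 2

namespace QuantumPlane

/-! ## The algebra `A = 𝕂_q[X,Y] ⋊ U_q(sl₂)` -/

/-- The generators of `A`. -/
inductive Gen : Type
  | E | F | K | Kinv | X | Y

section Algebra

variable {𝕂 : Type*} [Field 𝕂]

/-- A generator as an element of the free algebra. -/
abbrev gen (𝕂 : Type*) [Field 𝕂] (g : Gen) : FreeAlgebra 𝕂 Gen := FreeAlgebra.ι 𝕂 g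

open Gen in
/-- The defining relations of `A`. -/
inductive Rel (q : 𝕂) : FreeAlgebra 𝕂 Gen → FreeAlgebra 𝕂 Gen → Prop
  | K_Kinv : Rel q (gen 𝕂 K * gen 𝕂 Kinv) 1
  | Kinv_K : Rel q (gen 𝕂 Kinv * gen 𝕂 K) 1
  | K_E : Rel q (gen 𝕂 K * gen 𝕂 E * gen 𝕂 Kinv) (q ^ 2 • gen 𝕂 E)
  | K_F : Rel q (gen 𝕂 K * gen 𝕂 F * gen 𝕂 Kinv) ((q ^ 2)⁻¹ • gen 𝕂 F)
  | E_F : Rel q (gen 𝕂 E * gen 𝕂 F - gen 𝕂 F * gen 𝕂 E)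
      ((q - q⁻¹)⁻¹ • (gen 𝕂 K - gen 𝕂 Kinv))
  | E_X : Rel q (gen 𝕂 E * gen 𝕂 X) (q • (gen 𝕂 X * gen 𝕂 E))
  | E_Y : Rel q (gen 𝕂 E * gen 𝕂 Y) (gen 𝕂 X + q⁻¹ • (gen 𝕂 Y * gen 𝕂 E))
  | F_X : Rel q (gen 𝕂 F * gen 𝕂 X) (gen 𝕂 Y * gen 𝕂 Kinv + gen 𝕂 X * gen 𝕂 F)
  | F_Y : Rel q (gen 𝕂 F * gen 𝕂 Y) (gen 𝕂 Y * gen 𝕂 F)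
  | K_X : Rel q (gen 𝕂 K * gen 𝕂 X * gen 𝕂 Kinv) (q • gen 𝕂 X)
  | K_Y : Rel q (gen 𝕂 K * gen 𝕂 Y * gen 𝕂 Kinv) (q⁻¹ • gen 𝕂 Y)
  | X_Y : Rel q (gen 𝕂 X * gen 𝕂 Y) (q • (gen 𝕂 Y * gen 𝕂 X))

/-- The smash product algebra `A = 𝕂_q[X,Y] ⋊ U_q(sl₂)`, by generators and relations. -/
abbrev A (q : 𝕂) : Type _ := RingQuot (Rel q)

/-- A generator as an element of `A`. -/
def A.of (q : 𝕂) (g : Gen) : A q := RingQuot.mkAlgHom 𝕂 (Rel q) (gen 𝕂 g)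

/-- The element `φ = EY - qYE`. -/
def A.phi (q : 𝕂) : A q := A.of q .E * A.of q .Y - q • (A.of q .Y * A.of q .E)

/-- The element `ψ = XF - q²FX`. -/
def A.psi (q : 𝕂) : A q := A.of q .X * A.of q .F - q ^ 2 • (A.of q .F * A.of q .X)

/-- The subalgebra `B` of `A` generated by `K`, `K⁻¹`, `X`, `Y`, `φ` and `ψ`. -/
def B (q : 𝕂) : Subalgebra 𝕂 (A q) :=
  Algebra.adjoin 𝕂
    {A.of q .K, A.of q .Kinv, A.of q .X, A.of q .Y, A.phi q, A.psi q}

/-! ## From `X,Y`-invertible representations of `B` to representations of `A` -/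

/-- Elements of an algebra `R` that satisfy the relations between the generators
`K`, `K⁻¹`, `X`, `Y`, `φ`, `ψ` of `B`, together with inverses of `X` and `Y`. -/
structure BData (q : 𝕂) (R : Type*) [Ring R] [Algebra 𝕂 R] where
  (k ki x xi y yi φ ψ : R)
  k_ki : k * ki = 1
  ki_k : ki * k = 1
  x_xi : x * xi = 1
  xi_x : xi * x = 1
  y_yi : y * yi = 1
  yi_y : yi * y = 1
  k_x : k * x = q • (x * k)
  y_k : y * k = q • (k * y)
  x_y : x * y = q • (y * x)
  φ_x : φ * x = x * φ
  y_φ : y * φ = q • (φ * y)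
  k_φ : k * φ = q • (φ * k)
  ψ_x : ψ * x = x * ψ
  ψ_y : ψ * y = q • (y * ψ)
  ψ_k : ψ * k = q • (k * ψ)
  ψ_φ : ψ * φ - φ * ψ = (q * (1 - q ^ 2)) • (k * y * x)

namespace BData

variable {q : 𝕂} {R : Type*} [Ring R] [Algebra 𝕂 R] (D : BData q R)

/-- The images of the generators of `A`. Those of `E` and `F` are dictated by the identities
`φ = X - (q - q⁻¹)YE` and `ψ = (1 - q²)XF - q²YK⁻¹`. -/
def act : Gen → R
  | .E => (q - q⁻¹)⁻¹ • (D.yi * (D.x - D.φ))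
  | .F => (1 - q ^ 2)⁻¹ • (D.xi * (D.ψ + q ^ 2 • (D.y * D.ki)))
  | .K => D.k
  | .Kinv => D.ki
  | .X => D.x
  | .Y => D.y

end BData

end Algebra
end QuantumPlane
namespace QuantumPlane.BData
variable {𝕂 : Type*} [Field 𝕂]
variable {q : 𝕂} {R : Type*} [Ring R] [Algebra 𝕂 R] (D : BData q R)

/-- a relation `a * b = c • (b * a)` with `b` invertible passes to the inverse of `b`. -/
theorem swap_right {a b bi : R} {c : 𝕂} (h1 : b * bi = 1) (h2 : bi * b = 1)
    (h : a * b = c • (b * a)) : bi * a = c • (a * bi) := by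
  calc bi * a = bi * (a * b) * bi := by rw [mul_assoc, mul_assoc, h1, mul_one]
    _ = _ := by
      rw [h, mul_smul_comm, smul_mul_assoc, ← mul_assoc, h2, one_mul]

theorem flip {a b : R} {c : 𝕂} (hc : c ≠ 0) (h : a * b = c • (b * a)) :
    b * a = c⁻¹ • (a * b) := by
  rw [h, smul_smul, inv_mul_cancel₀ hc, one_smul]

theorem assoc_rule {a b : R} {c : 𝕂} (h : a * b = c • (b * a)) (z : R) :
    a * (b * z) = c • (b * (a * z)) := by
  rw [← mul_assoc, h, smul_mul_assoc, mul_assoc]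

set_option linter.unusedSimpArgs false in
theorem act_rel (hq : q ≠ 0) (hq2 : q ^ 2 ≠ 1) {a b : FreeAlgebra 𝕂 Gen} (h : Rel q a b) :
    FreeAlgebra.lift 𝕂 D.act a = FreeAlgebra.lift 𝕂 D.act b := by
  have hs : q - q⁻¹ ≠ 0 := by
    intro h; apply hq2; field_simp at h; linear_combination h
  have ht : 1 - q ^ 2 ≠ 0 := fun h => hq2 (by linear_combination -h)
  have one {a b : R} (h : a * b = b * a) : a * b = (1 : 𝕂) • (b * a) := by rw [one_smul, h]
  -- normal order: x, xi, y, yi, k, ki, φ, ψ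
  have e1 := D.k_x
  have e2 := swap_right D.k_ki D.ki_k (flip hq e1)
  have e3 := flip hq D.x_y
  have e4 := swap_right D.y_yi D.yi_y D.x_y
  have e5 := flip hq D.y_k
  have e6 := swap_right D.k_ki D.ki_k D.y_k
  have e7 := one D.φ_x
  have e8 := flip hq D.y_φ
  have e9 := flip hq D.k_φ
  have e10 := one D.ψ_x
  have e11 := D.ψ_y
  have e12 := D.ψ_k
  -- xi
  have f1 := swap_right D.x_xi D.xi_x e1
  have f2 := flip hq f1
  have f3 := swap_right D.k_ki D.ki_k f1
  have f4 := swap_right D.x_xi D.xi_x e3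
  have f5 := flip (inv_ne_zero hq) f4
  have f6 := swap_right D.y_yi D.yi_y f4
  have f7 := flip one_ne_zero (swap_right D.x_xi D.xi_x e7)
  have f8 := flip one_ne_zero (swap_right D.x_xi D.xi_x e10)
  -- yi
  have g1 := swap_right D.y_yi D.yi_y e5
  have g2 := flip (inv_ne_zero hq) g1
  have g3 := swap_right D.k_ki D.ki_k g1
  have g4 := flip (inv_ne_zero hq) (swap_right D.y_yi D.yi_y e8)
  have g5 := flip hq (swap_right D.y_yi D.yi_y e11)
  -- ki
  have i1 := flip (inv_ne_zero hq) (swap_right D.k_ki D.ki_k e9)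
  have i2 := flip hq (swap_right D.k_ki D.ki_k e12)
  have j : D.ψ * D.φ = D.φ * D.ψ + (q * (1 - q ^ 2)) • (D.k * D.y * D.x) := by
    rw [← D.ψ_φ]; abel
  have c1 (z : R) : D.k * (D.ki * z) = z := by rw [← mul_assoc, D.k_ki, one_mul]
  have c2 (z : R) : D.ki * (D.k * z) = z := by rw [← mul_assoc, D.ki_k, one_mul]
  have c3 (z : R) : D.x * (D.xi * z) = z := by rw [← mul_assoc, D.x_xi, one_mul]
  have c4 (z : R) : D.xi * (D.x * z) = z := by rw [← mul_assoc, D.xi_x, one_mul]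
  have c5 (z : R) : D.y * (D.yi * z) = z := by rw [← mul_assoc, D.y_yi, one_mul]
  have c6 (z : R) : D.yi * (D.y * z) = z := by rw [← mul_assoc, D.yi_y, one_mul]
  cases h <;>
  simp only [map_mul, map_one, map_smul, map_add, map_sub, FreeAlgebra.lift_ι_apply, act, gen,
    mul_assoc, smul_mul_assoc, mul_smul_comm, mul_add, add_mul, mul_sub, sub_mul, smul_add,
    smul_sub, smul_smul, D.k_ki, D.ki_k, D.x_xi, D.xi_x, D.y_yi, D.yi_y, c1, c2, c3, c4, c5, c6,
    mul_one, one_mul,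
    e1, e2, e3, e4, e5, e6, e7, e8, e9, e10, e11, e12, f2, f3, f5, f6, f7, f8, g2, g3, g4, g5,
    i1, i2, j, assoc_rule e1, assoc_rule e2, assoc_rule e3, assoc_rule e4, assoc_rule e5,
    assoc_rule e6, assoc_rule e7, assoc_rule e8, assoc_rule e9, assoc_rule e10, assoc_rule e11,
    assoc_rule e12, assoc_rule f2, assoc_rule f3, assoc_rule f5, assoc_rule f6, assoc_rule f7,
    assoc_rule f8, assoc_rule g2, assoc_rule g3, assoc_rule g4, assoc_rule g5, assoc_rule i1,
    assoc_rule i2] <;>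
  try match_scalars <;> field_simp <;> try ring


end QuantumPlane.BData

namespace QuantumPlane
section Modules
variable {𝕂 : Type*} [Field 𝕂]

/-- The algebra homomorphism `A → R` determined by the images of the generators of `B`. -/
def BData.toHom {q : 𝕂} (hq : q ≠ 0) (hq2 : q ^ 2 ≠ 1) {R : Type*} [Ring R] [Algebra 𝕂 R]
    (D : BData q R) : A q →ₐ[𝕂] R :=
  RingQuot.liftAlgHom 𝕂 ⟨FreeAlgebra.lift 𝕂 D.act, fun _ _ h => D.act_rel hq hq2 h⟩

/-- The vector space with basis `e(a,b)`, `0 ≤ a < n`, `0 ≤ b < l`. -/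
abbrev Sp (𝕂 : Type*) [Field 𝕂] (n l : ℕ) : Type _ := ZMod n × ZMod l →₀ 𝕂

/-- The basis vector `e(a,b)`. -/
noncomputable abbrev e {n l : ℕ} (a : ZMod n) (b : ZMod l) : Sp 𝕂 n l := Finsupp.single (a, b) 1

/-- The linear operator that sends each basis vector `e(a,b)` to `f a b`. -/
noncomputable def basisOp {n l : ℕ} (f : ZMod n → ZMod l → Sp 𝕂 n l) :
    Module.End 𝕂 (Sp 𝕂 n l) :=
  Finsupp.linearCombination 𝕂 fun i => f i.1 i.2

theorem basisOp_e {n l : ℕ} (f : ZMod n → ZMod l → Sp 𝕂 n l) (a : ZMod n) (b : ZMod l) :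
    basisOp f (e a b) = f a b := by
  simp [basisOp]

theorem op_ext {n l : ℕ} {S T : Module.End 𝕂 (Sp 𝕂 n l)}
    (h : ∀ a b, S (e a b) = T (e a b)) : S = T :=
  Finsupp.lhom_ext' fun i => LinearMap.ext_ring (h i.1 i.2)

variable (n l : ℕ) (q : 𝕂) (ξ lam : 𝕂ˣ) (ε : ℤ) (c : 𝕂) (h : ℕ) (d : ZMod n → 𝕂)

/-- `e(a,b)X = e(a,b+1)` for `b < l-1`, and `e(a,l-1)X = ξ e(a,0)`. -/
noncomputable def opX : Module.End 𝕂 (Sp 𝕂 n l) :=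
  basisOp fun a b => if b = -1 then (ξ : 𝕂) • e a 0 else e a (b + 1)

/-- The inverse of `X`. -/
noncomputable def opXinv : Module.End 𝕂 (Sp 𝕂 n l) :=
  basisOp fun a b => if b = 0 then (ξ : 𝕂)⁻¹ • e a (-1) else e a (b - 1)

/-- `e(a,b)K = λ₁ q^{εa-b} e(a,b)`. -/
noncomputable def opK : Module.End 𝕂 (Sp 𝕂 n l) :=
  basisOp fun a b => (lam * q ^ (ε * a.val - b.val : ℤ) : 𝕂) • e a b

/-- The inverse of `K`. -/
noncomputable def opKinv : Module.End 𝕂 (Sp 𝕂 n l) :=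
  basisOp fun a b => (lam * q ^ (ε * a.val - b.val : ℤ) : 𝕂)⁻¹ • e a b

/-- `e(a,b)Y = λ₂ q^{εa+b} e(a,b-1)` for `b ≠ 0`, and `e(a,0)Y = ξ⁻¹ λ₂ q^{εa} e(a,l-1)`. -/
noncomputable def opY : Module.End 𝕂 (Sp 𝕂 n l) :=
  basisOp fun a b =>
    if b = 0 then (((ξ : 𝕂)⁻¹ * (lam * q ^ (ε * a.val : ℤ))) : 𝕂) • e a (-1)
    else (lam * q ^ (ε * a.val + b.val : ℤ) : 𝕂) • e a (b - 1)

/-- The inverse of `Y`. -/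
noncomputable def opYinv : Module.End 𝕂 (Sp 𝕂 n l) :=
  basisOp fun a b =>
    if b = -1 then ((ξ : 𝕂) * (lam * q ^ (ε * a.val : ℤ))⁻¹ : 𝕂) • e a 0
    else (lam * q ^ (ε * a.val + (b + 1).val : ℤ) : 𝕂)⁻¹ • e a (b + 1)

/-- `e(a,b) ↦ e(a+1,b)` for `a < n-1`, and `e(n-1,b) ↦ c e(0,b)Xʰ`. -/
noncomputable def opRaise : Module.End 𝕂 (Sp 𝕂 n l) :=
  basisOp fun a b => if a = -1 then c • (opX n l ξ ^ h) (e 0 b) else e (a + 1) b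

/-- `e(a,b) ↦ d(a) e(a-1,b)` for `a ≠ 0`, and `e(0,b) ↦ c d(0) e(n-1,b)Xʰ`. -/
noncomputable def opLower : Module.End 𝕂 (Sp 𝕂 n l) :=
  basisOp fun a b => if a = 0 then (c * d 0) • (opX n l ξ ^ h) (e (-1) b) else d a • e (a - 1) b

section lemmas
variable {n l q ξ lam ε c h d}

theorem val_succ {m : ℕ} [NeZero m] {b : ZMod m} (hb : b ≠ -1) : (b + 1).val = b.val + 1 := by
  have h1 : b.val + 1 ≠ m := by
    intro h
    apply hb
    have := congrArg (Nat.cast : ℕ → ZMod m) h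
    simp only [Nat.cast_add, ZMod.natCast_zmod_val, Nat.cast_one, CharP.cast_eq_zero] at this
    exact eq_neg_of_add_eq_zero_left this
  have h2 := b.val_lt
  have : (b + 1) = ((b.val + 1 : ℕ) : ZMod m) := by simp
  rw [this, ZMod.val_natCast, Nat.mod_eq_of_lt (by omega)]

theorem val_neg_one' {m : ℕ} [NeZero m] : ((-1 : ZMod m).val : ℤ) = m - 1 := by
  obtain ⟨k, rfl⟩ := Nat.exists_eq_succ_of_ne_zero (NeZero.ne m)
  simp [ZMod.val_neg_one]

theorem val_pred {m : ℕ} [NeZero m] {b : ZMod m} (hb : b ≠ 0) : b.val = (b - 1).val + 1 := by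
  have := val_succ (b := b - 1) (by intro h; apply hb; linear_combination h)
  simpa using this

theorem X_Xinv : opX n l ξ * opXinv n l ξ = 1 := by
  refine op_ext fun a b => ?_
  by_cases hb : b = 0
  · simp only [opX, opXinv, Module.End.mul_apply, basisOp_e, hb, if_true, map_smul, smul_smul,
      inv_mul_cancel₀ ξ.ne_zero, one_smul, Module.End.one_apply]
  · have : b - 1 ≠ -1 := fun h => hb (by linear_combination h)
    simp [opX, opXinv, basisOp_e, hb, this]

theorem Xinv_X : opXinv n l ξ * opX n l ξ = 1 := by
  refine op_ext fun a b => ?_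
  by_cases hb : b = -1
  · simp only [opX, opXinv, Module.End.mul_apply, basisOp_e, hb, if_true, map_smul, smul_smul,
      mul_inv_cancel₀ ξ.ne_zero, one_smul, Module.End.one_apply]
  · have : b + 1 ≠ 0 := fun h => hb (by linear_combination h)
    simp [opX, opXinv, basisOp_e, hb, this]


theorem K_Kinv (hq : q ≠ 0) : opK n l q lam ε * opKinv n l q lam ε = 1 := by
  refine op_ext fun a b => ?_
  have : (lam * q ^ (ε * a.val - b.val : ℤ) : 𝕂) ≠ 0 :=
    mul_ne_zero lam.ne_zero (zpow_ne_zero _ hq)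
  simp only [opK, opKinv, Module.End.mul_apply, basisOp_e, map_smul, smul_smul,
    inv_mul_cancel₀ this, one_smul, Module.End.one_apply]

theorem Kinv_K (hq : q ≠ 0) : opKinv n l q lam ε * opK n l q lam ε = 1 := by
  refine op_ext fun a b => ?_
  have : (lam * q ^ (ε * a.val - b.val : ℤ) : 𝕂) ≠ 0 :=
    mul_ne_zero lam.ne_zero (zpow_ne_zero _ hq)
  simp only [opK, opKinv, Module.End.mul_apply, basisOp_e, map_smul, smul_smul,
    mul_inv_cancel₀ this, one_smul, Module.End.one_apply]

theorem Y_Yinv (hq : q ≠ 0) : opY n l q ξ lam ε * opYinv n l q ξ lam ε = 1 := by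
  refine op_ext fun a b => ?_
  by_cases hb : b = -1
  · simp only [opY, opYinv, Module.End.mul_apply, basisOp_e, hb, if_true, map_smul, smul_smul,
      Module.End.one_apply]
    convert one_smul 𝕂 _ using 2
    have := zpow_ne_zero (ε * a.val) hq
    field_simp
  · have : b + 1 ≠ 0 := fun h => hb (by linear_combination h)
    simp only [opY, opYinv, Module.End.mul_apply, basisOp_e, hb, this, if_false, map_smul,
      smul_smul, Module.End.one_apply, add_sub_cancel_right]
    convert one_smul 𝕂 _ using 2
    exact inv_mul_cancel₀ (mul_ne_zero lam.ne_zero (zpow_ne_zero _ hq))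

theorem Yinv_Y (hq : q ≠ 0) : opYinv n l q ξ lam ε * opY n l q ξ lam ε = 1 := by
  refine op_ext fun a b => ?_
  by_cases hb : b = 0
  · simp only [opY, opYinv, Module.End.mul_apply, basisOp_e, hb, if_true, map_smul, smul_smul,
      Module.End.one_apply]
    convert one_smul 𝕂 _ using 2
    have := zpow_ne_zero (ε * a.val) hq
    field_simp
  · have : b - 1 ≠ -1 := fun h => hb (by linear_combination h)
    simp only [opY, opYinv, Module.End.mul_apply, basisOp_e, hb, this, if_false, map_smul,
      smul_smul, Module.End.one_apply, sub_add_cancel]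
    convert one_smul 𝕂 _ using 2
    exact mul_inv_cancel₀ (mul_ne_zero lam.ne_zero (zpow_ne_zero _ hq))


theorem K_X [NeZero l] (hq : q ≠ 0) (hl : q ^ l = 1) : opX n l ξ * opK n l q lam ε = q • (opK n l q lam ε * opX n l ξ) := by
  refine op_ext fun a b => ?_
  by_cases hb : b = -1
  · simp only [opX, opK, Module.End.mul_apply, LinearMap.smul_apply, basisOp_e, hb, if_true,
      map_smul, smul_smul, val_neg_one', ZMod.val_zero]
    congr 1
    have : q ^ (ε * a.val - ((l : ℤ) - 1)) = q * q ^ (ε * a.val - ((0 : ℕ) : ℤ)) := by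
      rw [show ε * a.val - ((l : ℤ) - 1) = 1 + (ε * a.val - ((0 : ℕ) : ℤ)) - l by push_cast; ring,
        zpow_sub₀ hq, zpow_natCast, hl, div_one, zpow_add₀ hq, zpow_one]
    rw [this]; ring
  · simp only [opX, opK, Module.End.mul_apply, LinearMap.smul_apply, basisOp_e, hb, if_false,
      map_smul, smul_smul, val_succ hb]
    congr 1
    have : q ^ (ε * a.val - (b.val : ℤ)) = q * q ^ (ε * a.val - ((b.val + 1 : ℕ) : ℤ)) := by
      rw [← zpow_one_add₀ hq]; congr 1; push_cast; ring
    rw [this]; ring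

/-- The diagonal operator `YX`. -/
theorem X_Y_e (a : ZMod n) (b : ZMod l) :
    opX n l ξ (opY n l q ξ lam ε (e a b)) = (lam * q ^ (ε * a.val + b.val : ℤ) : 𝕂) • e a b := by
  by_cases hb : b = 0
  · simp only [opX, opY, basisOp_e, hb, if_true, map_smul, smul_smul]
    congr 1
    rw [ZMod.val_zero, Nat.cast_zero, add_zero]; field_simp
  · have : b - 1 ≠ -1 := fun h => hb (by linear_combination h)
    simp only [opX, opY, basisOp_e, hb, this, if_false, map_smul, sub_add_cancel]

theorem Y_X_e [NeZero l] (hq : q ≠ 0) (hl : q ^ l = 1) (a : ZMod n) (b : ZMod l) :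
    opY n l q ξ lam ε (opX n l ξ (e a b)) =
      (q * (lam * q ^ (ε * a.val + b.val : ℤ)) : 𝕂) • e a b := by
  by_cases hb : b = -1
  · simp only [opX, opY, basisOp_e, hb, if_true, map_smul, smul_smul, val_neg_one']
    congr 1
    have : q ^ (ε * a.val + ((l : ℤ) - 1)) = q⁻¹ * q ^ (ε * a.val) := by
      rw [show ε * a.val + ((l : ℤ) - 1) = -1 + (ε * a.val) + l by ring,
        zpow_add₀ hq, zpow_natCast, hl, mul_one, zpow_add₀ hq, zpow_neg_one]
    rw [this]; field_simp
  · have : b + 1 ≠ 0 := fun h => hb (by linear_combination h)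
    simp only [opX, opY, basisOp_e, hb, this, if_false, val_succ hb, add_sub_cancel_right]
    congr 1
    have : q ^ (ε * a.val + ((b.val + 1 : ℕ) : ℤ)) = q * q ^ (ε * a.val + (b.val : ℤ)) := by
      rw [← zpow_one_add₀ hq]; congr 1; push_cast; ring
    rw [this]; ring

theorem X_Y [NeZero l] (hq : q ≠ 0) (hl : q ^ l = 1) : opY n l q ξ lam ε * opX n l ξ = q • (opX n l ξ * opY n l q ξ lam ε) := by
  refine op_ext fun a b => ?_
  simp only [Module.End.mul_apply, LinearMap.smul_apply, X_Y_e, Y_X_e hq hl, smul_smul]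


theorem Y_K {lam' : 𝕂ˣ} [NeZero l] (hq : q ≠ 0) (hl : q ^ l = 1) :
    opK n l q lam ε * opY n l q ξ lam' ε = q • (opY n l q ξ lam' ε * opK n l q lam ε) := by
  have h1 : opX n l ξ * (opY n l q ξ lam' ε * opK n l q lam ε) =
      opK n l q lam ε * (opX n l ξ * opY n l q ξ lam' ε) := by
    refine op_ext fun a b => ?_
    simp only [Module.End.mul_apply, opK, basisOp_e, map_smul, X_Y_e, smul_smul, mul_comm]
  have h2 := congrArg (fun T => opXinv n l ξ * T) h1
  simp only [← mul_assoc, Xinv_X, one_mul] at h2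
  have h3 : opK n l q lam ε * opX n l ξ = q⁻¹ • (opX n l ξ * opK n l q lam ε) := by
    rw [K_X hq hl, smul_smul, inv_mul_cancel₀ hq, one_smul]
  rw [h2, mul_assoc (opXinv n l ξ), h3, mul_smul_comm, ← mul_assoc, Xinv_X, one_mul,
    smul_mul_assoc, smul_smul, mul_inv_cancel₀ hq, one_smul]

theorem Xpow_T {T : Module.End 𝕂 (Sp 𝕂 n l)} {u : 𝕂}
    (hT : T * opX n l ξ = u • (opX n l ξ * T)) (m : ℕ) (v : Sp 𝕂 n l) :
    T ((opX n l ξ ^ m) v) = u ^ m • (opX n l ξ ^ m) (T v) := by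
  induction m generalizing v with
  | zero => simp
  | succ k ih =>
    have := congrArg (fun S => S v) hT
    simp only [Module.End.mul_apply, LinearMap.smul_apply] at this
    rw [pow_succ, Module.End.mul_apply, ih, this, map_smul, smul_smul, pow_succ,
      Module.End.mul_apply]

theorem T_raise {T : Module.End 𝕂 (Sp 𝕂 n l)} {u s : 𝕂} {t : ZMod n → ZMod l → 𝕂}
    (hT : T * opX n l ξ = u • (opX n l ξ * T)) (ht : ∀ a b, T (e a b) = t a b • e a b)
    (h1 : ∀ a b, a ≠ -1 → t (a + 1) b = s * t a b) (h2 : ∀ b, u ^ h * t 0 b = s * t (-1) b) :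
    T * opRaise n l ξ c h = s • (opRaise n l ξ c h * T) := by
  refine op_ext fun a b => ?_
  by_cases ha : a = -1
  · simp only [opRaise, Module.End.mul_apply, LinearMap.smul_apply, basisOp_e, ha, if_true,
      map_smul, Xpow_T hT, ht, smul_smul]
    congr 1; linear_combination c * h2 b
  · simp only [opRaise, Module.End.mul_apply, LinearMap.smul_apply, basisOp_e, ha, if_false,
      map_smul, ht, smul_smul, h1 a b ha]

theorem T_lower {T : Module.End 𝕂 (Sp 𝕂 n l)} {u s : 𝕂} {t : ZMod n → ZMod l → 𝕂}
    (hT : T * opX n l ξ = u • (opX n l ξ * T)) (ht : ∀ a b, T (e a b) = t a b • e a b)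
    (h1 : ∀ a b, a ≠ -1 → t (a + 1) b = s * t a b) (h2 : ∀ b, u ^ h * t 0 b = s * t (-1) b)
    (hu : u ^ h * u ^ h = 1) :
    opLower n l ξ c h d * T = s • (T * opLower n l ξ c h d) := by
  refine op_ext fun a b => ?_
  by_cases ha : a = 0
  · have h3 : t 0 b = s * (u ^ h * t (-1) b) := by
      linear_combination (u ^ h) * h2 b - (t 0 b) * hu
    simp only [opLower, Module.End.mul_apply, LinearMap.smul_apply, basisOp_e, ha, if_true,
      map_smul, Xpow_T hT, ht, smul_smul, h3]
    congr 1; ring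
  · have h3 := h1 (a - 1) b (by intro h; apply ha; linear_combination h)
    rw [sub_add_cancel] at h3
    simp only [opLower, Module.End.mul_apply, LinearMap.smul_apply, basisOp_e, ha, if_false,
      map_smul, ht, smul_smul, h3]
    congr 1; ring

theorem raise_X : opX n l ξ * opRaise n l ξ c h = opRaise n l ξ c h * opX n l ξ := by
  refine op_ext fun a b => ?_
  have hc : ∀ v, opX n l ξ ((opX n l ξ ^ h) v) = (opX n l ξ ^ h) (opX n l ξ v) := fun v => by
    rw [← Module.End.mul_apply, ← Module.End.mul_apply, ← pow_succ, pow_succ']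
  by_cases ha : a = -1
  · simp only [opRaise, Module.End.mul_apply, basisOp_e, ha, if_true, map_smul, hc]
    have hx : ∀ a', opX n l ξ (e a' b) =
        if b = -1 then (ξ : 𝕂) • e a' 0 else e a' (b + 1) := fun a' => basisOp_e _ a' b
    by_cases hb : b = -1
    · simp only [hx, if_pos hb, map_smul, basisOp_e, if_true]
      rw [smul_comm]
    · simp only [hx, if_neg hb, basisOp_e, if_true]
  · by_cases hb : b = -1
    · simp only [opRaise, opX, Module.End.mul_apply, basisOp_e, ha, hb, if_true, if_false, map_smul]
    · simp only [opRaise, opX, Module.End.mul_apply, basisOp_e, ha, hb, if_false]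

theorem lower_X : opX n l ξ * opLower n l ξ c h d = opLower n l ξ c h d * opX n l ξ := by
  refine op_ext fun a b => ?_
  have hc : ∀ v, opX n l ξ ((opX n l ξ ^ h) v) = (opX n l ξ ^ h) (opX n l ξ v) := fun v => by
    rw [← Module.End.mul_apply, ← Module.End.mul_apply, ← pow_succ, pow_succ']
  by_cases ha : a = 0
  · simp only [opLower, Module.End.mul_apply, basisOp_e, ha, if_true, map_smul, hc]
    have hx : ∀ a', opX n l ξ (e a' b) =
        if b = -1 then (ξ : 𝕂) • e a' 0 else e a' (b + 1) := fun a' => basisOp_e _ a' b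
    by_cases hb : b = -1
    · simp only [hx, if_pos hb, map_smul, basisOp_e, if_true]
      rw [smul_comm]
    · simp only [hx, if_neg hb, basisOp_e, if_true]
  · by_cases hb : b = -1
    · simp only [opLower, opX, Module.End.mul_apply, basisOp_e, ha, hb, if_true, if_false, map_smul]
      rw [smul_comm]
    · simp only [opLower, opX, Module.End.mul_apply, basisOp_e, ha, hb, if_false, map_smul]

theorem X_pow_e [NeZero l] (a : ZMod n) (m : ℕ) (hm : m < l) :
    (opX n l ξ ^ m) (e a 0) = e a (m : ZMod l) := by
  induction m with
  | zero => simp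
  | succ k ih =>
    have : ((k : ℕ) : ZMod l) ≠ -1 := by
      intro hk
      have h0 : ((k + 1 : ℕ) : ZMod l) = 0 := by push_cast; rw [hk]; ring
      rw [ZMod.natCast_eq_zero_iff] at h0
      exact absurd (Nat.le_of_dvd (by omega) h0) (by omega)
    rw [pow_succ', Module.End.mul_apply, ih (by omega), opX, basisOp_e, if_neg this]
    push_cast; rfl

theorem X_pow_l [NeZero l] : opX n l ξ ^ l = algebraMap 𝕂 _ (ξ : 𝕂) := by
  refine op_ext fun a b => ?_
  have h0 : (opX n l ξ ^ l) (e a 0) = (ξ : 𝕂) • e a 0 := by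
    obtain ⟨k, hk⟩ := Nat.exists_eq_succ_of_ne_zero (NeZero.ne l)
    have h1 : ((k : ℕ) : ZMod l) = -1 := by
      have : ((k + 1 : ℕ) : ZMod l) = 0 := by rw [ZMod.natCast_eq_zero_iff, hk]
      push_cast at this; linear_combination this
    have h2 : opX n l ξ ^ l = opX n l ξ * opX n l ξ ^ k := by
      rw [← pow_succ', ← Nat.succ_eq_add_one, ← hk]
    rw [h2, Module.End.mul_apply, X_pow_e a k (by omega), opX, basisOp_e, if_pos h1]
  have h3 := X_pow_e (ξ := ξ) a b.val b.val_lt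
  rw [ZMod.natCast_zmod_val] at h3
  rw [← h3, ← Module.End.mul_apply, ← pow_add, add_comm, pow_add, Module.End.mul_apply, h0,
    map_smul, Module.algebraMap_end_apply]

theorem raise_lower {c' : 𝕂}
    (hw : (c * c') • opX n l ξ ^ (2 * h) = 1 ∨ d 0 = 0) (a : ZMod n) (b : ZMod l) :
    opRaise n l ξ c h (opLower n l ξ c' h d (e a b)) = d a • e a b := by
  by_cases ha : a = 0
  · have key : opRaise n l ξ c h (opLower n l ξ c' h d (e 0 b)) =
        d 0 • ((c * c') • opX n l ξ ^ (2 * h)) (e 0 b) := by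
      have hc : Commute (opRaise n l ξ c h) (opX n l ξ ^ h) := Commute.pow_right raise_X.symm h
      have hc' := fun v => congrArg (fun S => S v) hc.eq
      simp only [Module.End.mul_apply] at hc'
      rw [opLower, basisOp_e, if_pos rfl, map_smul, hc', opRaise, basisOp_e, if_pos rfl, map_smul,
        LinearMap.smul_apply, two_mul, pow_add, Module.End.mul_apply, smul_smul, smul_smul]
      congr 1; ring
    rw [ha, key]
    rcases hw with hw | hw
    · rw [hw, Module.End.one_apply]
    · rw [hw, zero_smul, zero_smul]
  · have : a - 1 ≠ -1 := fun h => ha (by linear_combination h)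
    simp only [opRaise, opLower, basisOp_e, ha, this, if_false, map_smul, sub_add_cancel]

theorem lower_raise {c' : 𝕂}
    (hw : (c * c') • opX n l ξ ^ (2 * h) = 1 ∨ d 0 = 0) (a : ZMod n) (b : ZMod l) :
    opLower n l ξ c' h d (opRaise n l ξ c h (e a b)) = d (a + 1) • e a b := by
  by_cases ha : a = -1
  · have key : opLower n l ξ c' h d (opRaise n l ξ c h (e (-1) b)) =
        d 0 • ((c * c') • opX n l ξ ^ (2 * h)) (e (-1) b) := by
      have hc : Commute (opLower n l ξ c' h d) (opX n l ξ ^ h) := Commute.pow_right lower_X.symm h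
      have hc' := fun v => congrArg (fun S => S v) hc.eq
      simp only [Module.End.mul_apply] at hc'
      rw [opRaise, basisOp_e, if_pos rfl, map_smul, hc', opLower, basisOp_e, if_pos rfl, map_smul,
        LinearMap.smul_apply, two_mul, pow_add, Module.End.mul_apply, smul_smul, smul_smul]
      congr 1; ring
    rw [ha, key, neg_add_cancel]
    rcases hw with hw | hw
    · rw [hw, Module.End.one_apply]
    · rw [hw, zero_smul, zero_smul]
  · have : a + 1 ≠ 0 := fun h => ha (by linear_combination h)
    simp only [opRaise, opLower, basisOp_e, ha, this, if_false, add_sub_cancel_right]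

theorem K_e (a : ZMod n) (b : ZMod l) :
    opK n l q lam ε (e a b) = (lam * q ^ (ε * a.val - b.val : ℤ) : 𝕂) • e a b :=
  basisOp_e _ a b

theorem D_X {lam' : 𝕂ˣ} [NeZero l] (hq : q ≠ 0) (hl : q ^ l = 1) :
    (opX n l ξ * opY n l q ξ lam' ε) * opX n l ξ =
      q • (opX n l ξ * (opX n l ξ * opY n l q ξ lam' ε)) := by
  rw [mul_assoc, X_Y hq hl, mul_smul_comm]

theorem raise_K [NeZero l] [NeZero n] (hq : q ≠ 0) (hl : q ^ l = 1) (hε : q ^ (ε * n) = q ^ h)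
    (hh : q ^ h * q ^ h = 1) :
    opK n l q lam ε * opRaise n l ξ c h = q ^ ε • (opRaise n l ξ c h * opK n l q lam ε) := by
  have hT : opK n l q lam ε * opX n l ξ = q⁻¹ • (opX n l ξ * opK n l q lam ε) := by
    rw [K_X hq hl, smul_smul, inv_mul_cancel₀ hq, one_smul]
  refine T_raise hT K_e (fun a b ha => ?_) (fun b => ?_)
  · rw [val_succ ha, Nat.cast_add, Nat.cast_one, mul_add, mul_one, add_sub_right_comm,
      zpow_add₀ hq]
    ring
  · rw [val_neg_one', show ε * ((n : ℤ) - 1) - b.val = ε * n + (-ε) + (-(b.val : ℤ)) by ring,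
      zpow_add₀ hq, zpow_add₀ hq, hε, ZMod.val_zero, Nat.cast_zero, mul_zero, zero_sub, zpow_neg _ ε,
      inv_pow, inv_eq_of_mul_eq_one_left hh]
    have := zpow_ne_zero ε hq
    field_simp

theorem lower_K [NeZero l] [NeZero n] (hq : q ≠ 0) (hl : q ^ l = 1) (hε : q ^ (ε * n) = q ^ h)
    (hh : q ^ h * q ^ h = 1) :
    opLower n l ξ c h d * opK n l q lam ε =
      q ^ ε • (opK n l q lam ε * opLower n l ξ c h d) := by
  have hT : opK n l q lam ε * opX n l ξ = q⁻¹ • (opX n l ξ * opK n l q lam ε) := by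
    rw [K_X hq hl, smul_smul, inv_mul_cancel₀ hq, one_smul]
  refine T_lower hT K_e (fun a b ha => ?_) (fun b => ?_) ?_
  · rw [val_succ ha, Nat.cast_add, Nat.cast_one, mul_add, mul_one, add_sub_right_comm,
      zpow_add₀ hq]
    ring
  · rw [val_neg_one', show ε * ((n : ℤ) - 1) - b.val = ε * n + (-ε) + (-(b.val : ℤ)) by ring,
      zpow_add₀ hq, zpow_add₀ hq, hε, ZMod.val_zero, Nat.cast_zero, mul_zero, zero_sub, zpow_neg _ ε,
      inv_pow, inv_eq_of_mul_eq_one_left hh]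
    have := zpow_ne_zero ε hq
    field_simp
  · rw [inv_pow, ← mul_inv, hh, inv_one]

theorem raise_Y [NeZero l] [NeZero n] (hq : q ≠ 0) (hl : q ^ l = 1) (hε : q ^ (ε * n) = q ^ h) :
    opY n l q ξ lam ε * opRaise n l ξ c h = q ^ ε • (opRaise n l ξ c h * opY n l q ξ lam ε) := by
  have key : (opX n l ξ * opY n l q ξ lam ε) * opRaise n l ξ c h =
      q ^ ε • (opRaise n l ξ c h * (opX n l ξ * opY n l q ξ lam ε)) := by
    refine T_raise (D_X hq hl) X_Y_e (fun a b ha => ?_) (fun b => ?_)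
    · rw [val_succ ha, Nat.cast_add, Nat.cast_one, mul_add, mul_one, add_right_comm,
        zpow_add₀ hq]
      ring
    · rw [val_neg_one', show ε * ((n : ℤ) - 1) + b.val = ε * n + (-ε) + b.val by ring,
        zpow_add₀ hq, zpow_add₀ hq, zpow_add₀ hq, hε, ZMod.val_zero, Nat.cast_zero, mul_zero, zpow_zero,
        zpow_neg _ ε]
      have := zpow_ne_zero ε hq
      field_simp
  have h2 := congrArg (fun T => opXinv n l ξ * T) key
  simp only [mul_smul_comm] at h2
  rwa [← mul_assoc (opRaise n l ξ c h), ← raise_X, mul_assoc, mul_assoc, ← mul_assoc (opXinv n l ξ),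
    ← mul_assoc (opXinv n l ξ), Xinv_X, one_mul, one_mul] at h2

theorem lower_Y [NeZero l] [NeZero n] (hq : q ≠ 0) (hl : q ^ l = 1) (hε : q ^ (ε * n) = q ^ h)
    (hh : q ^ h * q ^ h = 1) :
    opLower n l ξ c h d * opY n l q ξ lam ε =
      q ^ ε • (opY n l q ξ lam ε * opLower n l ξ c h d) := by
  have key : opLower n l ξ c h d * (opX n l ξ * opY n l q ξ lam ε) =
      q ^ ε • ((opX n l ξ * opY n l q ξ lam ε) * opLower n l ξ c h d) := by
    refine T_lower (D_X hq hl) X_Y_e (fun a b ha => ?_) (fun b => ?_) hh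
    · rw [val_succ ha, Nat.cast_add, Nat.cast_one, mul_add, mul_one, add_right_comm,
        zpow_add₀ hq]
      ring
    · rw [val_neg_one', show ε * ((n : ℤ) - 1) + b.val = ε * n + (-ε) + b.val by ring,
        zpow_add₀ hq, zpow_add₀ hq, zpow_add₀ hq, hε, ZMod.val_zero, Nat.cast_zero, mul_zero, zpow_zero,
        zpow_neg _ ε]
      have := zpow_ne_zero ε hq
      field_simp
  have h2 := congrArg (fun T => opXinv n l ξ * T) key
  simp only [mul_smul_comm] at h2
  rwa [← mul_assoc (opLower n l ξ c h d), ← lower_X, mul_assoc, mul_assoc,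
    ← mul_assoc (opXinv n l ξ), ← mul_assoc (opXinv n l ξ), Xinv_X, one_mul, one_mul] at h2

theorem val_succ_cast {m : ℕ} [NeZero m] (a : ZMod m) :
    ((a + 1).val : ℤ) = a.val + 1 ∨ ((a + 1).val : ℤ) = a.val + 1 - m := by
  by_cases ha : a = -1
  · right; rw [ha, val_neg_one', neg_add_cancel, ZMod.val_zero]; push_cast; ring
  · left; rw [val_succ ha]; push_cast; ring

theorem zpow_succ_val {m : ℕ} [NeZero m] (hq : q ≠ 0) (k : ℤ) (hm : q ^ (k * m) = 1) (a : ZMod m) :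
    q ^ (k * ((a + 1).val : ℤ)) = q ^ k * q ^ (k * (a.val : ℤ)) := by
  rw [← zpow_add₀ hq]
  rcases val_succ_cast a with h | h
  · rw [h]; congr 1; ring
  · rw [h, show k * ((a.val : ℤ) + 1 - m) = k + k * a.val - k * m by ring, zpow_sub₀ hq, hm, div_one]

end lemmas

variable (lam1 lam2 : 𝕂ˣ) (lam3 c' : 𝕂)

/-- The coefficients `λ₃ - q³(q⁻²ᵃ - 1)λ₁λ₂`. -/
def coeffI (a : ZMod n) : 𝕂 := lam3 - q ^ 3 * (q ^ (-2 * a.val : ℤ) - 1) * lam1 * lam2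

/-- The coefficients `λ₃ + q³(1 - q²ᵃ⁻²)λ₁λ₂`. -/
def coeffII (a : ZMod n) : 𝕂 := lam3 + q ^ 3 * (1 - q ^ (2 * a.val - 2 : ℤ)) * lam1 * lam2

variable {n l q ξ lam1 lam2 lam3 c c' h}

/-- The operators on the span of `e(a,b) = vφᵃXᵇ`, as elements of `End(V)ᵐᵒᵖ` (right action). -/
noncomputable def dataI (hn : n ≠ 0) (hl : l ≠ 0) (hq : q ≠ 0) (hql : q ^ l = 1)
    (hqn : q ^ n = q ^ h) (hqh : q ^ h * q ^ h = 1) (ξ lam1 lam2 : 𝕂ˣ) (lam3 c c' : 𝕂)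
    (hw : (c * c') • opX n l ξ ^ (2 * h) = 1 ∨ coeffI n q lam1 lam2 lam3 0 = 0) :
    BData q (Module.End 𝕂 (Sp 𝕂 n l))ᵐᵒᵖ :=
  haveI : NeZero n := ⟨hn⟩
  haveI : NeZero l := ⟨hl⟩
  have hε : q ^ ((-1 : ℤ) * n) = q ^ h := by
    rw [neg_one_mul, zpow_neg, zpow_natCast, hqn, inv_eq_of_mul_eq_one_left hqh]
  { k := op (opK n l q lam1 (-1))
    ki := op (opKinv n l q lam1 (-1))
    x := op (opX n l ξ)
    xi := op (opXinv n l ξ)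
    y := op (opY n l q ξ lam2 (-1))
    yi := op (opYinv n l q ξ lam2 (-1))
    φ := op (opRaise n l ξ c h)
    ψ := op (opLower n l ξ c' h (coeffI n q lam1 lam2 lam3))
    k_ki := unop_injective (Kinv_K hq)
    ki_k := unop_injective (K_Kinv hq)
    x_xi := unop_injective Xinv_X
    xi_x := unop_injective X_Xinv
    y_yi := unop_injective (Yinv_Y hq)
    yi_y := unop_injective (Y_Yinv hq)
    k_x := unop_injective (K_X hq hql)
    y_k := unop_injective (Y_K hq hql)
    x_y := unop_injective (X_Y hq hql)
    φ_x := unop_injective raise_X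
    y_φ := by
      refine unop_injective ?_
      have := raise_Y (ξ := ξ) (lam := lam2) (c := c) hq hql hε
      simp only [unop_mul, unop_smul, unop_op]
      rw [this, smul_smul, zpow_neg_one, mul_inv_cancel₀ hq, one_smul]
    k_φ := by
      refine unop_injective ?_
      have := raise_K (ξ := ξ) (lam := lam1) (c := c) hq hql hε hqh
      simp only [unop_mul, unop_smul, unop_op]
      rw [this, smul_smul, zpow_neg_one, mul_inv_cancel₀ hq, one_smul]
    ψ_x := unop_injective lower_X
    ψ_y := by
      refine unop_injective ?_
      have := lower_Y (ξ := ξ) (lam := lam2) (c := c') (d := coeffI n q lam1 lam2 lam3)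
        hq hql hε hqh
      simp only [unop_mul, unop_smul, unop_op]
      rw [this, smul_smul, zpow_neg_one, mul_inv_cancel₀ hq, one_smul]
    ψ_k := by
      refine unop_injective ?_
      have := lower_K (ξ := ξ) (lam := lam1) (c := c') (d := coeffI n q lam1 lam2 lam3)
        hq hql hε hqh
      simp only [unop_mul, unop_smul, unop_op]
      rw [this, smul_smul, zpow_neg_one, mul_inv_cancel₀ hq, one_smul]
    ψ_φ := by
      refine unop_injective (op_ext fun a b => ?_)
      simp only [unop_mul, unop_smul, unop_sub, unop_op, LinearMap.sub_apply, LinearMap.smul_apply,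
        Module.End.mul_apply, raise_lower hw, lower_raise hw, X_Y_e, K_e, map_smul, smul_smul]
      rw [← sub_smul]
      congr 1
      have h1 : q ^ ((-2 : ℤ) * n) = 1 := by
        rw [show (-2 : ℤ) * n = (-1) * n + (-1) * n by ring, zpow_add₀ hq, hε, hqh]
      have h2 : q ^ ((-1 : ℤ) * a.val + b.val) * q ^ ((-1 : ℤ) * a.val - b.val) =
          q ^ ((-2 : ℤ) * a.val) := by rw [← zpow_add₀ hq]; congr 1; ring
      have h3 : q ^ 3 * q ^ (-2 : ℤ) = q := by
        rw [← zpow_natCast, ← zpow_add₀ hq]; norm_num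
      simp only [coeffI, zpow_succ_val hq _ h1]
      linear_combination (lam1 * lam2 * q ^ ((-2 : ℤ) * a.val) : 𝕂) * h3 -
        (q * (1 - q ^ 2) * lam1 * lam2) * h2 }

/-- The operators on the span of `e(a,b) = vψᵃXᵇ`, as elements of `End(V)ᵐᵒᵖ` (right action). -/
noncomputable def dataII (hn : n ≠ 0) (hl : l ≠ 0) (hq : q ≠ 0) (hql : q ^ l = 1)
    (hqn : q ^ n = q ^ h) (hqh : q ^ h * q ^ h = 1) (ξ lam1 lam2 : 𝕂ˣ) (lam3 c c' : 𝕂)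
    (hw : (c * c') • opX n l ξ ^ (2 * h) = 1 ∨ coeffII n q lam1 lam2 lam3 0 = 0) :
    BData q (Module.End 𝕂 (Sp 𝕂 n l))ᵐᵒᵖ :=
  haveI : NeZero n := ⟨hn⟩
  haveI : NeZero l := ⟨hl⟩
  have hε : q ^ ((1 : ℤ) * n) = q ^ h := by rw [one_mul, zpow_natCast, hqn]
  { k := op (opK n l q lam1 1)
    ki := op (opKinv n l q lam1 1)
    x := op (opX n l ξ)
    xi := op (opXinv n l ξ)
    y := op (opY n l q ξ lam2 1)
    yi := op (opYinv n l q ξ lam2 1)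
    φ := op (opLower n l ξ c' h (coeffII n q lam1 lam2 lam3))
    ψ := op (opRaise n l ξ c h)
    k_ki := unop_injective (Kinv_K hq)
    ki_k := unop_injective (K_Kinv hq)
    x_xi := unop_injective Xinv_X
    xi_x := unop_injective X_Xinv
    y_yi := unop_injective (Yinv_Y hq)
    yi_y := unop_injective (Y_Yinv hq)
    k_x := unop_injective (K_X hq hql)
    y_k := unop_injective (Y_K hq hql)
    x_y := unop_injective (X_Y hq hql)
    φ_x := unop_injective lower_X
    y_φ := by
      refine unop_injective ?_
      have := lower_Y (ξ := ξ) (lam := lam2) (c := c') (d := coeffII n q lam1 lam2 lam3)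
        hq hql hε hqh
      simpa only [unop_mul, unop_smul, unop_op, zpow_one] using this
    k_φ := by
      refine unop_injective ?_
      have := lower_K (ξ := ξ) (lam := lam1) (c := c') (d := coeffII n q lam1 lam2 lam3)
        hq hql hε hqh
      simpa only [unop_mul, unop_smul, unop_op, zpow_one] using this
    ψ_x := unop_injective raise_X
    ψ_y := by
      refine unop_injective ?_
      have := raise_Y (ξ := ξ) (lam := lam2) (c := c) hq hql hε
      simpa only [unop_mul, unop_smul, unop_op, zpow_one] using this
    ψ_k := by
      refine unop_injective ?_
      have := raise_K (ξ := ξ) (lam := lam1) (c := c) hq hql hε hqh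
      simpa only [unop_mul, unop_smul, unop_op, zpow_one] using this
    ψ_φ := by
      refine unop_injective (op_ext fun a b => ?_)
      simp only [unop_mul, unop_smul, unop_sub, unop_op, LinearMap.sub_apply, LinearMap.smul_apply,
        Module.End.mul_apply, raise_lower hw, lower_raise hw, X_Y_e, K_e, map_smul, smul_smul]
      rw [← sub_smul]
      congr 1
      have h1 : q ^ ((2 : ℤ) * n) = 1 := by
        rw [show (2 : ℤ) * n = 1 * n + 1 * n by ring, zpow_add₀ hq, hε, hqh]
      have h2 : q ^ ((1 : ℤ) * a.val + b.val) * q ^ ((1 : ℤ) * a.val - b.val) =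
          q ^ ((2 : ℤ) * a.val) := by rw [← zpow_add₀ hq]; congr 1; ring
      have h3 : q ^ 3 * (q ^ (2 : ℤ))⁻¹ = q := by
        rw [← zpow_natCast, ← zpow_neg, ← zpow_add₀ hq]; norm_num
      have h4 : q ^ (2 : ℤ) * (q ^ (2 : ℤ))⁻¹ = 1 := mul_inv_cancel₀ (zpow_ne_zero _ hq)
      have h5 : q ^ (2 : ℤ) = q ^ 2 := by norm_cast
      have h6 (m : ℤ) : q ^ (m - 2) = q ^ m * (q ^ (2 : ℤ))⁻¹ := by
        rw [zpow_sub₀ hq, div_eq_mul_inv]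
      simp only [coeffII, h6, zpow_succ_val hq _ h1]
      linear_combination (lam1 * lam2 * q ^ ((2 : ℤ) * a.val) : 𝕂) * h3 -
        (q * (1 - q ^ 2) * lam1 * lam2) * h2 - q ^ 3 * lam1 * lam2 * q ^ ((2 : ℤ) * a.val) * h4 }

theorem pow_two_ne_one (hq : IsPrimitiveRoot q l) (hl : 3 ≤ l) : q ^ 2 ≠ 1 := fun h => by
  have := Nat.le_of_dvd (by norm_num) (hq.dvd_of_pow_eq_one 2 h)
  omega

/-- The right `A`-module on the span of the `e(a,b)` on which `K`, `X`, `Y`, `φ`, `ψ` act through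
the given operators. -/
def BMod (_hq : IsPrimitiveRoot q l) (_hl : 3 ≤ l) (_D : BData q (Module.End 𝕂 (Sp 𝕂 n l))ᵐᵒᵖ) :
    Type _ := Sp 𝕂 n l

section BMod
variable (hq : IsPrimitiveRoot q l) (hl : 3 ≤ l) (D : BData q (Module.End 𝕂 (Sp 𝕂 n l))ᵐᵒᵖ)

noncomputable instance : AddCommGroup (BMod hq hl D) := inferInstanceAs (AddCommGroup (Sp 𝕂 n l))

noncomputable instance : Module 𝕂 (BMod hq hl D) := inferInstanceAs (Module 𝕂 (Sp 𝕂 n l))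

/-- The right action as a homomorphism from `Aᵐᵒᵖ` to the endomorphisms. -/
noncomputable def BMod.action : (A q)ᵐᵒᵖ →ₐ[𝕂] Module.End 𝕂 (Sp 𝕂 n l) :=
  AlgHom.opComm (D.toHom (hq.ne_zero (by omega)) (pow_two_ne_one hq hl))

noncomputable instance : Module (A q)ᵐᵒᵖ (BMod hq hl D) :=
  Module.compHom (Sp 𝕂 n l) (BMod.action hq hl D).toRingHom

instance : IsScalarTower 𝕂 (A q)ᵐᵒᵖ (BMod hq hl D) where
  smul_assoc r a v := by
    have := congrArg (fun T : Module.End 𝕂 (Sp 𝕂 n l) => T v) (map_smul (BMod.action hq hl D) r a)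
    exact this

theorem toHom_of (hq0 : q ≠ 0) (hq2 : q ^ 2 ≠ 1) {R : Type*} [Ring R] [Algebra 𝕂 R]
    (D : BData q R) (g : Gen) : D.toHom hq0 hq2 (A.of q g) = D.act g := by
  simp [BData.toHom, A.of]

/-- The element `φ` of `A` acts through the given operator `φ`. -/
theorem toHom_phi (hq0 : q ≠ 0) (hq2 : q ^ 2 ≠ 1) {R : Type*} [Ring R] [Algebra 𝕂 R]
    (D : BData q R) : D.toHom hq0 hq2 (A.phi q) = D.φ := by
  have hs : q - q⁻¹ ≠ 0 := by
    intro h; apply hq2; field_simp at h; linear_combination h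
  have h1 : D.φ * D.y = q⁻¹ • (D.y * D.φ) := by
    rw [D.y_φ, smul_smul, inv_mul_cancel₀ hq0, one_smul]
  have e3 : D.yi * D.x = q • (D.x * D.yi) := BData.swap_right D.y_yi D.yi_y D.x_y
  have h2 : D.yi * ((D.x - D.φ) * D.y) = q • D.x - q⁻¹ • D.φ := by
    rw [sub_mul, D.x_y, h1, mul_sub, mul_smul_comm, mul_smul_comm, ← mul_assoc, ← mul_assoc,
      D.yi_y, one_mul, one_mul]
  simp only [A.phi, map_sub, map_mul, map_smul, toHom_of, BData.act, smul_mul_assoc,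
    mul_smul_comm, mul_assoc, h2]
  rw [← mul_assoc D.y, D.y_yi, one_mul]
  match_scalars <;> field_simp <;> ring

/-- The element `ψ` of `A` acts through the given operator `ψ`. -/
theorem toHom_psi (hq0 : q ≠ 0) (hq2 : q ^ 2 ≠ 1) {R : Type*} [Ring R] [Algebra 𝕂 R]
    (D : BData q R) : D.toHom hq0 hq2 (A.psi q) = D.ψ := by
  have ht : 1 - q ^ 2 ≠ 0 := fun h => hq2 (by linear_combination -h)
  have h0 : D.ki * D.x = q⁻¹ • (D.x * D.ki) := by
    have : D.x * D.k = q⁻¹ • (D.k * D.x) := by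
      rw [D.k_x, smul_smul, inv_mul_cancel₀ hq0, one_smul]
    exact BData.swap_right D.k_ki D.ki_k this
  have h1 : D.y * D.x = q⁻¹ • (D.x * D.y) := by
    rw [D.x_y, smul_smul, inv_mul_cancel₀ hq0, one_smul]
  have h2 : D.xi * ((D.ψ + q ^ 2 • (D.y * D.ki)) * D.x) = D.ψ + D.y * D.ki := by
    rw [add_mul, D.ψ_x, smul_mul_assoc, mul_assoc, h0, mul_smul_comm, ← mul_assoc D.y, h1,
      smul_mul_assoc, smul_smul, smul_smul, mul_add, mul_smul_comm, mul_assoc D.x, ← mul_assoc,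
      ← mul_assoc, D.xi_x, one_mul, one_mul,
      show q ^ 2 * q⁻¹ * q⁻¹ = 1 by field_simp, one_smul]
  simp only [A.psi, map_sub, map_mul, map_smul, toHom_of, BData.act, smul_mul_assoc,
    mul_smul_comm, mul_assoc, h2]
  rw [← mul_assoc D.x, D.x_xi, one_mul]
  match_scalars <;> field_simp <;> ring

end BMod

/-! ## The modules `N₁, …, N₆` -/

theorem coeffII_zero (hq : q ≠ 0) :
    coeffII n q lam1 lam2 (q * (1 - q ^ 2) * lam1 * lam2) 0 = 0 := by
  have : q ^ (-2 : ℤ) = (q ^ 2)⁻¹ := by rw [zpow_neg]; norm_cast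
  simp only [coeffII, ZMod.val_zero, Nat.cast_zero, mul_zero, zero_sub, this]
  field_simp
  ring

theorem half_pow (hq : IsPrimitiveRoot q l) (he : Even l) :
    q ^ (l / 2) * q ^ (l / 2) = 1 := by
  rw [← pow_add, ← two_mul, Nat.two_mul_div_two_of_even he, hq.pow_eq_one]

section N
variable (hq : IsPrimitiveRoot q l) (hl : 3 ≤ l)

/-- `N₁`, for `l` odd. It has the basis `e(a,b) = vφᵃXᵇ`, `0 ≤ a, b < l`, where `vφˡ = αv`,
`vXˡ = ξv`, `vK = λ₁v`, `vYX = λ₂v`, `vψφ = λ₃v`. -/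
abbrev N1 (α ξ lam1 lam2 : 𝕂ˣ) (lam3 : 𝕂) : Type _ :=
  BMod hq hl (dataI (n := l) (h := 0) (by omega) (by omega) (hq.ne_zero (by omega)) hq.pow_eq_one
    (by rw [hq.pow_eq_one, pow_zero]) (by simp) ξ lam1 lam2 lam3 (α : 𝕂) (α : 𝕂)⁻¹
    (Or.inl (by simp)))

/-- `N₂`, for `l` odd. It has the basis `e(a,b) = vψᵃXᵇ`, `0 ≤ a, b < l`, where `vψˡ = βv`,
`vXˡ = ξv`, `vK = λ₁v`, `vYX = λ₂v`, `vψφ = λ₃v`. -/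
abbrev N2 (β ξ lam1 lam2 : 𝕂ˣ) (lam3 : 𝕂) : Type _ :=
  BMod hq hl (dataII (n := l) (h := 0) (by omega) (by omega) (hq.ne_zero (by omega)) hq.pow_eq_one
    (by rw [hq.pow_eq_one, pow_zero]) (by simp) ξ lam1 lam2 lam3 (β : 𝕂) (β : 𝕂)⁻¹
    (Or.inl (by simp)))

/-- `N₃`, for `l` odd. It has the basis `e(a,b) = uψᵃXᵇ`, `0 ≤ a, b < l`, where `uφ = 0`,
`uψˡ = 0`, `uXˡ = ξu`, `uK = λ₁u`, `uYX = λ₂u`, `uψφ = q(1 - q²)λ₁λ₂u`. -/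
abbrev N3 (ξ lam1 lam2 : 𝕂ˣ) : Type _ :=
  BMod hq hl (dataII (n := l) (h := 0) (by omega) (by omega) (hq.ne_zero (by omega)) hq.pow_eq_one
    (by rw [hq.pow_eq_one, pow_zero]) (by simp) ξ lam1 lam2 (q * (1 - q ^ 2) * lam1 * lam2) 0 0
    (Or.inr (coeffII_zero (hq.ne_zero (by omega)))))

/-- `N₄`, for `l` even. It has the basis `e(a,b) = vφᵃXᵇ`, `0 ≤ a < l/2`, `0 ≤ b < l`, where
`vφ^(l/2)X^(l/2) = α'v`, `vXˡ = ξv`, `vK = λ₁v`, `vYX = λ₂v`, `vψφ = λ₃v`, so that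
`vφ^(l/2) = ξ⁻¹α'vX^(l/2)`. -/
abbrev N4 (he : Even l) (α' ξ lam1 lam2 : 𝕂ˣ) (lam3 : 𝕂) : Type _ :=
  BMod hq hl (dataI (n := l / 2) (h := l / 2) (by omega) (by omega) (hq.ne_zero (by omega))
    hq.pow_eq_one rfl (half_pow hq he) ξ lam1 lam2 lam3 ((ξ : 𝕂)⁻¹ * α') (α' : 𝕂)⁻¹
    (Or.inl (by
      have : NeZero l := ⟨by omega⟩
      have h1 : (ξ : 𝕂)⁻¹ * α' * (α' : 𝕂)⁻¹ * ξ = 1 := by field_simp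
      rw [Nat.two_mul_div_two_of_even he, X_pow_l, Algebra.smul_def, ← map_mul, h1, map_one])))

/-- `N₅`, for `l` even. It has the basis `e(a,b) = uψᵃXᵇ`, `0 ≤ a < l/2`, `0 ≤ b < l`, where
`uφ = 0`, `uψ^(l/2)X^(l/2) = β'u`, `uXˡ = ξu`, `uK = λ₁u`, `uYX = λ₂u`,
`uψφ = q(1 - q²)λ₁λ₂u`, so that `uψ^(l/2) = ξ⁻¹β'uX^(l/2)`. -/
abbrev N5 (he : Even l) (β' ξ lam1 lam2 : 𝕂ˣ) : Type _ :=
  BMod hq hl (dataII (n := l / 2) (h := l / 2) (by omega) (by omega) (hq.ne_zero (by omega))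
    hq.pow_eq_one rfl (half_pow hq he) ξ lam1 lam2 (q * (1 - q ^ 2) * lam1 * lam2)
    ((ξ : 𝕂)⁻¹ * β') 0 (Or.inr (coeffII_zero (hq.ne_zero (by omega)))))

/-- `N₆`, for `l` even. It has the basis `e(a,b) = uψᵃXᵇ`, `0 ≤ a < l/2`, `0 ≤ b < l`, where
`uφ = 0`, `uψ^(l/2) = 0`, `uXˡ = ξu`, `uK = λ₁u`, `uYX = λ₂u`, `uψφ = q(1 - q²)λ₁λ₂u`. -/
abbrev N6 (he : Even l) (ξ lam1 lam2 : 𝕂ˣ) : Type _ :=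
  BMod hq hl (dataII (n := l / 2) (h := l / 2) (by omega) (by omega) (hq.ne_zero (by omega))
    hq.pow_eq_one rfl (half_pow hq he) ξ lam1 lam2 (q * (1 - q ^ 2) * lam1 * lam2) 0 0
    (Or.inr (coeffII_zero (hq.ne_zero (by omega)))))

end N

/-- `X` and `Y` act invertibly on the right `A`-module `M`. -/
def XYInvertible (q : 𝕂) (M : Type*) [AddCommGroup M] [Module (A q)ᵐᵒᵖ M] : Prop :=
  Function.Bijective (fun m : M => op (A.of q .X) • m) ∧
    Function.Bijective (fun m : M => op (A.of q .Y) • m)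

/-- `M` is a simple right `A`-module on which `X` and `Y` act invertibly. -/
structure IsSimpleXY (q : 𝕂) (M : Type*) [AddCommGroup M] [Module (A q)ᵐᵒᵖ M] : Prop where
  simple : IsSimpleModule (A q)ᵐᵒᵖ M
  invertible : XYInvertible q M

/-- `M` is simple as a right `B`-module. -/
abbrev IsSimpleB (q : 𝕂) (M : Type*) [AddCommGroup M] [Module (A q)ᵐᵒᵖ M] : Prop :=
  IsSimpleModule (B q).op M

end Modules
end QuantumPlane

open QuantumPlane

/-! Put n = l, h = 0 for l odd and n = h = l/2 for l even. In both cases q^n = q^h = ±1 and l ∣ 2m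
implies n ∣ m, which lets the two parities share most arguments.

Finiteness. The l-th powers of the generators are central: moving a generator past an l-th power
gives a factor that is an l-th root of unity raised to the l-th power, and the correction terms
carry geometric sums over distinct l-th roots of unity, which vanish. The monomials in X, Y, K, K⁻¹,
E, F span A, so A is finite over a finitely generated central algebra. Zariski's lemma then makes
every simple module finite dimensional.

Simplicity of the models. K and YX are diagonal on the e(a,b) and their joint eigenvalues separate
the basis. A nonzero stable subspace therefore contains some e(a,b), and X, φ, ψ reach all the
others.

Classification. Let M be simple with X and Y invertible. Formulas for E and F in terms of the
generators of B, together with finite dimension, show that B-stable subspaces are A-stable. The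
operators X^l, φ^n X^h and ψ^n X^h commute with A, so they are scalars by Schur's lemma. The
operators K, YX and ψφ commute with one another and have a joint eigenvector. If φ^n X^h ≠ 0, such a
vector v generates a copy of N₁ or N₄ through the vφ^aX^b. Otherwise φ is nilpotent and its kernel
is stable under the three operators; a joint eigenvector u there gives N₂, N₃, N₅ or N₆ through the
uψ^aX^b, according to the parity of l and whether ψ^n X^h vanishes. The map from the model is a
nonzero homomorphism between simple modules, hence an isomorphism.

PI degree. Let N = nl. By Burnside's theorem a simple module of dimension D gives a quotient M_D(𝕂)
of the opposite algebra, hence by transposition one of A, and the staircase of matrix units rules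
out monic identities of degree below 2D. This bounds the dimension of every simple module as soon as
A has an identity of degree 2N. To obtain one, N₁ or N₄ is deformed by five independent parameters
into a representation of A by N × N matrices over a Laurent polynomial ring. It is faithful because
the images of the monomials X^aY^bK^iE^cF^d have leading terms with different exponents. The
Amitsur–Levitzki theorem, proved by Rosset's exterior algebra argument, then supplies the standard
identity of degree 2N. -/

/-! ### Nilpotency of matrices whose positive powers have trace zero. -/

section NilpotentOfTrace

open Polynomial Matrix

variable {ι R : Type*} [Fintype ι] [DecidableEq ι] [CommRing R]

/-- The derivative of a determinant of polynomials, column by column. -/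
theorem derivative_det (N : Matrix ι ι R[X]) :
    derivative N.det = ∑ i, (N.updateCol i fun j => derivative (N j i)).det := by
  simp only [det_apply', map_sum, derivative_mul, derivative_intCast, zero_mul, zero_add,
    derivative_prod_finset]
  rw [Finset.sum_comm]
  refine Finset.sum_congr rfl fun σ _ => ?_
  rw [Finset.mul_sum]
  refine Finset.sum_congr rfl fun i _ => ?_
  congr 1
  rw [← Finset.mul_prod_erase _ _ (Finset.mem_univ i), mul_comm]
  congr 1
  · simp
  · refine Finset.prod_congr rfl fun j hj => ?_
    rw [updateCol_ne (Finset.ne_of_mem_erase hj)]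

/-- Each column of the characteristic matrix differentiates to a standard unit vector, so the
summands of `derivative_det` are the diagonal cofactors. -/
theorem derivative_charpoly (M : Matrix ι ι R) :
    derivative M.charpoly = trace (adjugate (charmatrix M)) := by
  rw [charpoly, derivative_det, ← trace_transpose, adjugate_transpose, trace]
  refine Finset.sum_congr rfl fun i _ => ?_
  rw [diag_apply, adjugate_apply, ← det_transpose, ← updateRow_transpose]
  congr 2
  ext1 j
  by_cases h : j = i
  · subst h; simp [charmatrix_apply_eq]
  · simp [h]

/-- The recursion between the coefficients of the adjugate of the characteristic matrix. -/
theorem coeff_adjugate_charmatrix (M : Matrix ι ι R) (k : ℕ) :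
    (matPolyEquiv (adjugate (charmatrix M))).coeff k =
      M * (matPolyEquiv (adjugate (charmatrix M))).coeff (k + 1) +
        M.charpoly.coeff (k + 1) • 1 := by
  have h := congrArg (fun N => (matPolyEquiv N).coeff (k + 1)) (mul_adjugate (charmatrix M))
  simp only [map_mul, matPolyEquiv_charmatrix, sub_mul, coeff_sub, coeff_X_mul, coeff_C_mul] at h
  rw [← charpoly, matPolyEquiv_smul_one, coeff_map, Algebra.algebraMap_eq_smul_one] at h
  rw [← h]; abel

/-- If all positive powers of `M` have trace zero, so has `M` times each coefficient of the
adjugate of the characteristic matrix. -/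
theorem trace_mul_coeff_adjugate {M : Matrix ι ι R} (hM : ∀ k, 0 < k → trace (M ^ k) = 0) (k : ℕ) :
    trace (M * (matPolyEquiv (adjugate (charmatrix M))).coeff k) = 0 := by
  set p := matPolyEquiv (adjugate (charmatrix M))
  -- Downward induction on the coefficient index, with `d` the distance from above the degree. The
  -- exponent `j` must vary because the recursion trades an index for a factor `M`.
  suffices ∀ d k j, p.natDegree + 1 ≤ k + d → 0 < j → trace (M ^ j * p.coeff k) = 0 by
    simpa using this (p.natDegree + 1) k 1 (by omega) one_pos
  intro d
  induction d with
  | zero =>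
    intro k j hk _
    rw [coeff_eq_zero_of_natDegree_lt (by omega), mul_zero, trace_zero]
  | succ d ih =>
    intro k j hk hj
    rw [coeff_adjugate_charmatrix, mul_add, ← mul_assoc, ← pow_succ, trace_add,
      ih (k + 1) (j + 1) (by omega) (by omega), mul_smul_comm, mul_one, trace_smul, hM j hj,
      smul_zero, add_zero]

/-- Taking traces in (X - M) adj(X - M) = χ · 1 and using tr(M adj(X - M)) = 0 gives Euler's
equation nχ = Xχ'. It reads (n - k)χ_k = 0 on coefficients, and n - k is invertible over ℚ for k ≠
n. -/
theorem charpoly_eq_X_pow_of_trace [Algebra ℚ R] {M : Matrix ι ι R}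
    (hM : ∀ k, 0 < k → trace (M ^ k) = 0) : M.charpoly = X ^ Fintype.card ι := by
  nontriviality R
  have h0 : trace (M.map C * adjugate (charmatrix M)) = 0 := by
    ext k
    rw [coeff_zero, ← trace_mul_coeff_adjugate hM k, trace, trace, finsetSum_coeff]
    refine Finset.sum_congr rfl fun i _ => ?_
    rw [diag_apply, diag_apply, ← matPolyEquiv_coeff_apply, map_mul, matPolyEquiv_map_C,
      coeff_C_mul]
  have h1 : (Fintype.card ι : R[X]) * M.charpoly = X * derivative M.charpoly := by
    have h : trace ((scalar ι X - M.map C) * adjugate (charmatrix M)) = trace (M.charpoly • 1) :=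
      congrArg trace (mul_adjugate (charmatrix M))
    rw [sub_mul, trace_sub, h0, sub_zero, scalar_apply, ← smul_eq_diagonal_mul, trace_smul,
      trace_smul, trace_one, smul_eq_mul, smul_eq_mul, ← derivative_charpoly] at h
    rw [mul_comm]
    exact h.symm
  ext k
  rw [coeff_X_pow]
  split_ifs with hk
  · rw [hk, ← charpoly_natDegree_eq_dim M]; exact charpoly_monic M
  · have h := congrArg (fun p => coeff p k) h1
    have h2 : ((Fintype.card ι : ℚ) - k) • M.charpoly.coeff k = 0 := by
      rw [sub_smul, sub_eq_zero, Nat.cast_smul_eq_nsmul, Nat.cast_smul_eq_nsmul, nsmul_eq_mul,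
        nsmul_eq_mul]
      rcases k with _ | k
      · simpa using h
      · simp only [coeff_X_mul, coeff_derivative, ← C_eq_natCast, coeff_C_mul] at h
        rw [h]; push_cast; ring
    have h3 : ((Fintype.card ι : ℚ) - k) ≠ 0 := by
      exact sub_ne_zero.2 fun h => hk (Nat.cast_injective h).symm
    have := congrArg (fun x => ((Fintype.card ι : ℚ) - k)⁻¹ • x) h2
    simpa [smul_smul, inv_mul_cancel₀ h3] using this

/-- A matrix over a commutative `ℚ`-algebra whose positive powers all have trace zero is
nilpotent. -/
theorem pow_card_eq_zero_of_trace [Algebra ℚ R] {M : Matrix ι ι R}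
    (hM : ∀ k, 0 < k → trace (M ^ k) = 0) : M ^ Fintype.card ι = 0 := by
  have := aeval_self_charpoly M
  rwa [charpoly_eq_X_pow_of_trace hM, map_pow, aeval_X] at this

end NilpotentOfTrace

/-! ### The Amitsur–Levitzki theorem by Rosset's argument. -/

section AmitsurLevitzki

open Matrix

/-- The standard polynomial `∑ sign(σ) x_{σ(1)} ⋯ x_{σ(k)}` as an alternating map. -/
noncomputable def standardPoly (S R : Type*) [CommRing S] [Ring R] [Algebra S R] (k : ℕ) :
    R [⋀^Fin k]→ₗ[S] R :=
  MultilinearMap.alternatization (MultilinearMap.mkPiAlgebraFin S k R)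

theorem standardPoly_apply (S : Type*) {R : Type*} [CommRing S] [Ring R] [Algebra S R] {k : ℕ}
    (x : Fin k → R) :
    standardPoly S R k x =
      ∑ σ : Equiv.Perm (Fin k), Equiv.Perm.sign σ • (List.ofFn fun i => x (σ i)).prod := by
  simp [standardPoly, MultilinearMap.alternatization_apply]

theorem map_standardPoly {S S' R R' : Type*} [CommRing S] [CommRing S'] [Ring R] [Ring R']
    [Algebra S R] [Algebra S' R'] (f : R →+* R') {k : ℕ} (x : Fin k → R) :
    f (standardPoly S R k x) = standardPoly S' R' k fun i => f (x i) := by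
  simp only [standardPoly_apply, map_sum, Units.smul_def, map_zsmul, map_list_prod,
    List.map_ofFn, Function.comp_def]

variable {ι : Type*}

/-- The matrix over an algebra obtained by multiplying a matrix of scalars by an element. -/
def matSMul {K : Type*} {C : Type*} [SMul K C] (M : Matrix ι ι K) (x : C) :
    Matrix ι ι C :=
  Matrix.of fun i j => M i j • x

theorem matSMul_mul [Fintype ι] {K C : Type*} [CommSemiring K] [Semiring C] [Algebra K C]
    (M N : Matrix ι ι K) (x y : C) :
    matSMul M x * matSMul N y = matSMul (M * N) (x * y) := by
  ext i j
  simp [matSMul, mul_apply, Finset.sum_smul, smul_smul, mul_comm]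

theorem matSMul_one [DecidableEq ι] {K C : Type*} [CommSemiring K] [Semiring C] [Algebra K C] :
    matSMul (1 : Matrix ι ι K) (1 : C) = 1 := by
  ext i j
  simp [matSMul, one_apply]

variable [Fintype ι] [DecidableEq ι]

theorem prod_matSMul {K C : Type*} [CommSemiring K] [Semiring C] [Algebra K C] {I : Type*}
    (A : I → Matrix ι ι K) (x : I → C) (s : List I) :
    (s.map fun i => matSMul (A i) (x i)).prod = matSMul (s.map A).prod (s.map x).prod := by
  induction s with
  | nil => simp [matSMul_one]
  | cons i s ih => simp [ih, matSMul_mul]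

section

variable {ι : Type*} {m : ℕ} (A : Fin m → Matrix ι ι ℚ)

/-- The generic matrix `∑ Aᵢ eᵢ` over the exterior algebra. -/
noncomputable def grassmannMatrix : Matrix ι ι (ExteriorAlgebra ℚ (Fin m → ℚ)) :=
  Matrix.of fun a b => ExteriorAlgebra.ι ℚ fun i => A i a b

theorem grassmannMatrix_eq_sum :
    grassmannMatrix A = ∑ i, matSMul (A i) (ExteriorAlgebra.ι ℚ (Pi.single i (1 : ℚ))) := by
  ext1 a b
  simp only [grassmannMatrix, of_apply, Matrix.sum_apply, matSMul, ← map_smul, ← map_sum]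
  congr 1
  ext i
  simp [Finset.sum_apply, Pi.single_apply]

end

variable {m : ℕ} (A : Fin m → Matrix ι ι ℚ)

/-- The coefficient of `e₁ ∧ ⋯ ∧ eₘ`. -/
noncomputable def topCoeff (m : ℕ) : ExteriorAlgebra ℚ (Fin m → ℚ) →ₗ[ℚ] ℚ :=
  ExteriorAlgebra.liftAlternating fun k =>
    if h : k = m then h ▸ (Pi.basisFun ℚ (Fin m)).det else 0

theorem topCoeff_ιMulti (v : Fin m → Fin m → ℚ) :
    topCoeff m (ExteriorAlgebra.ιMulti ℚ m v) = (Pi.basisFun ℚ (Fin m)).det v := by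
  simp [topCoeff, ExteriorAlgebra.liftAlternating_apply_ιMulti]

/-- A repeated basis vector kills the wedge product, and a permutation of the basis contributes its
sign. -/
theorem det_basisFun_comp (f : Fin m → Fin m) :
    topCoeff m (ExteriorAlgebra.ιMulti ℚ m fun j => Pi.basisFun ℚ (Fin m) (f j)) =
      if h : Function.Bijective f then
        ((Equiv.Perm.sign (Equiv.ofBijective f h) : ℤ) : ℚ) else 0 := by
  rw [topCoeff_ιMulti]
  split_ifs with h
  · have := (Pi.basisFun ℚ (Fin m)).det.map_perm (Pi.basisFun ℚ (Fin m)) (Equiv.ofBijective f h)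
    rw [Module.Basis.det_self] at this
    simpa [Function.comp_def, Units.smul_def] using this
  · refine AlternatingMap.map_eq_zero_of_not_injective _ _ fun hi => h ?_
    exact Finite.injective_iff_bijective.1 fun x y hxy => hi (by simp only [hxy])

/-- The m-th power of ∑ Aᵢeᵢ expands into one product of matrices for each map f of the indices,
times the wedge of the corresponding basis vectors. Only permutations survive, with their signs,
which is the standard polynomial. -/
theorem topCoeff_grassmannMatrix_pow (a b : ι) :
    topCoeff m ((grassmannMatrix A ^ m) a b) = standardPoly ℚ _ m A a b := by
  have h1 : grassmannMatrix A ^ m = MultilinearMap.mkPiAlgebraFin ℚ m _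
      fun _ => ∑ i, matSMul (A i) (ExteriorAlgebra.ι ℚ (Pi.basisFun ℚ (Fin m) i)) := by
    rw [grassmannMatrix_eq_sum, MultilinearMap.mkPiAlgebraFin_apply_const]
    simp
  have h2 (f : Fin m → Fin m) : MultilinearMap.mkPiAlgebraFin ℚ m _
      (fun j => matSMul (A (f j)) (ExteriorAlgebra.ι ℚ (Pi.basisFun ℚ (Fin m) (f j)))) =
      matSMul (List.ofFn fun j => A (f j)).prod
        (ExteriorAlgebra.ιMulti ℚ m fun j => Pi.basisFun ℚ (Fin m) (f j)) := by
    have := prod_matSMul A (fun i => ExteriorAlgebra.ι ℚ (Pi.basisFun ℚ (Fin m) i)) (List.ofFn f)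
    simpa only [List.map_ofFn, Function.comp_def, ExteriorAlgebra.ιMulti_apply,
      MultilinearMap.mkPiAlgebraFin_apply] using this
  rw [h1, MultilinearMap.map_sum, Matrix.sum_apply, map_sum, standardPoly_apply, Matrix.sum_apply]
  simp only [h2]
  simp only [matSMul, of_apply, map_smul, det_basisFun_comp]
  let j : Equiv.Perm (Fin m) ↪ (Fin m → Fin m) := ⟨fun σ => σ, DFunLike.coe_injective⟩
  rw [← Finset.sum_subset (Finset.subset_univ (Finset.univ.map j)), Finset.sum_map]
  · refine Finset.sum_congr rfl fun σ _ => ?_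
    have hσ : Equiv.ofBijective (⇑σ) σ.bijective = σ := Equiv.ext fun _ => rfl
    have : Function.Bijective (j σ) := σ.bijective
    rw [dif_pos this]
    change _ • (((Equiv.Perm.sign (Equiv.ofBijective (⇑σ) σ.bijective) : ℤˣ) : ℤ) : ℚ) = _
    rw [hσ, smul_eq_mul, mul_comm, Units.smul_def, Matrix.smul_apply, zsmul_eq_mul]
    rfl
  · intro f _ hf
    rw [dif_neg, smul_zero]
    intro h
    exact hf (Finset.mem_map.2 ⟨Equiv.ofBijective f h, Finset.mem_univ _, rfl⟩)

/-- The products of two vectors in the exterior algebra commute with vectors. -/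
theorem ExteriorAlgebra.ι_mul_ι_comm {S V : Type*} [CommRing S] [AddCommGroup V] [Module S V]
    (u v w : V) : ExteriorAlgebra.ι S u * ExteriorAlgebra.ι S v * ExteriorAlgebra.ι S w =
      ExteriorAlgebra.ι S w * (ExteriorAlgebra.ι S u * ExteriorAlgebra.ι S v) := by
  have h1 := eq_neg_of_add_eq_zero_left (ExteriorAlgebra.ι_add_mul_swap (R := S) v w)
  have h2 := eq_neg_of_add_eq_zero_left (ExteriorAlgebra.ι_add_mul_swap (R := S) u w)
  rw [mul_assoc, h1, mul_neg, ← mul_assoc, h2, neg_mul, neg_neg, mul_assoc]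

/-- The products of two vectors in the exterior algebra. -/
def evenProducts (m : ℕ) : Set (ExteriorAlgebra ℚ (Fin m → ℚ)) :=
  {x | ∃ u v, x = ExteriorAlgebra.ι ℚ u * ExteriorAlgebra.ι ℚ v}

theorem commute_ι_of_mem_adjoin {x : ExteriorAlgebra ℚ (Fin m → ℚ)}
    (hx : x ∈ Algebra.adjoin ℚ (evenProducts m)) (w : Fin m → ℚ) :
    x * ExteriorAlgebra.ι ℚ w = ExteriorAlgebra.ι ℚ w * x := by
  induction hx using Algebra.adjoin_induction with
  | mem x hx =>
    obtain ⟨u, v, rfl⟩ := hx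
    exact ExteriorAlgebra.ι_mul_ι_comm u v w
  | algebraMap r => exact Algebra.commutes r _
  | add x y _ _ hx hy => rw [add_mul, mul_add, hx, hy]
  | mul x y _ _ hx hy => rw [mul_assoc, hy, ← mul_assoc, hx, mul_assoc]

/-- The commutative algebra generated by the products of two vectors. -/
noncomputable instance evenCommRing (m : ℕ) : CommRing (Algebra.adjoin ℚ (evenProducts m)) :=
  { Subalgebra.toRing (Algebra.adjoin ℚ (evenProducts m)) with
    mul_comm := (Algebra.isMulCommutative_adjoin ℚ (by
      rintro x hx _ ⟨u, v, rfl⟩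
      have hx := Algebra.subset_adjoin (R := ℚ) hx
      rw [← mul_assoc, commute_ι_of_mem_adjoin hx, mul_assoc, commute_ι_of_mem_adjoin hx,
        mul_assoc])).is_comm.comm }

-- The trace is its own negative. Commuting `D` past one factor cycles the product without a sign,
-- while interchanging the odd entries of the two Grassmann matrices costs a sign; the entries of
-- `D` are even and pass freely. It is used with `D` an even power of the Grassmann matrix.
omit [DecidableEq ι] in
theorem trace_grassmannMatrix_pow {D : Matrix ι ι (ExteriorAlgebra ℚ (Fin m → ℚ))}
    (hD : ∀ i j, D i j ∈ Algebra.adjoin ℚ (evenProducts m))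
    (hc : Commute D (grassmannMatrix A)) :
    trace (D * (grassmannMatrix A * grassmannMatrix A)) = 0 := by
  set B := grassmannMatrix A
  have h1 : trace (D * (B * B)) = trace (B * (D * B)) := by
    rw [← mul_assoc D, ← mul_assoc B, hc.eq]
  have h2 : trace (B * (D * B)) = -trace (D * (B * B)) := by
    have e1 : trace (B * (D * B)) = ∑ a, ∑ b, ∑ c, D b c * (B a b * B c a) := by
      simp only [trace, diag_apply, mul_apply, Finset.mul_sum]
      refine Finset.sum_congr rfl fun a _ => Finset.sum_congr rfl fun b _ =>
        Finset.sum_congr rfl fun c _ => ?_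
      have h : D b c * B a b = B a b * D b c := commute_ι_of_mem_adjoin (hD b c) _
      rw [← mul_assoc, ← mul_assoc, h]
    have e2 : trace (D * (B * B)) = ∑ b, ∑ c, ∑ a, D b c * (B c a * B a b) := by
      simp only [trace, diag_apply, mul_apply, Finset.mul_sum]
    rw [e1, e2, Finset.sum_comm, ← Finset.sum_neg_distrib]
    refine Finset.sum_congr rfl fun b _ => ?_
    rw [Finset.sum_comm, ← Finset.sum_neg_distrib]
    refine Finset.sum_congr rfl fun c _ => ?_
    rw [← Finset.sum_neg_distrib]
    refine Finset.sum_congr rfl fun a _ => ?_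
    rw [← mul_neg]
    congr 1
    exact eq_neg_of_add_eq_zero_left (ExteriorAlgebra.ι_add_mul_swap _ _)
  have h3 : (2 : ℚ) • trace (D * (B * B)) = 0 := by
    rw [two_smul]; nth_rw 1 [h1]; rw [h2, neg_add_cancel]
  exact (smul_eq_zero.1 h3).resolve_left two_ne_zero

theorem trace_grassmannMatrix_sq_pow (k : ℕ) (hk : 0 < k) :
    trace ((grassmannMatrix A * grassmannMatrix A) ^ k) = 0 := by
  obtain ⟨k, rfl⟩ := Nat.exists_eq_succ_of_ne_zero hk.ne'
  rw [pow_succ]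
  refine trace_grassmannMatrix_pow A ?_
    (((Commute.refl _).mul_left (Commute.refl _)).pow_left k)
  induction k with
  | zero =>
    intro i j
    rw [pow_zero, one_apply]
    split_ifs
    exacts [one_mem _, zero_mem _]
  | succ k ih =>
    intro i j
    rw [pow_succ, mul_apply]
    refine sum_mem fun c _ => mul_mem (ih k.succ_pos i c) ?_
    rw [mul_apply]
    exact sum_mem fun k _ => Algebra.subset_adjoin ⟨_, _, rfl⟩

/-- The trace criterion needs commuting entries. This transports it to a noncommutative ring for
matrices whose entries lie in a commutative subring. -/
theorem pow_card_eq_zero_of_trace_of_injective {R S : Type*} [CommRing R] [Algebra ℚ R] [Ring S]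
    {f : R →+* S} (hf : Function.Injective f) (M : Matrix ι ι R)
    (h : ∀ k, 0 < k → trace ((M.map f) ^ k) = 0) : (M.map f) ^ Fintype.card ι = 0 := by
  have hM (k : ℕ) : (M ^ k).map f = (M.map f) ^ k := map_pow f.mapMatrix M k
  have h0 : M ^ Fintype.card ι = 0 := by
    refine pow_card_eq_zero_of_trace fun k hk => hf ?_
    rw [map_zero, ← h k hk, ← hM]
    exact AddMonoidHom.map_trace f.toAddMonoidHom _
  rw [← hM, h0]
  exact map_zero f.mapMatrix

/-- The square of the Grassmann matrix has entries in the commutative even subalgebra and its powers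
have trace zero, so it is nilpotent of order at most the size of the matrix. -/
theorem grassmannMatrix_pow_eq_zero : grassmannMatrix A ^ (2 * Fintype.card ι) = 0 := by
  have hB : ∀ i j, (grassmannMatrix A * grassmannMatrix A) i j ∈
      Algebra.adjoin ℚ (evenProducts m) := fun i j => by
    rw [mul_apply]
    exact sum_mem fun k _ => Algebra.subset_adjoin ⟨_, _, rfl⟩
  rw [pow_mul, pow_two]
  let M : Matrix ι ι (Algebra.adjoin ℚ (evenProducts m)) := Matrix.of fun i j => ⟨_, hB i j⟩
  exact pow_card_eq_zero_of_trace_of_injective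
    (f := (Algebra.adjoin ℚ (evenProducts m)).val.toRingHom) Subtype.val_injective M
    (trace_grassmannMatrix_sq_pow A)

/-- The **Amitsur–Levitzki theorem** over `ℚ`. -/
theorem standardPoly_matrix_rat (A : Fin (2 * Fintype.card ι) → Matrix ι ι ℚ) :
    standardPoly ℚ _ _ A = 0 := by
  ext a b
  rw [← topCoeff_grassmannMatrix_pow, grassmannMatrix_pow_eq_zero]
  simp

/-- The **Amitsur–Levitzki theorem**: matrices of size `n` over a commutative ring satisfy the
standard identity of degree `2n`. -/
theorem standardPoly_matrix (S : Type*) [CommRing S] :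
    standardPoly S (Matrix ι ι S) (2 * Fintype.card ι) = 0 := by
  -- By multilinearity it suffices to evaluate on matrix units. These come from ℤ, and the identity
  -- over ℤ follows from the one over ℚ.
  refine AlternatingMap.coe_multilinearMap_injective
    (Module.Basis.ext_multilinear (fun _ => Matrix.stdBasis S ι ι) fun v => ?_)
  let F : Fin (2 * Fintype.card ι) → Matrix ι ι ℤ := fun i => Matrix.stdBasis ℤ ι ι (v i)
  have h1 : standardPoly ℤ (Matrix ι ι ℤ) _ F = 0 := by
    have hinj : Function.Injective (Int.castRingHom ℚ).mapMatrix :=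
      Matrix.map_injective (m := ι) (n := ι) (Int.castRingHom ℚ).injective_int
    apply hinj
    rw [map_standardPoly (S' := ℚ), standardPoly_matrix_rat, map_zero]
  have h2 := congrArg (Int.castRingHom S).mapMatrix h1
  rw [map_standardPoly (S' := S), map_zero] at h2
  have h3 : (fun i => (Int.castRingHom S).mapMatrix (F i)) =
      fun i => Matrix.stdBasis S ι ι (v i) := by
    ext i a b
    rcases hv : v i with ⟨c, d⟩
    simp [F, hv, Matrix.stdBasis_eq_single, Matrix.single_apply]
  rw [h3] at h2
  exact h2

end AmitsurLevitzki

/-! ### Monic identities: polarization and the staircase lower bound for matrices. -/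

section MonicIdentity

variable {R S : Type*} [Ring R] [Ring S]

theorem map_lift_freeMonoid (g : R →+* S) (x : ℕ → R) (f : MonoidAlgebra ℤ (FreeMonoid ℕ)) :
    g (MonoidAlgebra.lift ℤ R (FreeMonoid ℕ) (FreeMonoid.lift x) f) =
      MonoidAlgebra.lift ℤ S (FreeMonoid ℕ) (FreeMonoid.lift fun i => g (x i)) f := by
  simp only [MonoidAlgebra.lift_apply, Finsupp.sum, map_sum, map_zsmul]
  refine Finset.sum_congr rfl fun w _ => ?_
  congr 1
  simp [FreeMonoid.lift_apply, map_list_prod, Function.comp_def]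

theorem HasMonicIdentity.of_surjective {d : ℕ} (h : HasMonicIdentity R d) (g : R →+* S)
    (hg : Function.Surjective g) : HasMonicIdentity S d := by
  obtain ⟨f, h1, h2, h3⟩ := h
  refine ⟨f, h1, h2, fun x => ?_⟩
  choose y hy using fun i => hg (x i)
  obtain rfl : (fun i => g (y i)) = x := funext hy
  rw [← map_lift_freeMonoid, h3, map_zero]

/-- Different permutations give different words, so nothing cancels in the standard polynomial and
the identity permutation has coefficient 1. -/
theorem hasMonicIdentity_of_standardPoly {T : Type*} [CommRing T] [Algebra T R] {k : ℕ}
    (h : standardPoly T R k = 0) : HasMonicIdentity R k := by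
  let w (σ : Equiv.Perm (Fin k)) : FreeMonoid ℕ :=
    FreeMonoid.ofList (List.ofFn fun i => ((σ i : Fin k) : ℕ))
  have hw : Function.Injective w := fun σ τ hst => by
    have := List.ofFn_injective (FreeMonoid.ofList.injective hst)
    exact Equiv.ext fun i => Fin.ext (congrFun this i)
  have hlen (σ) : (w σ).length = k := by simp [w, FreeMonoid.length]
  refine ⟨∑ σ : Equiv.Perm (Fin k), MonoidAlgebra.single (w σ) (Equiv.Perm.sign σ : ℤ), ?_, ?_, ?_⟩
  · intro v hv
    by_contra hlt
    apply hv
    rw [MonoidAlgebra.coeff_sum, Finsupp.finsetSum_apply]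
    refine Finset.sum_eq_zero fun σ _ => ?_
    rw [MonoidAlgebra.coeff_single, Finsupp.single_eq_of_ne]
    rintro rfl
    exact hlt (hlen σ).le
  · refine ⟨w 1, hlen 1, ?_⟩
    rw [MonoidAlgebra.coeff_sum, Finsupp.finsetSum_apply, Finset.sum_eq_single 1]
    · simp
    · intro σ _ hσ
      rw [MonoidAlgebra.coeff_single, Finsupp.single_eq_of_ne fun h => hσ (hw h.symm)]
    · simp
  · intro x
    have := standardPoly_apply T fun i : Fin k => x i
    rw [h] at this
    simp only [map_sum, MonoidAlgebra.lift_single]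
    refine Eq.trans (Finset.sum_congr rfl fun σ _ => ?_) this.symm
    rw [Units.smul_def]
    congr 1
    simp [w, FreeMonoid.lift_apply, List.map_ofFn, Function.comp_def]

/-- Inclusion–exclusion: the sum is the expansion of a product with one factor per index, equal to
-1 on `T` and to -1 + 1 = 0 off `T`. -/
theorem sum_neg_one_pow_card_of_subset {d : ℕ} (T : Finset (Fin d)) :
    ∑ U : Finset (Fin d), (if T ⊆ U then (-1 : ℤ) ^ U.card else 0) =
      if T = Finset.univ then (-1) ^ d else 0 := by
  have h := Finset.prod_add (fun _ : Fin d => (-1 : ℤ)) (fun i => if i ∈ T then 0 else 1)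
    Finset.univ
  rw [Finset.powerset_univ] at h
  have h1 (U : Finset (Fin d)) : ((∏ _i ∈ U, (-1 : ℤ)) * ∏ i ∈ Finset.univ \ U,
      if i ∈ T then (0 : ℤ) else 1) = if T ⊆ U then (-1 : ℤ) ^ U.card else 0 := by
    rw [Finset.prod_const]
    split_ifs with hT
    · rw [Finset.prod_eq_one, mul_one]
      intro i hi
      rw [if_neg fun hiT => (Finset.mem_sdiff.1 hi).2 (hT hiT)]
    · obtain ⟨i, hiT, hiU⟩ := Finset.not_subset.1 hT
      have h0 : (∏ i ∈ Finset.univ \ U, if i ∈ T then (0 : ℤ) else 1) = 0 :=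
        Finset.prod_eq_zero (Finset.mem_sdiff.2 ⟨Finset.mem_univ i, hiU⟩) (if_pos hiT)
      rw [h0, mul_zero]
  rw [← Finset.sum_congr rfl fun U _ => h1 U, ← h]
  split_ifs with hT
  · simp [hT]
  · obtain ⟨i, hi⟩ : ∃ i, i ∉ T := by
      by_contra! hne
      exact hT (Finset.eq_univ_iff_forall.2 hne)
    exact Finset.prod_eq_zero (Finset.mem_univ i) (by simp [hi])

/-- Polarization of a word of length at most `d` along `s₁, …, s_d`. -/
theorem polarize_word {d : ℕ} (s : Fin d → R) (w : Fin d → ℕ)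
    (hs : ∀ p : Fin d → Fin d, Function.Bijective p → p ≠ id → (List.ofFn fun i => s (p i)).prod = 0)
    (v : List ℕ) (hv : v.length ≤ d) :
    ∑ U : Finset (Fin d), (-1 : ℤ) ^ U.card •
        (v.map fun i => ∑ j ∈ Finset.univ.filter (fun j => w j = i),
          (if j ∈ U then (1 : ℤ) else 0) • s j).prod =
      if v = List.ofFn w then (-1 : ℤ) ^ d • (List.ofFn s).prod else 0 := by
  classical
  -- Expanding the product chooses an index `p t` at each position of the word. The indicator of `U`
  -- retains the choices whose image lies in `U`.
  have h1 (U : Finset (Fin d)) : (v.map fun i => ∑ j ∈ Finset.univ.filter (fun j => w j = i),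
      (if j ∈ U then (1 : ℤ) else 0) • s j).prod =
      ∑ p ∈ Fintype.piFinset fun t : Fin v.length => Finset.univ.filter (fun j => w j = v.get t),
        (if Finset.univ.image p ⊆ U then (1 : ℤ) else 0) • (List.ofFn fun t => s (p t)).prod := by
    have e1 : (v.map fun i => ∑ j ∈ Finset.univ.filter (fun j => w j = i),
      (if j ∈ U then (1 : ℤ) else 0) • s j).prod =
      MultilinearMap.mkPiAlgebraFin ℤ v.length R fun t : Fin v.length =>
        ∑ j ∈ Finset.univ.filter (fun j => w j = v.get t),
          (if j ∈ U then (1 : ℤ) else 0) • s j := by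
      rw [MultilinearMap.mkPiAlgebraFin_apply]
      congr 1
      conv_lhs => rw [← List.ofFn_get v]
      rw [List.map_ofFn]
      rfl
    rw [e1, MultilinearMap.map_sum_finset]
    refine Finset.sum_congr rfl fun p _ => ?_
    rw [MultilinearMap.map_smul_univ, MultilinearMap.mkPiAlgebraFin_apply]
    congr 1
    split_ifs with hp
    · refine Finset.prod_eq_one fun t _ => if_pos (hp (Finset.mem_image_of_mem _ ?_))
      exact Finset.mem_univ t
    · obtain ⟨i, hi, hiU⟩ := Finset.not_subset.1 hp
      obtain ⟨t, _, rfl⟩ := Finset.mem_image.1 hi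
      exact Finset.prod_eq_zero (Finset.mem_univ t) (if_neg hiU)
  -- The alternating sum over `U` removes all choices that are not surjective. Since the word has
  -- length at most `d`, the remaining ones are bijections on a word of length `d`, and by `hs` only
  -- the identity contributes.
  have h2 (p : Fin v.length → Fin d) : ∑ U : Finset (Fin d), (-1 : ℤ) ^ U.card •
      ((if Finset.univ.image p ⊆ U then (1 : ℤ) else 0) • (List.ofFn fun t => s (p t)).prod) =
      (if Function.Surjective p then (-1 : ℤ) ^ d else 0) • (List.ofFn fun t => s (p t)).prod := by
    have e2 : Function.Surjective p ↔ Finset.univ.image p = Finset.univ := by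
      simp [Finset.eq_univ_iff_forall, Function.Surjective]
    simp only [e2, ← sum_neg_one_pow_card_of_subset, Finset.sum_smul, smul_smul, mul_ite, mul_one,
      mul_zero]
  simp only [h1, Finset.smul_sum]
  rw [Finset.sum_comm, Finset.sum_congr rfl fun p _ => h2 p]
  by_cases hvd : v.length = d
  · subst hvd
    have h3 (p : Fin v.length → Fin v.length) (hp : p ≠ id) :
        (if Function.Surjective p then (-1 : ℤ) ^ v.length else 0) •
          (List.ofFn fun t => s (p t)).prod = 0 := by
      split_ifs with hps
      · rw [hs p (Finite.surjective_iff_bijective.1 hps) hp, smul_zero]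
      · rw [zero_smul]
    have h4 : v = List.ofFn w ↔ id ∈ Fintype.piFinset fun t : Fin v.length =>
        Finset.univ.filter (fun j => w j = v.get t) := by
      simp only [Fintype.mem_piFinset, id, Finset.mem_filter, Finset.mem_univ, true_and]
      nth_rw 1 [← List.ofFn_get v]
      rw [List.ofFn_injective.eq_iff, funext_iff]
      exact forall_congr' fun _ => eq_comm
    split_ifs with hw
    · rw [Finset.sum_eq_single id (fun p _ hp => h3 p hp) fun h => absurd (h4.1 hw) h,
        if_pos Function.surjective_id]
      rfl
    · exact Finset.sum_eq_zero fun p hp => h3 p fun h => hw (h4.2 (h ▸ hp))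
  · rw [if_neg (by rintro rfl; simp at hvd)]
    refine Finset.sum_eq_zero fun p _ => ?_
    rw [if_neg, zero_smul]
    intro hp
    have := Fintype.card_le_of_surjective p hp
    simp at this
    omega

/-- A ring with a staircase of length `d` satisfies no monic identity of degree `d`. -/
theorem not_hasMonicIdentity_of_staircase {d : ℕ} (s : Fin d → R)
    (hs : ∀ p : Fin d → Fin d, Function.Bijective p → p ≠ id → (List.ofFn fun i => s (p i)).prod = 0)
    (h0 : (List.ofFn s).prod ≠ 0) : ¬ HasMonicIdentity R d := by
  classical
  rintro ⟨f, hf, ⟨u, hu, hu1⟩, hid⟩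
  obtain ⟨w, hw⟩ : ∃ w : Fin d → ℕ, FreeMonoid.toList u = List.ofFn w := by
    subst hu
    exact ⟨(FreeMonoid.toList u).get, (List.ofFn_get _).symm⟩
  -- The alternating sum of evaluations of `f` isolates the word `u`, whose coefficient is 1. Every
  -- evaluation vanishes, so the product of the staircase would vanish too.
  have key : ∑ U : Finset (Fin d), (-1 : ℤ) ^ U.card • MonoidAlgebra.lift ℤ R (FreeMonoid ℕ)
      (FreeMonoid.lift fun i => ∑ j ∈ Finset.univ.filter (fun j => w j = i),
        (if j ∈ U then (1 : ℤ) else 0) • s j) f = (-1 : ℤ) ^ d • (List.ofFn s).prod := by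
    simp only [MonoidAlgebra.lift_apply, Finsupp.sum, Finset.smul_sum]
    rw [Finset.sum_comm]
    have h1 (v : FreeMonoid ℕ) (hv : v ∈ f.coeff.support) :
        ∑ U : Finset (Fin d), (-1 : ℤ) ^ U.card • f.coeff v • FreeMonoid.lift
          (fun i => ∑ j ∈ Finset.univ.filter (fun j => w j = i),
            (if j ∈ U then (1 : ℤ) else 0) • s j) v =
          f.coeff v • if v = u then (-1 : ℤ) ^ d • (List.ofFn s).prod else 0 := by
      have := polarize_word s w hs (FreeMonoid.toList v) (hf v (Finsupp.mem_support_iff.1 hv))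
      simp only [← hw, FreeMonoid.toList.injective.eq_iff] at this
      rw [← this, Finset.smul_sum]
      refine Finset.sum_congr rfl fun U _ => ?_
      rw [smul_comm, FreeMonoid.lift_apply]
    rw [Finset.sum_congr rfl h1, Finset.sum_eq_single u, if_pos rfl, hu1, one_smul]
    · intro v _ hv
      rw [if_neg hv, smul_zero]
    · intro h
      rw [Finsupp.notMem_support_iff] at h
      rw [h, zero_smul]
  simp only [hid, smul_zero, Finset.sum_const_zero] at key
  rcases neg_one_pow_eq_or ℤ d with h | h <;> rw [h] at key <;>
    simp at key <;> first | exact h0 key | exact h0 key.symm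

/-- The staircase `e₁₁, e₁₂, e₂₂, e₂₃, …` of matrix units. -/
def staircase (n : ℕ) (C : Type*) [Zero C] [One C] (j : ℕ) : Matrix (Fin n) (Fin n) C :=
  Matrix.of fun a b => if (a : ℕ) = j / 2 ∧ (b : ℕ) = (j + 1) / 2 then 1 else 0

theorem staircase_mul {n : ℕ} {C : Type*} [CommRing C] {j k : ℕ}
    (h : (j + 1) / 2 ≠ k / 2) : staircase n C j * staircase n C k = 0 := by
  ext a b
  simp only [staircase, Matrix.mul_apply, Matrix.of_apply, Matrix.zero_apply]
  refine Finset.sum_eq_zero fun c _ => ?_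
  by_cases h1 : (c : ℕ) = (j + 1) / 2
  · rw [if_neg (c := (c : ℕ) = k / 2 ∧ _) fun h2 => h (h1 ▸ h2.1), mul_zero]
  · rw [if_neg fun h2 => h1 h2.2, zero_mul]

/-- Each matrix unit starts at the index where the previous one ends, so exactly one path
contributes. The offset `i` is what the induction on the length needs. -/
theorem staircase_prod_apply {n : ℕ} {C : Type*} [CommRing C] (d i : ℕ) (a b : Fin n)
    (ha : (a : ℕ) = i / 2) (hb : (b : ℕ) = (i + d) / 2) :
    (List.ofFn fun j : Fin d => staircase n C (i + j)).prod a b = 1 := by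
  induction d generalizing i a with
  | zero =>
    obtain rfl : a = b := Fin.ext (by rw [ha, hb, add_zero])
    simp
  | succ d ih =>
    have hb' := b.2
    have hc : (i + 1) / 2 < n := by omega
    rw [List.ofFn_succ, List.prod_cons, Matrix.mul_apply, Finset.sum_eq_single ⟨(i + 1) / 2, hc⟩]
    · have h1 := ih (i + 1) ⟨(i + 1) / 2, hc⟩ rfl (by rw [hb]; congr 1; ring)
      have h2 : (fun j : Fin d => staircase n C (i + (j.succ : Fin (d + 1)))) =
          fun j : Fin d => staircase n C (i + 1 + j) := by
        funext j; congr 1; rw [Fin.val_succ]; ring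
      rw [h2, h1, mul_one]
      simp [staircase, ha]
    · intro c _ hc'
      have : ¬ (c : ℕ) = (i + 1) / 2 := fun h => hc' (Fin.ext h)
      simp [staircase, this]
    · simp

theorem List.prod_ofFn_eq_zero_of_mul_eq_zero {T : Type*} [MonoidWithZero T] {d : ℕ} (f : Fin d → T)
    (i : ℕ) (hi : i + 1 < d) (h : f ⟨i, by omega⟩ * f ⟨i + 1, hi⟩ = 0) : (List.ofFn f).prod = 0 := by
  induction d generalizing i with
  | zero => omega
  | succ d ih =>
    rw [List.ofFn_succ, List.prod_cons]
    rcases i with _ | i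
    · obtain ⟨d, rfl⟩ := Nat.exists_eq_succ_of_ne_zero (show d ≠ 0 by omega)
      rw [List.ofFn_succ, List.prod_cons, ← mul_assoc]
      have : f 0 * f (Fin.succ 0) = 0 := h
      rw [this, zero_mul]
    · rw [ih (fun j => f j.succ) i (by omega) h, mul_zero]

/-- Matrices of size `n` satisfy no monic identity of degree less than `2n`. -/
theorem HasMonicIdentity.two_mul_le {n d : ℕ} {C : Type*} [CommRing C] [Nontrivial C]
    (h : HasMonicIdentity (Matrix (Fin n) (Fin n) C) d) : 2 * n ≤ d := by
  by_contra! hd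
  refine not_hasMonicIdentity_of_staircase (fun j : Fin d => staircase n C j) (fun p hp hne => ?_)
    (fun h0 => ?_) h
  · by_contra hprod
    apply hne
    -- A nonzero product of consecutive units forces (p i + 1)/2 = p(i+1)/2, which is impossible if
    -- p(i+1) < p i. Hence `p` is strictly increasing and so is the identity.
    have hlt : ∀ i (hi : i + 1 < d), p ⟨i, by omega⟩ < p ⟨i + 1, hi⟩ := by
      intro i hi
      by_contra! hle
      apply hprod
      refine List.prod_ofFn_eq_zero_of_mul_eq_zero _ i hi (staircase_mul ?_)
      have hne : p ⟨i, by omega⟩ ≠ p ⟨i + 1, hi⟩ := fun h => by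
        have := congrArg Fin.val (hp.1 h)
        simp at this
      have := Fin.lt_def.1 (lt_of_le_of_ne hle hne.symm)
      omega
    have hmono : StrictMono p := by
      rcases d with _ | d
      · exact fun i => i.elim0
      · exact Fin.strictMono_iff_lt_succ.2 fun i => hlt i (by omega)
    exact hmono.eq_id
  · have := congrFun (congrFun h0 ⟨0, by omega⟩) ⟨d / 2, by omega⟩
    have h1 := staircase_prod_apply (C := C) (n := n) d 0 ⟨0, by omega⟩ ⟨d / 2, by omega⟩ rfl (by simp)
    simp only [zero_add] at h1
    rw [h1] at this
    exact one_ne_zero this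

end MonicIdentity

/-! ### Burnside's theorem and the dimension bound from an identity. -/

section Burnside

variable {𝕂 R V : Type*} [Field 𝕂] [IsAlgClosed 𝕂] [Ring R] [Algebra 𝕂 R] [AddCommGroup V]
  [Module 𝕂 V] [Module R V] [IsScalarTower 𝕂 R V] [IsSimpleModule R V] [FiniteDimensional 𝕂 V]

/-- **Burnside's theorem**: an algebra over an algebraically closed field acts on a simple module of
finite dimension through all linear maps. -/
theorem lsmul_surjective_of_isSimpleModule :
    Function.Surjective (Algebra.lsmul 𝕂 𝕂 V : R →ₐ[𝕂] Module.End 𝕂 V) := by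
  classical
  have hb := IsSimpleModule.algebraMap_end_bijective_of_isAlgClosed (A := R) (V := V) 𝕂
  intro T
  -- By Schur's lemma the endomorphisms of the simple module are scalars, so every linear `T`
  -- commutes with them. The density theorem then realizes `T` on a finite spanning set.
  let f : Module.End (Module.End R V) V :=
    { toFun := T
      map_add' := map_add T
      map_smul' := fun g v => by
        obtain ⟨c, rfl⟩ := hb.2 g
        simp }
  obtain ⟨s, hs⟩ := Module.Finite.fg_top (R := 𝕂) (M := V)
  obtain ⟨r, hr⟩ := jacobson_density f s
  refine ⟨r, ?_⟩
  refine LinearMap.ext_on hs fun v hv => ?_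
  exact (hr v hv).symm

/-- A simple module of an algebra with a monic identity of degree `d` has dimension at most
`d / 2`. -/
theorem HasMonicIdentity.two_mul_finrank_le {d : ℕ} (h : HasMonicIdentity Rᵐᵒᵖ d) :
    2 * Module.finrank 𝕂 V ≤ d := by
  let b := Module.finBasis 𝕂 V
  let e := (LinearMap.toMatrixAlgEquiv b).toRingEquiv
  let g : R →+* Matrix (Fin (Module.finrank 𝕂 V)) (Fin (Module.finrank 𝕂 V)) 𝕂 :=
    e.toRingHom.comp (Algebra.lsmul 𝕂 𝕂 V : R →ₐ[𝕂] Module.End 𝕂 V).toRingHom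
  have hg : Function.Surjective g := e.surjective.comp lsmul_surjective_of_isSimpleModule
  -- Transposition identifies the matrix ring with its opposite, so `Rᵐᵒᵖ` also maps onto the
  -- matrices.
  let t := (Matrix.transposeRingEquiv (Fin (Module.finrank 𝕂 V)) 𝕂).symm
  refine (h.of_surjective (t.toRingHom.comp g.op) ?_).two_mul_le
  refine t.surjective.comp fun x => ?_
  obtain ⟨r, hr⟩ := hg x.unop
  exact ⟨op r, by simp [RingHom.op, hr]⟩

end Burnside

/-! ### Commutation with powers up to inhomogeneous terms. -/

section SkewDerivation

variable {𝕂 R : Type*} [Field 𝕂] [Ring R] [Algebra 𝕂 R]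

theorem mul_pow_of_skew {a b : R} {s : 𝕂} (h : a * b = s • (b * a)) (n : ℕ) :
    a * b ^ n = s ^ n • (b ^ n * a) := by
  induction n with
  | zero => simp
  | succ n ih =>
    rw [pow_succ, ← mul_assoc, ih, smul_mul_assoc, mul_assoc, h, mul_smul_comm, smul_smul,
      ← pow_succ, mul_assoc]

/-- Moving `a` past the copies of `b` one by one leaves a correction at each position, and
collecting these yields geometric sums. Two correction terms are allowed because `[E, F]` involves
`K` and `K⁻¹`, which scale differently; a missing term is taken to be 0. -/
theorem mul_pow_of_skew_add {a b w₁ w₂ : R} {s t₁ t₂ : 𝕂} (h : a * b = s • (b * a) + w₁ + w₂)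
    (h₁ : w₁ * b = t₁ • (b * w₁)) (h₂ : w₂ * b = t₂ • (b * w₂)) (n : ℕ) :
    a * b ^ (n + 1) = s ^ (n + 1) • (b ^ (n + 1) * a) +
      (∑ i ∈ Finset.range (n + 1), s ^ i * t₁ ^ (n - i)) • (b ^ n * w₁) +
      (∑ i ∈ Finset.range (n + 1), s ^ i * t₂ ^ (n - i)) • (b ^ n * w₂) := by
  have hsum (t : 𝕂) (n : ℕ) : ∑ i ∈ Finset.range (n + 2), s ^ i * t ^ (n + 1 - i) =
      t * (∑ i ∈ Finset.range (n + 1), s ^ i * t ^ (n - i)) + s ^ (n + 1) := by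
    rw [Finset.sum_range_succ, Finset.mul_sum, Nat.sub_self, pow_zero, mul_one]
    congr 1
    refine Finset.sum_congr rfl fun i hi => ?_
    rw [show n + 1 - i = n - i + 1 by have := Finset.mem_range.1 hi; omega, pow_succ]
    ring
  induction n with
  | zero => simp [h]
  | succ n ih =>
    rw [pow_succ b (n + 1), ← mul_assoc, ih, hsum, hsum]
    simp only [add_mul, smul_mul_assoc, mul_assoc, h, h₁, h₂, mul_add, mul_smul_comm]
    simp only [← mul_assoc, ← pow_succ]
    module

theorem geom_sum_eq_zero {s t : 𝕂} {l : ℕ} (hst : s ≠ t) (h : s ^ l = t ^ l) :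
    ∑ i ∈ Finset.range l, s ^ i * t ^ (l - 1 - i) = 0 := by
  have := geom_sum₂_mul s t l
  rw [h, sub_self] at this
  exact (mul_eq_zero.1 this).resolve_right (sub_ne_zero.2 hst)

/-- The corrections have the coefficients (s^l - t^l)/(s - t), which vanish when `s` and `t` are
distinct with equal l-th powers. -/
theorem mul_pow_of_skew_add_eq {a b w₁ w₂ : R} {s t₁ t₂ : 𝕂} {l : ℕ} (hl : l ≠ 0)
    (h : a * b = s • (b * a) + w₁ + w₂)
    (h₁ : w₁ * b = t₁ • (b * w₁)) (h₂ : w₂ * b = t₂ • (b * w₂)) (hs₁ : s ≠ t₁) (hs₂ : s ≠ t₂)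
    (hl₁ : s ^ l = t₁ ^ l) (hl₂ : s ^ l = t₂ ^ l) : a * b ^ l = s ^ l • (b ^ l * a) := by
  obtain ⟨n, rfl⟩ := Nat.exists_eq_succ_of_ne_zero hl
  have e1 := geom_sum_eq_zero hs₁ hl₁
  have e2 := geom_sum_eq_zero hs₂ hl₂
  simp only [Nat.succ_eq_add_one, Nat.add_sub_cancel] at e1 e2
  rw [Nat.succ_eq_add_one, mul_pow_of_skew_add h h₁ h₂, e1, e2, zero_smul, zero_smul, add_zero,
    add_zero]

end SkewDerivation

/-! ### The relations of A in commutation form. -/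

namespace QuantumPlane

variable {𝕂 : Type*} [Field 𝕂] {q : 𝕂}

namespace A

theorem of_rel {a b : FreeAlgebra 𝕂 Gen} (h : Rel q a b) :
    RingQuot.mkAlgHom 𝕂 (Rel q) a = RingQuot.mkAlgHom 𝕂 (Rel q) b :=
  RingQuot.mkAlgHom_rel 𝕂 h

variable (q) in
theorem k_ki : of q .K * of q .Kinv = 1 := by
  simpa [of] using of_rel (q := q) .K_Kinv

variable (q) in
theorem ki_k : of q .Kinv * of q .K = 1 := by
  simpa [of] using of_rel (q := q) .Kinv_K

theorem k_mul_of_conj {a b : A q} (h : of q .K * a * of q .Kinv = b) : of q .K * a = b * of q .K := by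
  rw [← h, mul_assoc, ki_k, mul_one]

variable (q) in
theorem k_E : of q .K * of q .E = q ^ 2 • (of q .E * of q .K) := by
  rw [k_mul_of_conj (b := q ^ 2 • of q .E) (by simpa [of] using of_rel (q := q) .K_E),
    smul_mul_assoc]

variable (q) in
theorem k_F : of q .K * of q .F = (q ^ 2)⁻¹ • (of q .F * of q .K) := by
  rw [k_mul_of_conj (b := (q ^ 2)⁻¹ • of q .F) (by simpa [of] using of_rel (q := q) .K_F),
    smul_mul_assoc]

variable (q) in
theorem k_X : of q .K * of q .X = q • (of q .X * of q .K) := by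
  rw [k_mul_of_conj (b := q • of q .X) (by simpa [of] using of_rel (q := q) .K_X),
    smul_mul_assoc]

variable (q) in
theorem k_Y : of q .K * of q .Y = q⁻¹ • (of q .Y * of q .K) := by
  rw [k_mul_of_conj (b := q⁻¹ • of q .Y) (by simpa [of] using of_rel (q := q) .K_Y),
    smul_mul_assoc]

variable (q) in
theorem E_F : of q .E * of q .F - of q .F * of q .E =
    (q - q⁻¹)⁻¹ • (of q .K - of q .Kinv) := by
  simpa only [of, map_mul, map_sub, map_smul] using of_rel (q := q) .E_F

variable (q) in
theorem E_X : of q .E * of q .X = q • (of q .X * of q .E) := by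
  simpa [of] using of_rel (q := q) .E_X

variable (q) in
theorem E_Y : of q .E * of q .Y = of q .X + q⁻¹ • (of q .Y * of q .E) := by
  simpa [of] using of_rel (q := q) .E_Y

variable (q) in
theorem F_X : of q .F * of q .X = of q .Y * of q .Kinv + of q .X * of q .F := by
  simpa [of] using of_rel (q := q) .F_X

variable (q) in
theorem F_Y : of q .F * of q .Y = of q .Y * of q .F := by
  simpa [of] using of_rel (q := q) .F_Y

variable (q) in
theorem X_Y : of q .X * of q .Y = q • (of q .Y * of q .X) := by
  simpa [of] using of_rel (q := q) .X_Y

variable (q) in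
theorem ki_X (hq : q ≠ 0) : of q .Kinv * of q .X = q⁻¹ • (of q .X * of q .Kinv) :=
  BData.swap_right (k_ki q) (ki_k q) (BData.flip hq (k_X q))

variable (q) in
theorem ki_Y (hq : q ≠ 0) : of q .Kinv * of q .Y = q • (of q .Y * of q .Kinv) := by
  simpa using BData.swap_right (k_ki q) (ki_k q) (BData.flip (inv_ne_zero hq) (k_Y q))

variable (q) in
theorem ki_E (hq : q ≠ 0) : of q .Kinv * of q .E = (q ^ 2)⁻¹ • (of q .E * of q .Kinv) :=
  BData.swap_right (k_ki q) (ki_k q) (BData.flip (pow_ne_zero 2 hq) (k_E q))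

variable (q) in
theorem ki_F (hq : q ≠ 0) : of q .Kinv * of q .F = q ^ 2 • (of q .F * of q .Kinv) := by
  simpa using
    BData.swap_right (k_ki q) (ki_k q) (BData.flip (inv_ne_zero (pow_ne_zero 2 hq)) (k_F q))

theorem one_smul_comm {R : Type*} [Ring R] [Algebra 𝕂 R] {a b : R} (h : a * b = b * a) :
    a * b = (1 : 𝕂) • (b * a) := by
  rw [one_smul, h]

/-- A subalgebra of `A` that contains the generators is everything. -/
theorem eq_top_of_of_mem {S : Subalgebra 𝕂 (A q)} (h : ∀ g, of q g ∈ S) : S = ⊤ := by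
  refine eq_top_iff.2 fun a _ => ?_
  obtain ⟨f, rfl⟩ := RingQuot.mkAlgHom_surjective 𝕂 (Rel q) a
  induction f using FreeAlgebra.induction with
  | grade0 r => rw [AlgHom.commutes]; exact S.algebraMap_mem r
  | grade1 g => exact h g
  | mul a b ha hb => rw [map_mul]; exact S.mul_mem (ha trivial) (hb trivial)
  | add a b ha hb => rw [map_add]; exact S.add_mem (ha trivial) (hb trivial)

/-- A linear subspace of `A` that contains `1` and is stable under left multiplication by the
generators is everything. -/
theorem submodule_eq_top {S : Submodule 𝕂 (A q)} (h1 : 1 ∈ S)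
    (h : ∀ g, ∀ m ∈ S, of q g * m ∈ S) : S = ⊤ := by
  let T : Subalgebra 𝕂 (A q) :=
    { carrier := {a | ∀ m ∈ S, a * m ∈ S}
      mul_mem' := fun {a b} ha hb m hm => by rw [mul_assoc]; exact ha _ (hb m hm)
      add_mem' := fun {a b} ha hb m hm => by rw [add_mul]; exact S.add_mem (ha m hm) (hb m hm)
      algebraMap_mem' := fun r m hm => by
        rw [← Algebra.smul_def]; exact S.smul_mem r hm }
  have hT : T = ⊤ := eq_top_of_of_mem h
  refine eq_top_iff.2 fun a _ => ?_
  have : a ∈ T := hT ▸ Algebra.mem_top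
  simpa using this 1 h1

theorem commute_all {z : A q} (h : ∀ g, of q g * z = z * of q g) (a : A q) : a * z = z * a := by
  have : Subalgebra.centralizer 𝕂 {z} = ⊤ := eq_top_of_of_mem fun g => by
    rw [Subalgebra.mem_centralizer_iff]
    rintro _ rfl
    exact (h g).symm
  have ha : a ∈ Subalgebra.centralizer 𝕂 {z} := this ▸ Algebra.mem_top
  exact ((Subalgebra.mem_centralizer_iff 𝕂).1 ha z rfl).symm

end A

end QuantumPlane

/-! ### The ordered monomials span A. -/

namespace QuantumPlane

variable {𝕂 : Type*} [Field 𝕂] {q : 𝕂}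

namespace A

variable (q) in
/-- The monomials `XᵃYᵇKⁱK⁻ʲEᶜFᵈ`. -/
def mono (a b i j c d : ℕ) : A q :=
  of q .X ^ a * (of q .Y ^ b * (of q .K ^ i * (of q .Kinv ^ j * (of q .E ^ c * of q .F ^ d))))

variable (q) in
/-- The span of the monomials. -/
def monoSpan : Submodule 𝕂 (A q) :=
  Submodule.span 𝕂 {x | ∃ a b i j c d, x = mono q a b i j c d}

theorem mono_mem (a b i j c d : ℕ) : mono q a b i j c d ∈ monoSpan q :=
  Submodule.subset_span ⟨a, b, i, j, c, d, rfl⟩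

theorem skew_pow_assoc {a b : A q} {s : 𝕂} (h : a * b = s • (b * a)) (n : ℕ) (z : A q) :
    a * (b ^ n * z) = s ^ n • (b ^ n * (a * z)) :=
  BData.assoc_rule (mul_pow_of_skew h n) z

theorem k_ki_comm : of q .Kinv * of q .K = (1 : 𝕂) • (of q .K * of q .Kinv) := by
  rw [ki_k, k_ki, one_smul]

variable (q) in
theorem F_E : of q .F * of q .E = (1 : 𝕂) • (of q .E * of q .F) +
    -(q - q⁻¹)⁻¹ • of q .K + (q - q⁻¹)⁻¹ • of q .Kinv := by
  rw [← sub_sub_cancel (of q .E * of q .F) (of q .F * of q .E), E_F]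
  module

theorem X_mul_mono (a b i j c d : ℕ) :
    of q .X * mono q a b i j c d = mono q (a + 1) b i j c d := by
  rw [mono, mono, pow_succ', mul_assoc]

theorem Y_mul_mono (hq : q ≠ 0) (a b i j c d : ℕ) :
    of q .Y * mono q a b i j c d = q⁻¹ ^ a • mono q a (b + 1) i j c d := by
  rw [mono, mono, skew_pow_assoc (BData.flip hq (X_Y q)), pow_succ' _ b, mul_assoc (of q .Y)]

theorem k_mul_mono (a b i j c d : ℕ) :
    of q .K * mono q a b i j c d = (q ^ a * q⁻¹ ^ b) • mono q a b (i + 1) j c d := by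
  rw [mono, mono, skew_pow_assoc (k_X q), skew_pow_assoc (k_Y q), mul_smul_comm, smul_smul,
    pow_succ' _ i, mul_assoc (of q .K)]

theorem ki_mul_mono (hq : q ≠ 0) (a b i j c d : ℕ) :
    of q .Kinv * mono q a b i j c d = (q⁻¹ ^ a * q ^ b) • mono q a b i (j + 1) c d := by
  rw [mono, mono, skew_pow_assoc (ki_X q hq), skew_pow_assoc (ki_Y q hq), mul_smul_comm, smul_smul,
    skew_pow_assoc k_ki_comm, one_pow, one_smul, pow_succ' _ j, mul_assoc (of q .Kinv)]

/-- `E` times a monomial without `X` and `Y`. -/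
theorem E_mul_mono_zero (hq : q ≠ 0) (i j c d : ℕ) :
    of q .E * mono q 0 0 i j c d = ((q ^ 2)⁻¹ ^ i * (q ^ 2) ^ j) • mono q 0 0 i j (c + 1) d := by
  have h1 := BData.flip (pow_ne_zero 2 hq) (k_E q)
  have h2 := BData.flip (inv_ne_zero (pow_ne_zero 2 hq)) (ki_E q hq)
  rw [inv_inv] at h2
  simp only [mono, pow_zero, one_mul]
  rw [skew_pow_assoc h1, skew_pow_assoc h2, mul_smul_comm, smul_smul, pow_succ' _ c,
    mul_assoc (of q .E)]

theorem XY_mul_mono (a b i j c d : ℕ) :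
    of q .X ^ a * (of q .Y ^ b * mono q 0 0 i j c d) = mono q a b i j c d := by
  simp [mono]

/-- `E` passes X^a up to a scalar. Passing a positive power of Y leaves one term in which a Y has
become an X, and this X is moved to the left. -/
theorem E_mul_mono_mem (hq : q ≠ 0) (a b i j c d : ℕ) :
    of q .E * mono q a b i j c d ∈ monoSpan q := by
  rw [← XY_mul_mono, skew_pow_assoc (E_X q)]
  refine Submodule.smul_mem _ _ ?_
  rcases b with _ | b
  · rw [pow_zero, one_mul, E_mul_mono_zero hq, mul_smul_comm]
    refine Submodule.smul_mem _ _ ?_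
    have := XY_mul_mono (q := q) a 0 i j (c + 1) d
    rw [pow_zero, one_mul] at this
    exact this ▸ mono_mem _ _ _ _ _ _
  · have h : of q .E * of q .Y = q⁻¹ • (of q .Y * of q .E) + of q .X + 0 := by
      rw [E_Y, add_zero, add_comm]
    have h1 := mul_pow_of_skew_add (t₂ := 0) h (X_Y q) (by simp) b
    rw [← mul_assoc (of q .E), h1, mul_zero, smul_zero, add_zero, add_mul, mul_add]
    refine Submodule.add_mem _ ?_ ?_
    · rw [smul_mul_assoc, mul_smul_comm, mul_assoc, E_mul_mono_zero hq]
      refine Submodule.smul_mem _ _ ?_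
      rw [mul_smul_comm, mul_smul_comm, XY_mul_mono]
      exact Submodule.smul_mem _ _ (mono_mem _ _ _ _ _ _)
    · have h2 := BData.flip (pow_ne_zero b hq) (mul_pow_of_skew (X_Y q) b)
      rw [smul_mul_assoc, mul_smul_comm, h2, smul_mul_assoc, mul_smul_comm, mul_assoc,
        ← mul_assoc (_ ^ a), ← pow_succ, XY_mul_mono]
      exact Submodule.smul_mem _ _ (Submodule.smul_mem _ _ (mono_mem _ _ _ _ _ _))

/-- Passing `F` over E^c leaves multiples of E^(c-1)K and E^(c-1)K⁻¹. Only membership in the span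
matters, so the scalars stay implicit; for c = 0 the last two are zero and the truncated `c - 1` is
harmless. -/
theorem F_mul_mono_zero (hq : q ≠ 0) (i j c d : ℕ) : ∃ α β γ : 𝕂,
    of q .F * mono q 0 0 i j c d = α • mono q 0 0 i j c (d + 1) +
      β • mono q 0 0 (i + 1) j (c - 1) d + γ • mono q 0 0 i (j + 1) (c - 1) d := by
  have h1 := BData.flip (inv_ne_zero (pow_ne_zero 2 hq)) (k_F q)
  have h2 := BData.flip (pow_ne_zero 2 hq) (ki_F q hq)
  rw [inv_inv] at h1
  simp only [mono, pow_zero, one_mul]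
  rw [skew_pow_assoc h1, skew_pow_assoc h2, mul_smul_comm, smul_smul]
  rcases c with _ | c
  · refine ⟨(q ^ 2) ^ i * (q ^ 2)⁻¹ ^ j, 0, 0, ?_⟩
    rw [pow_zero, one_mul, ← pow_succ', zero_smul, zero_smul, add_zero, add_zero, one_mul]
  · have e1 := BData.flip (pow_ne_zero 2 hq) (k_E q)
    have e2 := BData.flip (inv_ne_zero (pow_ne_zero 2 hq)) (ki_E q hq)
    rw [inv_inv] at e2
    have e1' : (-(q - q⁻¹)⁻¹ • of q .K) * of q .E =
        q ^ 2 • (of q .E * (-(q - q⁻¹)⁻¹ • of q .K)) := by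
      rw [smul_mul_assoc, k_E, mul_smul_comm, smul_comm]
    have e2' : ((q - q⁻¹)⁻¹ • of q .Kinv) * of q .E =
        (q ^ 2)⁻¹ • (of q .E * ((q - q⁻¹)⁻¹ • of q .Kinv)) := by
      rw [smul_mul_assoc, ki_E q hq, mul_smul_comm, smul_comm]
    have h3 := mul_pow_of_skew_add (F_E q) e1' e2' c
    have p1 := BData.flip (pow_ne_zero c (pow_ne_zero 2 hq)) (mul_pow_of_skew (k_E q) c)
    have p2 := BData.flip (pow_ne_zero c (inv_ne_zero (pow_ne_zero 2 hq)))
      (mul_pow_of_skew (ki_E q hq) c)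
    have p3 (z : A q) : of q .Kinv ^ j * (of q .K * z) = of q .K * (of q .Kinv ^ j * z) := by
      have : Commute (of q .Kinv ^ j) (of q .K) := by
        refine Commute.pow_left ?_ j
        rw [commute_iff_eq, ki_k, k_ki]
      rw [← mul_assoc, this.eq, mul_assoc]
    rw [← mul_assoc (of q .F), h3, mul_smul_comm, p1, mul_smul_comm, p2]
    simp only [add_mul, mul_add, smul_mul_assoc, mul_smul_comm, smul_add, smul_smul, mul_assoc,
      p3, Nat.add_sub_cancel]
    simp only [pow_succ' (of q .F) d, pow_succ (of q .K) i, pow_succ (of q .Kinv) j, mul_assoc]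
    exact ⟨_, _, _, rfl⟩

/-- Passing X^a leaves a correction in which one X is replaced by YK⁻¹, and `F` commutes with Y. The
rest is `F_mul_mono_zero`. -/
theorem F_mul_mono_mem (hq : q ≠ 0) (a b i j c d : ℕ) :
    of q .F * mono q a b i j c d ∈ monoSpan q := by
  have hF (i : ℕ) : of q .X ^ a * (of q .F * (of q .Y ^ b * mono q 0 0 i j c d)) ∈ monoSpan q := by
    obtain ⟨α, β, γ, h⟩ := F_mul_mono_zero hq i j c d
    rw [skew_pow_assoc (one_smul_comm (F_Y q)), one_pow, one_smul, h]
    simp only [mul_add, mul_smul_comm, XY_mul_mono]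
    exact Submodule.add_mem _ (Submodule.add_mem _ (Submodule.smul_mem _ _ (mono_mem _ _ _ _ _ _))
      (Submodule.smul_mem _ _ (mono_mem _ _ _ _ _ _))) (Submodule.smul_mem _ _ (mono_mem _ _ _ _ _ _))
  rw [← XY_mul_mono]
  rcases a with _ | a
  · simpa using hF i
  · have h : of q .F * of q .X = (1 : 𝕂) • (of q .X * of q .F) + of q .Y * of q .Kinv + 0 := by
      rw [F_X, add_zero, add_comm, one_smul]
    have h1 : of q .Y * of q .Kinv * of q .X = (q⁻¹ * q⁻¹) • (of q .X * (of q .Y * of q .Kinv)) := by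
      rw [mul_assoc, ki_X q hq, mul_smul_comm, ← mul_assoc, BData.flip hq (X_Y q), smul_mul_assoc,
        smul_smul, mul_assoc]
    have h2 := mul_pow_of_skew_add (t₂ := 0) h h1 (by simp) a
    rw [← mul_assoc (of q .F), h2, mul_zero, smul_zero, add_zero, add_mul]
    refine Submodule.add_mem _ ?_ ?_
    · rw [smul_mul_assoc, mul_assoc]
      exact Submodule.smul_mem _ _ (hF i)
    · rw [smul_mul_assoc, mul_assoc, mul_assoc (of q .Y), skew_pow_assoc (ki_Y q hq),
        ki_mul_mono hq]
      refine Submodule.smul_mem _ _ ?_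
      simp only [mul_smul_comm]
      rw [← mul_assoc (of q .Y), ← pow_succ', XY_mul_mono]
      exact Submodule.smul_mem _ _ (Submodule.smul_mem _ _ (mono_mem _ _ _ _ _ _))

/-- The span contains 1 and is stable under left multiplication by each generator, so it is a left
ideal containing 1. -/
theorem monoSpan_eq_top (hq : q ≠ 0) : monoSpan q = ⊤ := by
  refine submodule_eq_top ?_ fun g m hm => ?_
  · have : mono q 0 0 0 0 0 0 = 1 := by simp [mono]
    exact this ▸ mono_mem _ _ _ _ _ _
  · induction hm using Submodule.span_induction with
    | mem x hx =>
      obtain ⟨a, b, i, j, c, d, rfl⟩ := hx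
      cases g
      · exact E_mul_mono_mem hq _ _ _ _ _ _
      · exact F_mul_mono_mem hq _ _ _ _ _ _
      · rw [k_mul_mono]; exact Submodule.smul_mem _ _ (mono_mem _ _ _ _ _ _)
      · rw [ki_mul_mono hq]; exact Submodule.smul_mem _ _ (mono_mem _ _ _ _ _ _)
      · rw [X_mul_mono]; exact mono_mem _ _ _ _ _ _
      · rw [Y_mul_mono hq]; exact Submodule.smul_mem _ _ (mono_mem _ _ _ _ _ _)
    | zero => rw [mul_zero]; exact zero_mem _
    | add x y _ _ hx hy => rw [mul_add]; exact add_mem hx hy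
    | smul c x _ hx => rw [mul_smul_comm]; exact Submodule.smul_mem _ _ hx

end A

end QuantumPlane

/-! ### Simple modules over algebras finite over a central subalgebra. -/

section FiniteOverCenter

/-- A simple module over an algebra that is finite over a finitely generated central subalgebra is
finite dimensional. -/
theorem finiteDimensional_of_isSimpleModule {𝕂 C R V : Type*} [Field 𝕂] [CommRing C]
    [Algebra 𝕂 C] [Algebra.FiniteType 𝕂 C] [Ring R] [Algebra 𝕂 R] [Algebra C R]
    [IsScalarTower 𝕂 C R] [Module.Finite C R] [AddCommGroup V] [Module 𝕂 V] [Module R V]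
    [IsScalarTower 𝕂 R V] [IsSimpleModule R V] : FiniteDimensional 𝕂 V := by
  let : Module C V := Module.compHom V (algebraMap C R)
  have hsm (c : C) (v : V) : c • v = algebraMap C R c • v := rfl
  have : IsScalarTower C R V := ⟨fun c r v => by rw [hsm, smul_smul, Algebra.smul_def]⟩
  have : IsScalarTower 𝕂 C V := ⟨fun k c v => by
    rw [hsm, hsm, ← smul_assoc, ← IsScalarTower.coe_toAlgHom' 𝕂 C R, map_smul]⟩
  have := IsSimpleModule.nontrivial R V
  obtain ⟨v, hv⟩ := exists_ne (0 : V)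
  have hfin : Module.Finite C V := by
    refine Module.Finite.of_surjective ((LinearMap.toSpanSingleton R V v).restrictScalars C) ?_
    exact IsSimpleModule.toSpanSingleton_surjective R hv
  obtain ⟨W, hW, -⟩ := (eq_top_or_exists_le_coatom (⊥ : Submodule C V)).resolve_left bot_ne_top
  have hsimple : IsSimpleModule C (V ⧸ W) := isSimpleModule_iff_isCoatom.2 hW
  obtain ⟨m, hm, ⟨e⟩⟩ := isSimpleModule_iff_quot_maximal.1 hsimple
  -- For `c ∈ m`, multiplication by the central `c` is `R`-linear with image inside `W ≠ V`, so
  -- simplicity of `V` over `R` makes the image zero.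
  have htors : ∀ c ∈ m, ∀ x : V, c • x = 0 := by
    intro c hc
    let T : V →ₗ[R] V :=
      { toFun := fun x => c • x
        map_add' := smul_add c
        map_smul' := fun r x => by
          rw [hsm, hsm, RingHom.id_apply, smul_smul, smul_smul, Algebra.commutes] }
    have hT : LinearMap.range T = ⊥ := by
      refine (eq_bot_or_eq_top _).resolve_right fun htop => hW.1 ?_
      refine eq_top_iff.2 fun x _ => ?_
      obtain ⟨y, rfl⟩ : x ∈ LinearMap.range T := htop ▸ trivial
      rw [← Submodule.Quotient.mk_eq_zero]
      apply e.injective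
      change e (Submodule.Quotient.mk (c • y)) = e 0
      rw [Submodule.Quotient.mk_smul, map_smul, map_zero]
      obtain ⟨z, hz⟩ := Ideal.Quotient.mk_surjective (e (Submodule.Quotient.mk y))
      rw [← hz, Algebra.smul_def, Ideal.Quotient.algebraMap_eq, Ideal.Quotient.eq_zero_iff_mem.2 hc,
        zero_mul]
    intro x
    exact (Submodule.mem_bot R).1 (hT ▸ LinearMap.mem_range_self T x)
  have htors' : Module.IsTorsionBySet C V m := fun x c => htors c c.2 x
  let := htors'.module
  have : IsScalarTower 𝕂 (C ⧸ m) V := htors'.isScalarTower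
  have : IsScalarTower C (C ⧸ m) V := htors'.isScalarTower
  have : Module.Finite (C ⧸ m) V := Module.Finite.of_restrictScalars_finite C _ _
  let := Ideal.Quotient.field m
  -- Zariski's lemma: a field finitely generated as a `𝕂`-algebra is finite over `𝕂`.
  have : Module.Finite 𝕂 (C ⧸ m) := finite_of_finite_type_of_isJacobsonRing 𝕂 (C ⧸ m)
  exact Module.Finite.trans (C ⧸ m) V

end FiniteOverCenter

/-! ### The central l-th powers and finite dimension of simple modules. -/

namespace QuantumPlane

variable {𝕂 : Type*} [Field 𝕂] {q : 𝕂}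

instance : Finite Gen :=
  Finite.of_surjective (fun i : Fin 6 => ![Gen.E, .F, .K, .Kinv, .X, .Y] i) fun g => by
    cases g
    exacts [⟨0, rfl⟩, ⟨1, rfl⟩, ⟨2, rfl⟩, ⟨3, rfl⟩, ⟨4, rfl⟩, ⟨5, rfl⟩]

namespace A

theorem mul_pow_comm {R : Type*} [Ring R] [Algebra 𝕂 R] {a b : R} {s : 𝕂} {l : ℕ}
    (h : a * b = s • (b * a)) (hs : s ^ l = 1) : a * b ^ l = b ^ l * a := by
  rw [mul_pow_of_skew h, hs, one_smul]

theorem mul_pow_comm_add {R : Type*} [Ring R] [Algebra 𝕂 R] {a b w₁ w₂ : R} {s t₁ t₂ : 𝕂} {l : ℕ}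
    (hl : l ≠ 0) (h : a * b = s • (b * a) + w₁ + w₂)
    (h₁ : w₁ * b = t₁ • (b * w₁)) (h₂ : w₂ * b = t₂ • (b * w₂)) (hs₁ : s ≠ t₁) (hs₂ : s ≠ t₂)
    (hl₀ : s ^ l = 1) (hl₁ : t₁ ^ l = 1) (hl₂ : t₂ ^ l = 1) : a * b ^ l = b ^ l * a := by
  rw [mul_pow_of_skew_add_eq hl h h₁ h₂ hs₁ hs₂ (hl₀.trans hl₁.symm) (hl₀.trans hl₂.symm), hl₀,
    one_smul]

section Center

variable {l : ℕ}

/-- Most pairs of generators commute up to an l-th root of unity. The pairs (E,F), (E,Y), (F,X) have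
corrections, whose coefficients are geometric sums over distinct l-th roots of unity; distinctness
comes from q² ≠ 1. -/
theorem gen_mul_gen_pow (hq : IsPrimitiveRoot q l) (hl : 3 ≤ l) (g h : Gen) :
    of q g * of q h ^ l = of q h ^ l * of q g := by
  have hl0 : l ≠ 0 := by omega
  have h0 : q ≠ 0 := hq.ne_zero hl0
  have h2 : q ^ 2 ≠ 1 := pow_two_ne_one hq hl
  have p1 : q ^ l = 1 := hq.pow_eq_one
  have p1' : q⁻¹ ^ l = 1 := by rw [inv_pow, p1, inv_one]
  have p2 : (q ^ 2) ^ l = 1 := by rw [← pow_mul, mul_comm, pow_mul, p1, one_pow]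
  have p2' : (q ^ 2)⁻¹ ^ l = 1 := by rw [inv_pow, p2, inv_one]
  have n1 : (1 : 𝕂) ≠ (q ^ 2)⁻¹ := fun h => h2 (by rw [← inv_inv (q ^ 2), ← h, inv_one])
  have n2 : q⁻¹ ≠ q := fun h => h2 (by rw [pow_two]; nth_rw 1 [← h]; exact inv_mul_cancel₀ h0)
  have hself : ∀ g, of q g * of q g ^ l = of q g ^ l * of q g := fun g => by
    rw [← pow_succ, ← pow_succ']
  have q2 : q⁻¹ * q⁻¹ = (q ^ 2)⁻¹ := by rw [pow_two, mul_inv]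
  have hFE : of q .F * of q .E ^ l = of q .E ^ l * of q .F := by
    refine mul_pow_comm_add (t₁ := q ^ 2) (t₂ := (q ^ 2)⁻¹) hl0 (F_E q) ?_ ?_ h2.symm n1 (one_pow l)
      p2 p2'
    · rw [smul_mul_assoc, k_E, mul_smul_comm, smul_comm]
    · rw [smul_mul_assoc, ki_E q h0, mul_smul_comm, smul_comm]
  have hEF : of q .E * of q .F ^ l = of q .F ^ l * of q .E := by
    have h : of q .E * of q .F = (1 : 𝕂) • (of q .F * of q .E) +
        (q - q⁻¹)⁻¹ • of q .K + -(q - q⁻¹)⁻¹ • of q .Kinv := by rw [F_E]; module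
    refine mul_pow_comm_add (t₁ := (q ^ 2)⁻¹) (t₂ := q ^ 2) hl0 h ?_ ?_ n1 h2.symm (one_pow l)
      p2' p2
    · rw [smul_mul_assoc, k_F, mul_smul_comm, smul_comm]
    · rw [smul_mul_assoc, ki_F q h0, mul_smul_comm, smul_comm]
  have hEY : of q .E * of q .Y ^ l = of q .Y ^ l * of q .E := by
    have h : of q .E * of q .Y = q⁻¹ • (of q .Y * of q .E) + of q .X + 0 := by
      rw [E_Y, add_zero, add_comm]
    exact mul_pow_comm_add (t₂ := q) hl0 h (X_Y q) (by simp) n2 n2 p1' p1 p1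
  have hYE : of q .Y * of q .E ^ l = of q .E ^ l * of q .Y := by
    have h : of q .Y * of q .E = q • (of q .E * of q .Y) + (-q) • of q .X + 0 := by
      rw [E_Y, add_zero, smul_add, smul_smul, mul_inv_cancel₀ h0]; module
    refine mul_pow_comm_add (t₁ := q⁻¹) (t₂ := q⁻¹) hl0 h ?_ (by simp) n2.symm n2.symm p1 p1' p1'
    rw [smul_mul_assoc, BData.flip h0 (E_X q), mul_smul_comm, smul_comm]
  have hFX : of q .F * of q .X ^ l = of q .X ^ l * of q .F := by
    have h : of q .F * of q .X = (1 : 𝕂) • (of q .X * of q .F) + of q .Y * of q .Kinv + 0 := by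
      rw [F_X, add_zero, add_comm, one_smul]
    refine mul_pow_comm_add (t₁ := (q ^ 2)⁻¹) (t₂ := (q ^ 2)⁻¹) hl0 h ?_ (by simp) n1 n1 (one_pow l)
      p2' p2'
    rw [mul_assoc, ki_X q h0, mul_smul_comm, ← mul_assoc, BData.flip h0 (X_Y q), smul_mul_assoc,
      smul_smul, mul_assoc, q2]
  have hXF : of q .X * of q .F ^ l = of q .F ^ l * of q .X := by
    have h : of q .X * of q .F = (1 : 𝕂) • (of q .F * of q .X) +
        (-1 : 𝕂) • (of q .Y * of q .Kinv) + 0 := by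
      rw [F_X]; module
    refine mul_pow_comm_add (t₁ := q ^ 2) (t₂ := q ^ 2) hl0 h ?_ (by simp) h2.symm h2.symm
      (one_pow l) p2 p2
    rw [smul_mul_assoc, mul_assoc, ki_F q h0, mul_smul_comm, ← mul_assoc, ← F_Y, mul_assoc,
      mul_smul_comm, smul_comm]
  have eKE := BData.flip (pow_ne_zero 2 h0) (k_E q)
  have eKF := BData.flip (inv_ne_zero (pow_ne_zero 2 h0)) (k_F q)
  have eKX := BData.flip h0 (k_X q)
  have eKY := BData.flip (inv_ne_zero h0) (k_Y q)
  have eIE := BData.flip (inv_ne_zero (pow_ne_zero 2 h0)) (ki_E q h0)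
  have eIF := BData.flip (pow_ne_zero 2 h0) (ki_F q h0)
  have eIX := BData.flip (inv_ne_zero h0) (ki_X q h0)
  have eIY := BData.flip h0 (ki_Y q h0)
  rw [inv_inv] at eKF eKY eIE eIX
  have eKI : of q .K * of q .Kinv = (1 : 𝕂) • (of q .Kinv * of q .K) := by
    rw [k_ki, ki_k, one_smul]
  cases g <;> cases h
  · exact hself _
  · exact hEF
  · exact mul_pow_comm eKE p2'
  · exact mul_pow_comm eIE p2
  · exact mul_pow_comm (E_X q) p1
  · exact hEY
  · exact hFE
  · exact hself _
  · exact mul_pow_comm eKF p2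
  · exact mul_pow_comm eIF p2'
  · exact hFX
  · exact mul_pow_comm (one_smul_comm (𝕂 := 𝕂) (F_Y q)) (one_pow l)
  · exact mul_pow_comm (k_E q) p2
  · exact mul_pow_comm (k_F q) p2'
  · exact hself _
  · exact mul_pow_comm eKI (one_pow l)
  · exact mul_pow_comm (k_X q) p1
  · exact mul_pow_comm (k_Y q) p1'
  · exact mul_pow_comm (ki_E q h0) p2'
  · exact mul_pow_comm (ki_F q h0) p2
  · exact mul_pow_comm k_ki_comm (one_pow l)
  · exact hself _
  · exact mul_pow_comm (ki_X q h0) p1'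
  · exact mul_pow_comm (ki_Y q h0) p1
  · exact mul_pow_comm (BData.flip h0 (E_X q)) p1'
  · exact hXF
  · exact mul_pow_comm eKX p1'
  · exact mul_pow_comm eIX p1
  · exact hself _
  · exact mul_pow_comm (X_Y q) p1
  · exact hYE
  · exact mul_pow_comm (one_smul_comm (𝕂 := 𝕂) (F_Y q).symm) (one_pow l)
  · exact mul_pow_comm eKY p1
  · exact mul_pow_comm eIY p1'
  · exact mul_pow_comm (BData.flip h0 (X_Y q)) p1'
  · exact hself _

variable (hq : IsPrimitiveRoot q l) (hl : 3 ≤ l)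

/-- The central subalgebra generated by the `l`-th powers of the generators. -/
noncomputable def powHom : MvPolynomial Gen 𝕂 →ₐ[𝕂] A q :=
  (Subalgebra.center 𝕂 (A q)).val.comp (MvPolynomial.aeval fun g =>
    (⟨of q g ^ l, Subalgebra.mem_center_iff.2
      (commute_all fun h => gen_mul_gen_pow hq hl h g)⟩ : Subalgebra.center 𝕂 (A q)))

theorem powHom_X (g : Gen) : powHom hq hl (.X g) = of q g ^ l := by
  simp [powHom]

/-- `A` as an algebra over the polynomial ring that acts through the `l`-th powers of the
generators. -/
noncomputable abbrev powAlgebra : Algebra (MvPolynomial Gen 𝕂) (A q) :=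
  (powHom hq hl).toRingHom.toAlgebra' fun c x =>
    (Subalgebra.mem_center_iff.1 (MvPolynomial.aeval (fun g =>
      (⟨of q g ^ l, Subalgebra.mem_center_iff.2
        (commute_all fun h => gen_mul_gen_pow hq hl h g)⟩ : Subalgebra.center 𝕂 (A q))) c).2 x).symm

/-- Reducing the six exponents of a monomial modulo l splits off a central factor, so the finitely
many monomials with exponents below l generate. -/
theorem finite_powAlgebra :
    letI := powAlgebra hq hl
    Module.Finite (MvPolynomial Gen 𝕂) (A q) := by
  let := powAlgebra hq hl
  have : IsScalarTower 𝕂 (MvPolynomial Gen 𝕂) (A q) :=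
    IsScalarTower.of_algebraMap_eq fun r => ((powHom hq hl).commutes r).symm
  let T : (Fin 6 → Fin l) → A q := fun t => mono q (t 0) (t 1) (t 2) (t 3) (t 4) (t 5)
  refine ⟨⟨(Set.finite_range T).toFinset, ?_⟩⟩
  rw [Set.Finite.coe_toFinset]
  have hpow (g : Gen) (a : ℕ) :
      of q g ^ a = (MvPolynomial.X g ^ (a / l) : MvPolynomial Gen 𝕂) • of q g ^ (a % l) := by
    rw [Algebra.smul_def]
    change _ = powHom hq hl (MvPolynomial.X g ^ (a / l)) * _
    rw [map_pow, powHom_X, ← pow_mul, ← pow_add, Nat.div_add_mod]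
  have hle : monoSpan q ≤ (Submodule.span (MvPolynomial Gen 𝕂) (Set.range T)).restrictScalars 𝕂 := by
    refine Submodule.span_le.2 ?_
    rintro _ ⟨a, b, i, j, c, d, rfl⟩
    change mono q a b i j c d ∈ Submodule.span (MvPolynomial Gen 𝕂) (Set.range T)
    rw [mono, hpow .X a, hpow .Y b, hpow .K i, hpow .Kinv j, hpow .E c, hpow .F d]
    simp only [smul_mul_assoc, mul_smul_comm]
    have hlt (a : ℕ) : a % l < l := Nat.mod_lt _ (by omega)
    iterate 6 refine Submodule.smul_mem _ _ ?_
    exact Submodule.subset_span ⟨![⟨_, hlt a⟩, ⟨_, hlt b⟩, ⟨_, hlt i⟩, ⟨_, hlt j⟩, ⟨_, hlt c⟩,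
      ⟨_, hlt d⟩], rfl⟩
  rw [monoSpan_eq_top (hq.ne_zero (by omega))] at hle
  exact eq_top_iff.2 fun x _ => hle (Submodule.mem_top (x := x))

include hq hl in
theorem finiteDimensional_of_isSimpleModule (V : Type*) [AddCommGroup V] [Module 𝕂 V]
    [Module (A q)ᵐᵒᵖ V] [IsScalarTower 𝕂 (A q)ᵐᵒᵖ V] [IsSimpleModule (A q)ᵐᵒᵖ V] :
    FiniteDimensional 𝕂 V := by
  let := powAlgebra hq hl
  have : IsScalarTower 𝕂 (MvPolynomial Gen 𝕂) (A q) :=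
    IsScalarTower.of_algebraMap_eq fun r => ((powHom hq hl).commutes r).symm
  have := finite_powAlgebra hq hl
  have : Module.Finite (MvPolynomial Gen 𝕂) (A q)ᵐᵒᵖ :=
    Module.Finite.equiv (opLinearEquiv (MvPolynomial Gen 𝕂))
  exact _root_.finiteDimensional_of_isSimpleModule (C := MvPolynomial Gen 𝕂) (R := (A q)ᵐᵒᵖ)

end Center

end A

end QuantumPlane

/-! ### Leading terms of matrices over a group algebra. -/

section LeadingTerms

variable {𝕂 I G : Type*} [Field 𝕂] [AddCommGroup G] (w : G →+ ℤ)

/-- The matrix `zᵍM` over the group algebra of `G`. -/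
noncomputable def zSMul (g : G) (M : Matrix I I 𝕂) : Matrix I I (AddMonoidAlgebra 𝕂 G) :=
  matSMul M (AddMonoidAlgebra.single g (1 : 𝕂))

theorem zSMul_mul [Fintype I] (g h : G) (M N : Matrix I I 𝕂) :
    zSMul g M * zSMul h N = zSMul (g + h) (M * N) := by
  rw [zSMul, zSMul, matSMul_mul, AddMonoidAlgebra.single_mul_single, one_mul, zSMul]

theorem zSMul_add (g : G) (M N : Matrix I I 𝕂) : zSMul g (M + N) = zSMul g M + zSMul g N := by
  ext i j : 2
  simp [zSMul, matSMul, add_smul]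

theorem zSMul_smul (g : G) (c : 𝕂) (M : Matrix I I 𝕂) : zSMul g (c • M) = c • zSMul g M := by
  ext i j : 2
  simp [zSMul, matSMul]

theorem zSMul_zero_one [DecidableEq I] : zSMul (0 : G) (1 : Matrix I I 𝕂) = 1 :=
  matSMul_one

/-- The coefficient of `zᵍ` in an entry. -/
noncomputable def zCoeff (g : G) (i j : I) : Matrix I I (AddMonoidAlgebra 𝕂 G) →ₗ[𝕂] 𝕂 where
  toFun M := (M i j).coeff g
  map_add' M N := by simp
  map_smul' c M := by simp

theorem zCoeff_zSMul_self (g : G) (i j : I) (M : Matrix I I 𝕂) :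
    zCoeff g i j (zSMul g M) = M i j := by
  change (zSMul _ M i j).coeff g = _
  simp [zSMul, matSMul]

theorem zCoeff_zSMul_of_ne {g h : G} (hgh : g ≠ h) (i j : I) (M : Matrix I I 𝕂) :
    zCoeff g i j (zSMul h M) = 0 := by
  change (zSMul _ M i j).coeff g = _
  simp [zSMul, matSMul, Finsupp.single_eq_of_ne hgh]

/-- The span of the `zᵍM` with `g` of weight less than `n`. -/
noncomputable def lowWeight (n : ℤ) : Submodule 𝕂 (Matrix I I (AddMonoidAlgebra 𝕂 G)) :=
  Submodule.span 𝕂 {x | ∃ g M, w g < n ∧ x = zSMul g M}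

variable {w}

theorem zSMul_mem_lowWeight {g : G} {n : ℤ} (h : w g < n) (M : Matrix I I 𝕂) :
    zSMul g M ∈ lowWeight w n :=
  Submodule.subset_span ⟨g, M, h, rfl⟩

theorem lowWeight_mono {m n : ℤ} (h : m ≤ n) :
    (lowWeight w m : Submodule 𝕂 (Matrix I I (AddMonoidAlgebra 𝕂 G))) ≤ lowWeight w n :=
  Submodule.span_mono fun _ ⟨g, M, hg, hx⟩ => ⟨g, M, hg.trans_le h, hx⟩

theorem zCoeff_eq_zero_of_mem_lowWeight {n : ℤ} {x : Matrix I I (AddMonoidAlgebra 𝕂 G)}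
    (hx : x ∈ lowWeight w n) {g : G} (hg : n ≤ w g) (i j : I) : zCoeff g i j x = 0 := by
  induction hx using Submodule.span_induction with
  | mem x hx =>
    obtain ⟨h, M, hh, rfl⟩ := hx
    exact zCoeff_zSMul_of_ne (by rintro rfl; omega) i j M
  | zero => exact map_zero _
  | add x y _ _ hx hy => rw [map_add, hx, hy, add_zero]
  | smul c x _ hx => rw [map_smul, hx, smul_zero]

variable [Fintype I] [DecidableEq I]

/-- The bounds are strict, so weights below m and n add up to at most m + n - 2; this is the slack
of one in the hypothesis. -/
theorem mul_mem_lowWeight {m n k : ℤ} {x y : Matrix I I (AddMonoidAlgebra 𝕂 G)}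
    (hx : x ∈ lowWeight w m) (hy : y ∈ lowWeight w n) (hk : m + n ≤ k + 1) :
    x * y ∈ lowWeight w k := by
  have h := Submodule.mul_mem_mul hx hy
  rw [lowWeight, lowWeight, Submodule.span_mul_span] at h
  refine Submodule.span_le.2 ?_ h
  rintro _ ⟨_, ⟨g, M, hg, rfl⟩, _, ⟨h, N, hh, rfl⟩, rfl⟩
  exact Submodule.subset_span ⟨g + h, M * N, by rw [map_add]; omega, zSMul_mul g h M N⟩

variable (w) in
/-- `x` has the leading term `zᵍM` with `M` invertible. -/
def HasLead (g : G) (x : Matrix I I (AddMonoidAlgebra 𝕂 G)) : Prop :=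
  ∃ M : Matrix I I 𝕂, IsUnit M ∧ x - zSMul g M ∈ lowWeight w (w g)

theorem hasLead_zSMul (g : G) {M : Matrix I I 𝕂} (hM : IsUnit M) : HasLead w g (zSMul g M) :=
  ⟨M, hM, by rw [sub_self]; exact zero_mem _⟩

theorem HasLead.mul {g h : G} {x y : Matrix I I (AddMonoidAlgebra 𝕂 G)} (hx : HasLead w g x)
    (hy : HasLead w h y) : HasLead w (g + h) (x * y) := by
  obtain ⟨M, hM, hx⟩ := hx
  obtain ⟨N, hN, hy⟩ := hy
  refine ⟨M * N, hM.mul hN, ?_⟩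
  have hy' : y ∈ lowWeight w (w h + 1) := by
    rw [← sub_add_cancel y (zSMul h N)]
    exact add_mem (lowWeight_mono (by omega) hy) (zSMul_mem_lowWeight (by omega) N)
  have e : x * y - zSMul (g + h) (M * N) =
      (x - zSMul g M) * y + zSMul g M * (y - zSMul h N) := by
    rw [← zSMul_mul]; noncomm_ring
  rw [e, map_add]
  exact add_mem (mul_mem_lowWeight hx hy' (by omega))
    (mul_mem_lowWeight (zSMul_mem_lowWeight (lt_add_one _) M) hy (by omega))

theorem HasLead.pow {g : G} {x : Matrix I I (AddMonoidAlgebra 𝕂 G)} (hx : HasLead w g x) (n : ℕ) :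
    HasLead w (n • g) (x ^ n) := by
  induction n with
  | zero => rw [zero_smul, pow_zero, ← zSMul_zero_one]; exact hasLead_zSMul 0 isUnit_one
  | succ n ih => rw [pow_succ, succ_nsmul]; exact ih.mul hx

theorem HasLead.add_low {g : G} {x y : Matrix I I (AddMonoidAlgebra 𝕂 G)} (hx : HasLead w g x)
    (hy : y ∈ lowWeight w (w g)) : HasLead w g (x + y) := by
  obtain ⟨M, hM, hx⟩ := hx
  exact ⟨M, hM, by rw [add_sub_right_comm]; exact add_mem hx hy⟩

theorem HasLead.smul {g : G} {x : Matrix I I (AddMonoidAlgebra 𝕂 G)} (hx : HasLead w g x)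
    {c : 𝕂} (hc : c ≠ 0) : HasLead w g (c • x) := by
  obtain ⟨M, hM, hx⟩ := hx
  refine ⟨c • M, ?_, by rw [zSMul_smul, ← smul_sub]; exact Submodule.smul_mem _ _ hx⟩
  rw [Algebra.smul_def]
  exact ((isUnit_iff_ne_zero.2 hc).map (algebraMap 𝕂 _)).mul hM

/-- Elements with different leading terms are linearly independent. -/
theorem linearIndependent_of_hasLead [Nonempty I] {J : Type*} {g : J → G}
    (hg : Function.Injective g) {x : J → Matrix I I (AddMonoidAlgebra 𝕂 G)}
    (hx : ∀ t, HasLead w (g t) (x t)) : LinearIndependent 𝕂 x := by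
  rw [linearIndependent_iff]
  intro c hc
  by_contra hne
  -- At an index of maximal weight in the relation, the coefficient of z^(g t₀) sees only the
  -- leading matrix of `x t₀`: other leading terms have different exponents and all remainders have
  -- smaller weight.
  obtain ⟨t₀, ht₀, hmax⟩ := Finset.exists_max_image c.support (fun t => w (g t))
    (Finsupp.support_nonempty_iff.2 hne)
  obtain ⟨M, hM, hlow⟩ := hx t₀
  have key (i j : I) : c t₀ * M i j = 0 := by
    have h := congrArg (zCoeff (g t₀) i j) hc
    rw [map_zero, Finsupp.linearCombination_apply, Finsupp.sum, map_sum,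
      Finset.sum_eq_single t₀, map_smul, smul_eq_mul] at h
    · rw [← h, ← sub_add_cancel (x t₀) (zSMul (g t₀) M), map_add,
        zCoeff_eq_zero_of_mem_lowWeight hlow le_rfl, zero_add, zCoeff_zSMul_self]
    · intro t ht hne
      obtain ⟨N, -, hN⟩ := hx t
      rw [map_smul, ← sub_add_cancel (x t) (zSMul (g t) N), map_add,
        zCoeff_eq_zero_of_mem_lowWeight hN (hmax t ht), zero_add,
        zCoeff_zSMul_of_ne fun h => hne (hg h).symm, smul_zero]
    · exact fun h => absurd ht₀ h
  refine hM.ne_zero (Matrix.ext fun i j => ?_)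
  exact (mul_eq_zero.1 (key i j)).resolve_left (Finsupp.mem_support_iff.1 ht₀)

end LeadingTerms

/-! ### A faithful matrix representation of A over Laurent polynomials. -/

namespace QuantumPlane

namespace BData

variable {𝕂 : Type*} [Field 𝕂] {q : 𝕂} {I G : Type*} [Fintype I] [DecidableEq I] [AddCommGroup G]

/-- The deformation of a matrix representation with `φ` invertible: the generators are multiplied
by independent parameters, and a multiple of `φ⁻¹` is added to `ψ`. -/
noncomputable def generic (D : BData q (Matrix I I 𝕂)) {Φ : Matrix I I 𝕂} (h₁ : D.φ * Φ = 1)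
    (h₂ : Φ * D.φ = 1) (d : Fin 5 → G) : BData q (Matrix I I (AddMonoidAlgebra 𝕂 G)) where
  k := zSMul (d 2) D.k
  ki := zSMul (-d 2) D.ki
  x := zSMul (d 0) D.x
  xi := zSMul (-d 0) D.xi
  y := zSMul (d 1) D.y
  yi := zSMul (-d 1) D.yi
  φ := zSMul (d 3) D.φ
  -- The first exponent makes the relation for ψφ - φψ homogeneous. The second term obeys the same
  -- q-commutations with x, y, k as ψ; its products with φ on both sides are the scalar z^(d 4), so
  -- it cancels from the commutator and brings in a fifth free parameter.
  ψ := zSMul (d 0 + d 1 + d 2 - d 3) D.ψ + zSMul (d 4 - d 3) Φ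
  k_ki := by rw [zSMul_mul, D.k_ki, add_neg_cancel, zSMul_zero_one]
  ki_k := by rw [zSMul_mul, D.ki_k, neg_add_cancel, zSMul_zero_one]
  x_xi := by rw [zSMul_mul, D.x_xi, add_neg_cancel, zSMul_zero_one]
  xi_x := by rw [zSMul_mul, D.xi_x, neg_add_cancel, zSMul_zero_one]
  y_yi := by rw [zSMul_mul, D.y_yi, add_neg_cancel, zSMul_zero_one]
  yi_y := by rw [zSMul_mul, D.yi_y, neg_add_cancel, zSMul_zero_one]
  k_x := by rw [zSMul_mul, zSMul_mul, D.k_x, zSMul_smul, add_comm]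
  y_k := by rw [zSMul_mul, zSMul_mul, D.y_k, zSMul_smul, add_comm]
  x_y := by rw [zSMul_mul, zSMul_mul, D.x_y, zSMul_smul, add_comm]
  φ_x := by rw [zSMul_mul, zSMul_mul, D.φ_x, add_comm]
  y_φ := by rw [zSMul_mul, zSMul_mul, D.y_φ, zSMul_smul, add_comm]
  k_φ := by rw [zSMul_mul, zSMul_mul, D.k_φ, zSMul_smul, add_comm]
  ψ_x := by
    have h : Φ * D.x = D.x * Φ := by
      rw [swap_right (c := (1 : 𝕂)) h₁ h₂ (A.one_smul_comm D.φ_x.symm), one_smul]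
    rw [add_mul, mul_add, zSMul_mul, zSMul_mul, zSMul_mul, zSMul_mul, D.ψ_x, h,
      add_comm (d 0) (_ - d 3), add_comm (d 0) (d 4 - d 3)]
  ψ_y := by
    rw [add_mul, mul_add, zSMul_mul, zSMul_mul, zSMul_mul, zSMul_mul, D.ψ_y,
      swap_right h₁ h₂ D.y_φ, zSMul_smul, zSMul_smul, smul_add, add_comm (d 1) (_ - _),
      add_comm (d 1) (d 4 - d 3)]
  ψ_k := by
    rw [add_mul, mul_add, zSMul_mul, zSMul_mul, zSMul_mul, zSMul_mul, D.ψ_k,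
      swap_right h₁ h₂ D.k_φ, zSMul_smul, zSMul_smul, smul_add, add_comm (d 2) (_ - _),
      add_comm (d 2) (d 4 - d 3)]
  ψ_φ := by
    rw [add_mul, mul_add]
    simp only [zSMul_mul]
    rw [h₁, h₂, add_comm (d 3) (d 4 - d 3), add_sub_add_right_eq_sub, add_comm (d 3) (_ - _),
      sub_add_cancel, ← zSMul_smul, ← D.ψ_φ, sub_eq_add_neg, sub_eq_add_neg, zSMul_add,
      ← neg_one_smul 𝕂 (D.φ * D.ψ), zSMul_smul, neg_one_smul,
      show d 2 + d 1 + d 0 = d 0 + d 1 + d 2 by abel]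

section Lead

variable {w : G →+ ℤ} {D : BData q (Matrix I I 𝕂)} {Φ : Matrix I I 𝕂} {h₁ : D.φ * Φ = 1}
  {h₂ : Φ * D.φ = 1} {d : Fin 5 → G}

theorem isUnit_x {R : Type*} [Ring R] [Algebra 𝕂 R] (D : BData q R) : IsUnit D.x :=
  ⟨⟨D.x, D.xi, D.x_xi, D.xi_x⟩, rfl⟩

theorem isUnit_xi {R : Type*} [Ring R] [Algebra 𝕂 R] (D : BData q R) : IsUnit D.xi :=
  ⟨⟨D.xi, D.x, D.xi_x, D.x_xi⟩, rfl⟩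

theorem isUnit_y {R : Type*} [Ring R] [Algebra 𝕂 R] (D : BData q R) : IsUnit D.y :=
  ⟨⟨D.y, D.yi, D.y_yi, D.yi_y⟩, rfl⟩

theorem isUnit_yi {R : Type*} [Ring R] [Algebra 𝕂 R] (D : BData q R) : IsUnit D.yi :=
  ⟨⟨D.yi, D.y, D.yi_y, D.y_yi⟩, rfl⟩

theorem isUnit_k {R : Type*} [Ring R] [Algebra 𝕂 R] (D : BData q R) : IsUnit D.k :=
  ⟨⟨D.k, D.ki, D.k_ki, D.ki_k⟩, rfl⟩

theorem isUnit_ki {R : Type*} [Ring R] [Algebra 𝕂 R] (D : BData q R) : IsUnit D.ki :=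
  ⟨⟨D.ki, D.k, D.ki_k, D.k_ki⟩, rfl⟩

/-- `E` is a multiple of y⁻¹(x - φ). The weights make φ dominate x, and φ is invertible. -/
theorem hasLead_generic_E (hq : q ≠ 0) (hq2 : q ^ 2 ≠ 1) (hw0 : w (d 0) = 0) (hw3 : w (d 3) = 1) :
    HasLead w (d 3 - d 1) ((D.generic h₁ h₂ d).act .E) := by
  have hs : q - q⁻¹ ≠ 0 := fun h => hq2 (by field_simp at h; linear_combination h)
  have hφ : IsUnit D.φ := ⟨⟨D.φ, Φ, h₁, h₂⟩, rfl⟩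
  have h : HasLead w (d 3) ((-1 : 𝕂) • zSMul (d 3) D.φ + zSMul (d 0) D.x) :=
    ((hasLead_zSMul _ hφ).smul (neg_ne_zero.2 one_ne_zero)).add_low
      (zSMul_mem_lowWeight (by omega) _)
  have h' := ((hasLead_zSMul (w := w) (-d 1) D.isUnit_yi).mul h).smul (inv_ne_zero hs)
  convert h' using 1
  · abel
  · simp only [act, generic]
    rw [neg_one_smul, neg_add_eq_sub]

/-- In x⁻¹(ψ + q²yk⁻¹) the three terms have weights -1 (the old ψ), 1 (the added φ⁻¹) and 0. Weight
2 for `d 4` is chosen so that the invertible φ⁻¹ dominates. -/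
theorem hasLead_generic_F (hq2 : q ^ 2 ≠ 1) (hw0 : w (d 0) = 0) (hw1 : w (d 1) = 0)
    (hw2 : w (d 2) = 0) (hw3 : w (d 3) = 1) (hw4 : w (d 4) = 2) :
    HasLead w (d 4 - d 3 - d 0) ((D.generic h₁ h₂ d).act .F) := by
  have ht : 1 - q ^ 2 ≠ 0 := fun h => hq2 (by linear_combination -h)
  have hΦ : IsUnit Φ := ⟨⟨Φ, D.φ, h₂, h₁⟩, rfl⟩
  have hl : zSMul (d 0 + d 1 + d 2 - d 3) D.ψ + q ^ 2 • zSMul (d 1 + -d 2) (D.y * D.ki) ∈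
      lowWeight w (w (d 4 - d 3)) :=
    add_mem (zSMul_mem_lowWeight (by simp only [map_add, map_sub]; omega) _)
      (Submodule.smul_mem _ _
        (zSMul_mem_lowWeight (by simp only [map_add, map_sub, map_neg]; omega) _))
  have h' := ((hasLead_zSMul (w := w) (-d 0) D.isUnit_xi).mul
    ((hasLead_zSMul (w := w) (d 4 - d 3) hΦ).add_low hl)).smul (inv_ne_zero ht)
  convert h' using 1
  · abel
  · simp only [act, generic]
    rw [zSMul_mul]
    congr 2
    abel

theorem hasLead_generic_mono (hq : q ≠ 0) (hq2 : q ^ 2 ≠ 1) (hw0 : w (d 0) = 0)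
    (hw1 : w (d 1) = 0) (hw2 : w (d 2) = 0) (hw3 : w (d 3) = 1) (hw4 : w (d 4) = 2)
    (a b i j r s : ℕ) :
    HasLead w (a • d 0 + (b • d 1 + (i • d 2 + (j • -d 2 + (r • (d 3 - d 1) +
      s • (d 4 - d 3 - d 0)))))) ((D.generic h₁ h₂ d).toHom hq hq2 (A.mono q a b i j r s)) := by
  simp only [A.mono, map_mul, map_pow, toHom_of]
  exact ((hasLead_zSMul _ D.isUnit_x).pow a).mul (((hasLead_zSMul _ D.isUnit_y).pow b).mul
    (((hasLead_zSMul _ D.isUnit_k).pow i).mul (((hasLead_zSMul _ D.isUnit_ki).pow j).mul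
    (((hasLead_generic_E hq hq2 hw0 hw3).pow r).mul
    ((hasLead_generic_F hq2 hw0 hw1 hw2 hw3 hw4).pow s)))))

end Lead

end BData

namespace A

variable {𝕂 : Type*} [Field 𝕂] {q : 𝕂}

theorem k_pow_add_mul_ki_pow_add (m i j : ℕ) (z : A q) :
    of q .K ^ (i + m) * (of q .Kinv ^ (j + m) * z) = of q .K ^ i * (of q .Kinv ^ j * z) := by
  induction m with
  | zero => rfl
  | succ m ih =>
    rw [← ih, ← add_assoc, ← add_assoc, pow_succ, pow_succ', mul_assoc, mul_assoc,
      ← mul_assoc (of q .K) (of q .Kinv), k_ki, one_mul]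

/-- The basis of `A` formed by the monomials `XᵃYᵇKⁱEᶜFᵈ` with `i ∈ ℤ`. -/
def pbw (q : 𝕂) (t : ℕ × ℕ × ℤ × ℕ × ℕ) : A q :=
  mono q t.1 t.2.1 t.2.2.1.toNat (-t.2.2.1).toNat t.2.2.2.1 t.2.2.2.2

theorem mono_eq_pbw (a b i j c d : ℕ) : mono q a b i j c d = pbw q (a, b, (i - j : ℤ), c, d) := by
  simp only [pbw, mono]
  rcases le_total i j with h | h
  · obtain ⟨m, rfl⟩ := Nat.exists_eq_add_of_le h
    have h1 : ((i : ℤ) - ((i + m : ℕ) : ℤ)).toNat = 0 := by omega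
    have h2 : (-((i : ℤ) - ((i + m : ℕ) : ℤ))).toNat = m := by omega
    have := k_pow_add_mul_ki_pow_add i 0 m (of q .E ^ c * of q .F ^ d)
    rw [h1, h2, ← this, zero_add, add_comm m]
  · obtain ⟨m, rfl⟩ := Nat.exists_eq_add_of_le h
    have h1 : (((j + m : ℕ) : ℤ) - (j : ℤ)).toNat = m := by omega
    have h2 : (-(((j + m : ℕ) : ℤ) - (j : ℤ))).toNat = 0 := by omega
    have := k_pow_add_mul_ki_pow_add j m 0 (of q .E ^ c * of q .F ^ d)
    rw [h1, h2, ← this, zero_add, add_comm m]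

theorem span_range_pbw (hq : q ≠ 0) : Submodule.span 𝕂 (Set.range (pbw q)) = ⊤ := by
  refine eq_top_iff.2 ((monoSpan_eq_top hq).symm.le.trans (Submodule.span_mono ?_))
  rintro _ ⟨a, b, i, j, c, d, rfl⟩
  exact ⟨_, (mono_eq_pbw a b i j c d).symm⟩

end A

theorem _root_.LinearMap.injective_of_linearIndependent_comp {K V W ι : Type*} [Ring K]
    [AddCommGroup V] [AddCommGroup W] [Module K V] [Module K W] {f : V →ₗ[K] W} {v : ι → V}
    (hv : Submodule.span K (Set.range v) = ⊤) (h : LinearIndependent K (f ∘ v)) :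
    Function.Injective f := by
  refine (injective_iff_map_eq_zero f).2 fun x hx => ?_
  obtain ⟨c, rfl⟩ := (Finsupp.mem_span_range_iff_exists_finsupp).1 (hv.symm ▸ Submodule.mem_top (x := x))
  have : Finsupp.linearCombination K (f ∘ v) c = 0 := by
    rw [← hx, Finsupp.linearCombination_apply, map_finsuppSum]
    simp
  rw [linearIndependent_iff.1 h c this, Finsupp.sum_zero_index]

variable {𝕂 : Type*} [Field 𝕂] {q : 𝕂} {I : Type*} [Fintype I] [DecidableEq I] [Nonempty I]

/-- The leading exponent of X^aY^bK^iE^rF^s is (a - s, b - r, i, r - s, s), which determines all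
five numbers. So the spanning monomials have linearly independent images. -/
theorem BData.injective_generic_toHom (hq : q ≠ 0) (hq2 : q ^ 2 ≠ 1) (D : BData q (Matrix I I 𝕂))
    {Φ : Matrix I I 𝕂} (h₁ : D.φ * Φ = 1) (h₂ : Φ * D.φ = 1) :
    Function.Injective
      ((D.generic h₁ h₂ fun i => (Pi.single i 1 : Fin 5 → ℤ)).toHom hq hq2) := by
  -- Weights 0, 0, 0, 1, 2, as the leading terms of E and F require.
  let w : (Fin 5 → ℤ) →+ ℤ := Pi.evalAddMonoidHom _ 3 + (2 : ℤ) • Pi.evalAddMonoidHom _ 4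
  have hL (t : ℕ × ℕ × ℤ × ℕ × ℕ) := hasLead_generic_mono (w := w) (D := D) (h₁ := h₁) (h₂ := h₂)
    (d := fun i => (Pi.single i 1 : Fin 5 → ℤ)) hq hq2 (by simp [w]) (by simp [w]) (by simp [w])
    (by simp [w]) (by simp [w]) t.1 t.2.1 t.2.2.1.toNat (-t.2.2.1).toNat t.2.2.2.1 t.2.2.2.2
  refine LinearMap.injective_of_linearIndependent_comp
    (f := ((D.generic h₁ h₂ fun i => (Pi.single i 1 : Fin 5 → ℤ)).toHom hq hq2).toLinearMap)
    (A.span_range_pbw hq) (linearIndependent_of_hasLead ?_ hL)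
  rintro ⟨a, b, i, r, s⟩ ⟨a', b', i', r', s'⟩ h
  have h0 := congrFun h 0
  have h1 := congrFun h 1
  have h2 := congrFun h 2
  have h3 := congrFun h 3
  have h4 := congrFun h 4
  simp at h0 h1 h2 h3 h4
  simp only [Prod.mk.injEq]
  omega

/-- If `A` has a matrix representation of size `N` in which `X`, `Y` and `φ` are invertible, then
`A` satisfies the standard identity of degree `2N`. -/
theorem BData.hasMonicIdentity (hq : q ≠ 0) (hq2 : q ^ 2 ≠ 1) (D : BData q (Matrix I I 𝕂))
    {Φ : Matrix I I 𝕂} (h₁ : D.φ * Φ = 1) (h₂ : Φ * D.φ = 1) :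
    HasMonicIdentity (A q) (2 * Fintype.card I) := by
  refine hasMonicIdentity_of_standardPoly (T := 𝕂) (AlternatingMap.ext fun x => ?_)
  refine D.injective_generic_toHom hq hq2 h₁ h₂ ?_
  have := map_standardPoly (S := 𝕂) (S' := AddMonoidAlgebra 𝕂 (Fin 5 → ℤ))
    ((D.generic h₁ h₂ fun i => (Pi.single i 1 : Fin 5 → ℤ)).toHom hq hq2).toRingHom x
  rw [standardPoly_matrix] at this
  simpa using this

end QuantumPlane

/-! ### Stable subspaces of the model modules. -/

/-- A subspace stable under diagonal operators with simple joint spectrum contains a basis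
vector. -/
theorem Finsupp.exists_single_mem {K ι κ : Type*} [Field K] {W : Submodule K (ι →₀ K)}
    (hW : W ≠ ⊥) {T : κ → Module.End K (ι →₀ K)} {t : κ → ι → K}
    (hT : ∀ k i, T k (Finsupp.single i 1) = t k i • Finsupp.single i 1)
    (hsep : ∀ i j, (∀ k, t k i = t k j) → i = j) (hs : ∀ k, ∀ v ∈ W, T k v ∈ W) :
    ∃ i, Finsupp.single i 1 ∈ W := by
  have hc (k : κ) (v : ι →₀ K) (i : ι) : T k v i = t k i * v i := by
    induction v using Finsupp.induction_linear with
    | zero => simp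
    | add v w hv hw => simp [hv, hw, mul_add]
    | single j c =>
      rw [← mul_one c, ← smul_eq_mul, ← Finsupp.smul_single, map_smul, hT]
      by_cases h : i = j
      · subst h; simp; ring
      · simp [Finsupp.single_eq_of_ne h]
  have key (n : ℕ) : ∀ v ∈ W, v ≠ 0 → v.support.card = n → ∃ i, Finsupp.single i 1 ∈ W := by
    induction n using Nat.strong_induction_on with
    | _ n ih =>
    intro v hv hv0 hn
    obtain ⟨i, hi⟩ := Finsupp.support_nonempty_iff.2 hv0
    by_cases h : ∃ j ∈ v.support, j ≠ i
    · obtain ⟨j, hj, hji⟩ := h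
      obtain ⟨k, hk⟩ := not_forall.1 fun h => hji (hsep j i h)
      have hv' (s : ι) : (T k v - t k i • v) s = (t k s - t k i) * v s := by
        simp [hc, sub_mul]
      -- With `k` separating `i` from `j`, this combination loses `i` from the support but keeps
      -- `j`, so it is nonzero with smaller support.
      refine ih _ ?_ (T k v - t k i • v) (sub_mem (hs k v hv) (W.smul_mem _ hv)) ?_ rfl
      · rw [← hn]
        refine Finset.card_lt_card (Finset.ssubset_iff_of_subset (fun s hs' => ?_) |>.2 ⟨i, hi, ?_⟩)
        · rw [Finsupp.mem_support_iff, hv'] at hs'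
          exact Finsupp.mem_support_iff.2 (right_ne_zero_of_mul hs')
        · simp [hv']
      · intro h0
        have := DFunLike.congr_fun h0 j
        rw [hv'] at this
        exact mul_ne_zero (sub_ne_zero.2 hk) (Finsupp.mem_support_iff.1 hj) this
    · push Not at h
      refine ⟨i, ?_⟩
      have : v = v i • Finsupp.single i 1 := by
        ext s
        by_cases hsi : s = i
        · subst hsi; simp
        · have : v s = 0 := by
            by_contra hne
            exact hsi (h s (Finsupp.mem_support_iff.2 hne))
          simp [Finsupp.single_eq_of_ne hsi, this]
      rw [this] at hv
      exact (W.smul_mem_iff (Finsupp.mem_support_iff.1 hi)).1 hv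
  obtain ⟨v, hv, hv0⟩ := W.exists_mem_ne_zero_of_ne_bot hW
  exact key _ v hv hv0 rfl

theorem ZMod.induction_succ {m : ℕ} [NeZero m] {P : ZMod m → Prop} {b : ZMod m} (hb : P b)
    (h : ∀ b, P b → P (b + 1)) (b' : ZMod m) : P b' := by
  have key (k : ℕ) : P (b + k) := by
    induction k with
    | zero => simpa using hb
    | succ k ih => rw [Nat.cast_succ, ← add_assoc]; exact h _ ih
  have := key (b' - b).val
  rwa [ZMod.natCast_zmod_val, add_sub_cancel] at this

namespace QuantumPlane

variable {𝕂 : Type*} [Field 𝕂] {q : 𝕂} {n l : ℕ}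

section Simple

variable [NeZero l] {ξ lam1 lam2 : 𝕂ˣ} {ε : ℤ} {c c' : 𝕂} {h : ℕ} {d : ZMod n → 𝕂}

theorem eq_of_dvd_val_sub {m : ℕ} [NeZero m] {a a' : ZMod m} (h : (m : ℤ) ∣ a.val - a'.val) :
    a = a' := by
  have := (ZMod.intCast_zmod_eq_zero_iff_dvd _ m).2 h
  push_cast [ZMod.natCast_zmod_val] at this
  exact sub_eq_zero.1 this

/-- Adding the two congruences of exponents modulo l eliminates b and gives l ∣ 2(a - a'), whence a
= a' by `hnl`; then either congruence gives b = b'. -/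
theorem eq_of_zpow_eq [NeZero n] (hq : IsPrimitiveRoot q l) (hε : ε = 1 ∨ ε = -1)
    (hnl : ∀ m : ℤ, (l : ℤ) ∣ 2 * m → (n : ℤ) ∣ m) {a a' : ZMod n} {b b' : ZMod l}
    (h1 : q ^ (ε * a.val - b.val : ℤ) = q ^ (ε * a'.val - b'.val : ℤ))
    (h2 : q ^ (ε * a.val + b.val : ℤ) = q ^ (ε * a'.val + b'.val : ℤ)) : (a, b) = (a', b') := by
  have hq0 : q ≠ 0 := hq.ne_zero (NeZero.ne l)
  have dv {r s : ℤ} (h : q ^ r = q ^ s) : (l : ℤ) ∣ r - s := by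
    rw [← hq.zpow_eq_one_iff_dvd, zpow_sub₀ hq0, h, div_self (zpow_ne_zero _ hq0)]
  have e1 := dv h1
  have e2 := dv h2
  have ha : a = a' := by
    refine eq_of_dvd_val_sub (hnl _ ?_)
    have e3 := (dvd_add e1 e2).mul_left ε
    have : ε * ε = 1 := by rcases hε with rfl | rfl <;> rfl
    rw [show 2 * ((a.val : ℤ) - a'.val) =
      ε * (ε * a.val - b.val - (ε * a'.val - b'.val) + (ε * a.val + b.val - (ε * a'.val + b'.val)))
      by linear_combination (-2 * ((a.val : ℤ) - a'.val)) * this]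
    exact e3
  subst ha
  have hb : b = b' := eq_of_dvd_val_sub (by convert e2 using 1; ring)
  rw [hb]

theorem X_pow_mul_l (k : ℕ) : opX n l ξ ^ (l * k) = algebraMap 𝕂 _ ((ξ : 𝕂) ^ k) := by
  rw [pow_mul, X_pow_l, map_pow]

/-- X^l is a nonzero scalar, so X^(lk - k) inverts X^k up to a scalar. -/
theorem mem_of_X_pow_mem {W : Submodule 𝕂 (Sp 𝕂 n l)} (hX : ∀ v ∈ W, opX n l ξ v ∈ W) {k : ℕ}
    {v : Sp 𝕂 n l} (hv : (opX n l ξ ^ k) v ∈ W) : v ∈ W := by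
  have hp (m : ℕ) {u : Sp 𝕂 n l} (hu : u ∈ W) : (opX n l ξ ^ m) u ∈ W := by
    induction m with
    | zero => simpa
    | succ m ih => rw [pow_succ', Module.End.mul_apply]; exact hX _ ih
  have h1 := hp (l * k - k) hv
  rw [← Module.End.mul_apply, ← pow_add,
    Nat.sub_add_cancel (Nat.le_mul_of_pos_left k (NeZero.pos l)), X_pow_mul_l,
    Module.algebraMap_end_apply] at h1
  exact (W.smul_mem_iff (pow_ne_zero _ ξ.ne_zero)).1 h1

theorem e_mem_of_X {W : Submodule 𝕂 (Sp 𝕂 n l)} (hX : ∀ v ∈ W, opX n l ξ v ∈ W) {a : ZMod n}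
    {b : ZMod l} (hv : e a b ∈ W) (b' : ZMod l) : e a b' ∈ W := by
  refine ZMod.induction_succ (P := fun b => e a b ∈ W) hv (fun b hb => ?_) b'
  have := hX _ hb
  rw [opX, basisOp_e] at this
  split_ifs at this with h
  · rw [h, neg_add_cancel]
    exact (W.smul_mem_iff ξ.ne_zero).1 this
  · exact this

/-- A nonzero subspace stable under the operators of one of the modules `N` is everything. -/
theorem eq_top_of_stable [NeZero n] (hq : IsPrimitiveRoot q l) (hε : ε = 1 ∨ ε = -1)
    (hnl : ∀ m : ℤ, (l : ℤ) ∣ 2 * m → (n : ℤ) ∣ m) (hcd : c ≠ 0 ∨ ∀ a ≠ 0, d a ≠ 0)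
    {W : Submodule 𝕂 (Sp 𝕂 n l)} (hW : W ≠ ⊥) (hX : ∀ v ∈ W, opX n l ξ v ∈ W)
    (hK : ∀ v ∈ W, opK n l q lam1 ε v ∈ W) (hY : ∀ v ∈ W, opY n l q ξ lam2 ε v ∈ W)
    (hR : ∀ v ∈ W, opRaise n l ξ c h v ∈ W) (hL : ∀ v ∈ W, opLower n l ξ c' h d v ∈ W) :
    W = ⊤ := by
  -- The diagonal operators are K (`true`) and YX (`false`), whose joint eigenvalues separate the
  -- basis.
  obtain ⟨⟨a₀, b₀⟩, h₀⟩ := Finsupp.exists_single_mem hW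
    (T := fun k : Bool => cond k (opK n l q lam1 ε) (opX n l ξ * opY n l q ξ lam2 ε))
    (t := fun k i => cond k (lam1 * q ^ (ε * i.1.val - i.2.val : ℤ))
      (lam2 * q ^ (ε * i.1.val + i.2.val : ℤ)))
    (by
      rintro (_ | _) ⟨a, b⟩
      · exact X_Y_e a b
      · exact K_e a b)
    (by
      rintro ⟨a, b⟩ ⟨a', b'⟩ hk
      exact eq_of_zpow_eq hq hε hnl (mul_left_cancel₀ lam1.ne_zero (hk true))
        (mul_left_cancel₀ lam2.ne_zero (hk false)))
    (by
      rintro (_ | _) v hv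
      · exact hX _ (hY _ hv)
      · exact hK _ hv)
  let P (a : ZMod n) : Prop := ∀ b, e a b ∈ W
  have hP₀ : P a₀ := e_mem_of_X hX h₀
  have up (a : ZMod n) (ha : a ≠ -1) (hP : P a) : P (a + 1) := fun b => by
    have := hR _ (hP b)
    rwa [opRaise, basisOp_e, if_neg ha] at this
  have hP : ∀ a, P a := by
    -- If `c ≠ 0`, raising runs through all a cyclically. Otherwise the nonzero coefficients allow
    -- lowering to a = 0, from where raising reaches every a without wrapping around.
    rcases hcd with hc | hd
    · refine ZMod.induction_succ hP₀ fun a hP => ?_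
      by_cases ha : a = -1
      · intro b
        have := hR _ (hP b)
        rw [opRaise, basisOp_e, if_pos ha, W.smul_mem_iff hc] at this
        rw [ha, neg_add_cancel]
        exact mem_of_X_pow_mem hX this
      · exact up a ha hP
    · have down (a : ZMod n) (ha : a ≠ 0) (hP : P a) : P (a - 1) := fun b => by
        have := hL _ (hP b)
        rwa [opLower, basisOp_e, if_neg ha, W.smul_mem_iff (hd a ha)] at this
      have h0 : P 0 := by
        have key (k : ℕ) : ∀ a : ZMod n, a.val = k → P a → P 0 := by
          induction k with
          | zero => intro a ha hP; rwa [(ZMod.val_eq_zero a).1 ha] at hP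
          | succ k ih =>
            intro a ha hP
            have ha0 : a ≠ 0 := by rintro rfl; simp at ha
            exact ih (a - 1) (by have := val_pred ha0; omega) (down a ha0 hP)
        exact key _ a₀ rfl hP₀
      have key (k : ℕ) : ∀ a : ZMod n, a.val = k → P a := by
        induction k with
        | zero => intro a ha; rwa [(ZMod.val_eq_zero a).1 ha]
        | succ k ih =>
          intro a ha
          have ha0 : a ≠ 0 := by rintro rfl; simp at ha
          have := up (a - 1) (fun h => ha0 (by linear_combination h))
            (ih (a - 1) (by have := val_pred ha0; omega))
          rwa [sub_add_cancel] at this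
      exact fun a => key _ a rfl
  refine eq_top_iff.2 fun v _ => ?_
  induction v using Finsupp.induction_linear with
  | zero => exact zero_mem _
  | add v w hv hw => exact add_mem (hv trivial) (hw trivial)
  | single i s =>
    rw [← mul_one s, ← smul_eq_mul, ← Finsupp.smul_single]
    exact W.smul_mem _ (hP i.1 i.2)

end Simple

end QuantumPlane

theorem isSimpleModule_of_eq_top {R M : Type*} [Ring R] [AddCommGroup M] [Module R M]
    [Nontrivial M] (h : ∀ W : Submodule R M, W ≠ ⊥ → W = ⊤) : IsSimpleModule R M :=
  (isSimpleModule_iff R M).2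
    { eq_bot_or_eq_top := fun W => or_iff_not_imp_left.2 (h W) }

/-! ### Comparison of A-submodules and B-submodules. -/

namespace QuantumPlane

variable {𝕂 : Type*} [Field 𝕂] {q : 𝕂}

section RightModule

variable {M : Type*} [AddCommGroup M] [Module 𝕂 M] [Module (A q)ᵐᵒᵖ M]
  [IsScalarTower 𝕂 (A q)ᵐᵒᵖ M]

instance : IsScalarTower 𝕂 (B q).op M := ⟨fun r a v => smul_assoc r (a : (A q)ᵐᵒᵖ) v⟩

/-- A linear subspace stable under the generators of `A` is stable under `A`. -/
theorem A.smul_mem_of_gen {W : Submodule 𝕂 M} (h : ∀ g, ∀ v ∈ W, op (A.of q g) • v ∈ W) (a : A q)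
    {v : M} (hv : v ∈ W) : op a • v ∈ W := by
  let T : Subalgebra 𝕂 (A q) :=
    { carrier := {a | ∀ v ∈ W, op a • v ∈ W}
      mul_mem' := fun {a b} ha hb v hv => by rw [op_mul, mul_smul]; exact hb _ (ha v hv)
      add_mem' := fun {a b} ha hb v hv => by
        rw [op_add, add_smul]; exact W.add_mem (ha v hv) (hb v hv)
      algebraMap_mem' := fun r v hv => by
        rw [← MulOpposite.algebraMap_apply, algebraMap_smul]; exact W.smul_mem r hv }
  have hT : T = ⊤ := A.eq_top_of_of_mem h
  exact (hT ▸ Algebra.mem_top : a ∈ T) v hv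

theorem A.phi_eq :
    A.phi q = A.of q .X - (q - q⁻¹) • (A.of q .Y * A.of q .E) := by
  rw [A.phi, A.E_Y]
  module

theorem A.psi_eq : A.psi q = (1 - q ^ 2) • (A.of q .X * A.of q .F) -
    q ^ 2 • (A.of q .Y * A.of q .Kinv) := by
  rw [A.psi, A.F_X]
  module

theorem A.sub_inv_ne_zero (hq : q ≠ 0) (hq2 : q ^ 2 ≠ 1) : q - q⁻¹ ≠ 0 := fun h =>
  hq2 (by field_simp at h; linear_combination h)

theorem A.E_smul (hq : q ≠ 0) (hq2 : q ^ 2 ≠ 1) (v : M) :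
    op (A.of q .E) • op (A.of q .Y) • v =
      (q - q⁻¹)⁻¹ • (op (A.of q .X) • v - op (A.phi q) • v) := by
  rw [A.phi_eq, op_sub, op_smul, op_mul, sub_smul, sub_sub_cancel, smul_assoc,
    inv_smul_smul₀ (A.sub_inv_ne_zero hq hq2), mul_smul]

theorem A.F_smul (hq2 : q ^ 2 ≠ 1) (v : M) :
    op (A.of q .F) • op (A.of q .X) • v = (1 - q ^ 2)⁻¹ •
      (op (A.psi q) • v + q ^ 2 • op (A.of q .Kinv) • op (A.of q .Y) • v) := by
  have ht : 1 - q ^ 2 ≠ 0 := fun h => hq2 (by linear_combination -h)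
  rw [A.psi_eq, op_sub, op_smul, op_smul, op_mul, op_mul, sub_smul, smul_assoc, smul_assoc,
    mul_smul (op (A.of q .Kinv)), sub_add_cancel, inv_smul_smul₀ ht, mul_smul]

theorem A.phi_mem : A.phi q ∈ B q := Algebra.subset_adjoin (by simp)

theorem A.psi_mem : A.psi q ∈ B q := Algebra.subset_adjoin (by simp)

theorem A.k_mem : A.of q .K ∈ B q := Algebra.subset_adjoin (by simp)

theorem A.ki_mem : A.of q .Kinv ∈ B q := Algebra.subset_adjoin (by simp)

theorem A.x_mem : A.of q .X ∈ B q := Algebra.subset_adjoin (by simp)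

theorem A.y_mem : A.of q .Y ∈ B q := Algebra.subset_adjoin (by simp)

omit [Module 𝕂 M] [IsScalarTower 𝕂 (A q)ᵐᵒᵖ M] in
theorem B.smul_mem (W : Submodule (B q).op M) {a : A q} (ha : a ∈ B q) {v : M} (hv : v ∈ W) :
    op a • v ∈ W :=
  W.smul_mem (⟨op a, ha⟩ : (B q).op) hv

/-- The subspaces of a right `A`-module that are stable under `B` are stable under `A` if `X` and
`Y` act invertibly and the dimension is finite. -/
theorem B.smul_mem_of_finiteDimensional [FiniteDimensional 𝕂 M] (hq : q ≠ 0) (hq2 : q ^ 2 ≠ 1)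
    (hM : XYInvertible q M) (W : Submodule (B q).op M) (a : A q) {v : M} (hv : v ∈ W) :
    op a • v ∈ W := by
  let W' : Submodule 𝕂 M := W.restrictScalars 𝕂
  -- An injective operator preserving a finite dimensional subspace maps it onto itself. Hence
  -- vectors of `W` can be divided by X and Y inside `W`, which is what the formulas for E and F
  -- need.
  have surj {x : A q} (hx : x ∈ B q) (hinj : Function.Injective fun m : M => op x • m) {v : M}
      (hv : v ∈ W) : ∃ u ∈ W, op x • u = v := by
    let f : W' →ₗ[𝕂] W' := ((Algebra.lsmul 𝕂 𝕂 M (op x)) : Module.End 𝕂 M).restrict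
      (fun u hu => B.smul_mem W hx hu)
    have hf : Function.Injective f := fun u u' h => Subtype.ext (hinj (congrArg Subtype.val h))
    obtain ⟨u, hu⟩ := LinearMap.surjective_of_injective hf ⟨v, hv⟩
    exact ⟨u, u.2, congrArg Subtype.val hu⟩
  refine A.smul_mem_of_gen (W := W') (fun g v hv => ?_) a hv
  cases g with
  | E =>
    obtain ⟨u, hu, rfl⟩ := surj A.y_mem hM.2.1 hv
    rw [A.E_smul hq hq2]
    exact W'.smul_mem _ (W'.sub_mem (B.smul_mem W A.x_mem hu) (B.smul_mem W A.phi_mem hu))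
  | F =>
    obtain ⟨u, hu, rfl⟩ := surj A.x_mem hM.1.1 hv
    rw [A.F_smul hq2]
    exact W'.smul_mem _ (W'.add_mem (B.smul_mem W A.psi_mem hu)
      (W'.smul_mem _ (B.smul_mem W A.ki_mem (B.smul_mem W A.y_mem hu))))
  | K => exact B.smul_mem W A.k_mem hv
  | Kinv => exact B.smul_mem W A.ki_mem hv
  | X => exact B.smul_mem W A.x_mem hv
  | Y => exact B.smul_mem W A.y_mem hv

theorem isSimpleB_of_isSimpleModule [FiniteDimensional 𝕂 M] (hq : q ≠ 0) (hq2 : q ^ 2 ≠ 1)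
    (hM : IsSimpleXY q M) : IsSimpleB q M := by
  have := hM.simple
  have := IsSimpleModule.nontrivial (A q)ᵐᵒᵖ M
  refine isSimpleModule_of_eq_top fun W hW => ?_
  let W' : Submodule (A q)ᵐᵒᵖ M :=
    { W with smul_mem' := fun a v hv => (B.smul_mem_of_finiteDimensional hq hq2 hM.invertible W
        a.unop hv : op a.unop • v ∈ W) }
  have hW' : W' = ⊤ := (eq_bot_or_eq_top W').resolve_left fun h => hW (by
    refine (Submodule.eq_bot_iff W).2 fun v hv => ?_
    exact (Submodule.eq_bot_iff W').1 h v hv)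
  exact eq_top_iff.2 fun v _ => (hW' ▸ Submodule.mem_top : v ∈ W')

omit [Module 𝕂 M] [IsScalarTower 𝕂 (A q)ᵐᵒᵖ M] in
theorem isSimpleModule_of_isSimpleB (hM : IsSimpleB q M) : IsSimpleModule (A q)ᵐᵒᵖ M := by
  have := IsSimpleModule.nontrivial (B q).op M
  refine isSimpleModule_of_eq_top fun W hW => ?_
  let W' : Submodule (B q).op M := { W with smul_mem' := fun a v hv => W.smul_mem (a : (A q)ᵐᵒᵖ) hv }
  have hW' : W' = ⊤ := (hM.toIsSimpleOrder.eq_bot_or_eq_top W').resolve_left fun h => hW (by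
    refine (Submodule.eq_bot_iff W).2 fun v hv => ?_
    exact (Submodule.eq_bot_iff W').1 h v hv)
  exact eq_top_iff.2 fun v _ => (hW' ▸ Submodule.mem_top : v ∈ W')

end RightModule

/-! ### Simplicity of N₁, …, N₆. -/

section BMod

variable {n l : ℕ} (hq : IsPrimitiveRoot q l) (hl : 3 ≤ l)
  (D : BData q (Module.End 𝕂 (Sp 𝕂 n l))ᵐᵒᵖ)

theorem BMod.smul_def (a : A q) (v : BMod hq hl D) :
    op a • v = (D.toHom (hq.ne_zero (by omega)) (pow_two_ne_one hq hl) a).unop v :=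
  rfl

theorem BMod.K_smul (v : BMod hq hl D) : op (A.of q .K) • v = D.k.unop v := by
  rw [BMod.smul_def, toHom_of, BData.act]

theorem BMod.X_smul (v : BMod hq hl D) : op (A.of q .X) • v = D.x.unop v := by
  rw [BMod.smul_def, toHom_of, BData.act]

theorem BMod.Y_smul (v : BMod hq hl D) : op (A.of q .Y) • v = D.y.unop v := by
  rw [BMod.smul_def, toHom_of, BData.act]

theorem BMod.phi_smul (v : BMod hq hl D) : op (A.phi q) • v = D.φ.unop v := by
  rw [BMod.smul_def, toHom_phi]

theorem BMod.psi_smul (v : BMod hq hl D) : op (A.psi q) • v = D.ψ.unop v := by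
  rw [BMod.smul_def, toHom_psi]

theorem BMod.xyInvertible : XYInvertible q (BMod hq hl D) := by
  have bij {T S : (Module.End 𝕂 (Sp 𝕂 n l))ᵐᵒᵖ} (h1 : T * S = 1) (h2 : S * T = 1) :
      Function.Bijective T.unop := by
    refine Function.bijective_iff_has_inverse.2 ⟨S.unop, fun v => ?_, fun v => ?_⟩
    · rw [← Module.End.mul_apply, ← unop_mul, h1]; rfl
    · rw [← Module.End.mul_apply, ← unop_mul, h2]; rfl
  refine ⟨?_, ?_⟩
  · rw [funext (BMod.X_smul hq hl D)]
    exact bij D.x_xi D.xi_x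
  · rw [funext (BMod.Y_smul hq hl D)]
    exact bij D.y_yi D.yi_y

theorem BMod.isSimpleB [NeZero n] [NeZero l] (h : ∀ W : Submodule 𝕂 (Sp 𝕂 n l), W ≠ ⊥ →
      (∀ v ∈ W, D.x.unop v ∈ W) → (∀ v ∈ W, D.k.unop v ∈ W) → (∀ v ∈ W, D.y.unop v ∈ W) →
      (∀ v ∈ W, D.φ.unop v ∈ W) → (∀ v ∈ W, D.ψ.unop v ∈ W) → W = ⊤) :
    IsSimpleB q (BMod hq hl D) := by
  have : Nontrivial (BMod hq hl D) := inferInstanceAs (Nontrivial (Sp 𝕂 n l))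
  refine isSimpleModule_of_eq_top fun W hW => ?_
  let W' : Submodule 𝕂 (BMod hq hl D) := W.restrictScalars 𝕂
  have hW' : W' = ⊤ := h W' ?_ ?_ ?_ ?_ ?_ ?_
  · exact eq_top_iff.2 fun v _ => (hW' ▸ Submodule.mem_top : v ∈ W')
  · intro h0
    exact hW ((Submodule.eq_bot_iff W).2 fun v hv => (Submodule.eq_bot_iff W').1 h0 v hv)
  · exact fun v hv => BMod.X_smul hq hl D v ▸ B.smul_mem W A.x_mem hv
  · exact fun v hv => BMod.K_smul hq hl D v ▸ B.smul_mem W A.k_mem hv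
  · exact fun v hv => BMod.Y_smul hq hl D v ▸ B.smul_mem W A.y_mem hv
  · exact fun v hv => BMod.phi_smul hq hl D v ▸ B.smul_mem W A.phi_mem hv
  · exact fun v hv => BMod.psi_smul hq hl D v ▸ B.smul_mem W A.psi_mem hv

theorem BMod.isSimpleXY (h : IsSimpleB q (BMod hq hl D)) : IsSimpleXY q (BMod hq hl D) :=
  ⟨isSimpleModule_of_isSimpleB h, BMod.xyInvertible hq hl D⟩

theorem BMod.finrank [NeZero n] [NeZero l] : Module.finrank 𝕂 (BMod hq hl D) = n * l := by
  change Module.finrank 𝕂 (Sp 𝕂 n l) = n * l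
  simp [ZMod.card]

instance [NeZero n] [NeZero l] : FiniteDimensional 𝕂 (BMod hq hl D) :=
  inferInstanceAs (FiniteDimensional 𝕂 (Sp 𝕂 n l))

variable {h : ℕ} (hn0 : n ≠ 0) (hl0 : l ≠ 0) (hq0 : q ≠ 0) (hql : q ^ l = 1)
    (hqn : q ^ n = q ^ h) (hqh : q ^ h * q ^ h = 1) (ξ lam1 lam2 : 𝕂ˣ) (lam3 c c' : 𝕂)

theorem isSimpleB_dataI (hnl : ∀ m : ℤ, (l : ℤ) ∣ 2 * m → (n : ℤ) ∣ m) (hc : c ≠ 0)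
    (hw : (c * c') • opX n l ξ ^ (2 * h) = 1 ∨ coeffI n q lam1 lam2 lam3 0 = 0) :
    IsSimpleB q (BMod hq hl (dataI hn0 hl0 hq0 hql hqn hqh ξ lam1 lam2 lam3 c c' hw)) := by
  have : NeZero n := ⟨hn0⟩
  have : NeZero l := ⟨hl0⟩
  exact BMod.isSimpleB hq hl _ fun W hW hX hK hY hφ hψ =>
    eq_top_of_stable hq (Or.inr rfl) hnl (Or.inl hc) hW hX hK hY hφ hψ

theorem isSimpleB_dataII (hnl : ∀ m : ℤ, (l : ℤ) ∣ 2 * m → (n : ℤ) ∣ m)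
    (hw : (c * c') • opX n l ξ ^ (2 * h) = 1 ∨ coeffII n q lam1 lam2 lam3 0 = 0)
    (hcd : c ≠ 0 ∨ ∀ a ≠ 0, coeffII n q lam1 lam2 lam3 a ≠ 0) :
    IsSimpleB q (BMod hq hl (dataII hn0 hl0 hq0 hql hqn hqh ξ lam1 lam2 lam3 c c' hw)) := by
  have : NeZero n := ⟨hn0⟩
  have : NeZero l := ⟨hl0⟩
  exact BMod.isSimpleB hq hl _ fun W hW hX hK hY hφ hψ =>
    eq_top_of_stable hq (Or.inl rfl) hnl hcd hW hX hK hY hψ hφ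

/-- For the λ₃ forced by uφ = 0, the general coefficients collapse to those of N₃, N₅ and N₆. -/
theorem coeffII_eq (hq0 : q ≠ 0) (a : ZMod n) :
    coeffII n q lam1 lam2 (q * (1 - q ^ 2) * lam1 * lam2) a =
      q * (1 - q ^ (2 * a.val : ℤ)) * lam1 * lam2 := by
  have h5 : q ^ (2 : ℤ) = q ^ 2 := by norm_cast
  rw [coeffII, zpow_sub₀ hq0, h5]
  field_simp
  ring

/-- The factor 1 - q^(2a) vanishes only if l ∣ 2a, hence n ∣ a, hence a = 0. -/
theorem coeffII_ne_zero [NeZero n] (hq0 : q ≠ 0) (hq : IsPrimitiveRoot q l)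
    (hnl : ∀ m : ℤ, (l : ℤ) ∣ 2 * m → (n : ℤ) ∣ m) {a : ZMod n} (ha : a ≠ 0) :
    coeffII n q lam1 lam2 (q * (1 - q ^ 2) * lam1 * lam2) a ≠ 0 := by
  rw [coeffII_eq lam1 lam2 hq0]
  refine mul_ne_zero (mul_ne_zero (mul_ne_zero hq0 fun h => ha ?_) lam1.ne_zero) lam2.ne_zero
  have := hnl _ ((hq.zpow_eq_one_iff_dvd _).1 (sub_eq_zero.1 h).symm)
  exact eq_of_dvd_val_sub (by simpa using this)

theorem dvd_of_dvd_two_mul_of_odd (ho : Odd l) (m : ℤ) (h : (l : ℤ) ∣ 2 * m) : (l : ℤ) ∣ m :=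
  IsCoprime.dvd_of_dvd_mul_left (Nat.isCoprime_iff_coprime.2 ho.coprime_two_right) h

theorem half_dvd_of_dvd_two_mul (he : Even l) (m : ℤ) (h : (l : ℤ) ∣ 2 * m) :
    ((l / 2 : ℕ) : ℤ) ∣ m := by
  obtain ⟨k, rfl⟩ := he
  rw [show (k + k) / 2 = k by omega]
  refine Int.dvd_of_mul_dvd_mul_left two_ne_zero ?_ |>.elim fun c hc => ⟨c, hc⟩
  convert h using 1
  push_cast; ring

section N

theorem isSimpleB_N1 (ho : Odd l) (α ξ lam1 lam2 : 𝕂ˣ) (lam3 : 𝕂) :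
    IsSimpleB q (N1 hq hl α ξ lam1 lam2 lam3) :=
  isSimpleB_dataI hq hl _ _ _ _ _ _ _ _ _ _ _ _ (dvd_of_dvd_two_mul_of_odd ho) α.ne_zero _

theorem isSimpleB_N2 (ho : Odd l) (β ξ lam1 lam2 : 𝕂ˣ) (lam3 : 𝕂) :
    IsSimpleB q (N2 hq hl β ξ lam1 lam2 lam3) :=
  isSimpleB_dataII hq hl _ _ _ _ _ _ _ _ _ _ _ _ (dvd_of_dvd_two_mul_of_odd ho) _
    (Or.inl β.ne_zero)

theorem isSimpleB_N3 (ho : Odd l) (ξ lam1 lam2 : 𝕂ˣ) : IsSimpleB q (N3 hq hl ξ lam1 lam2) :=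
  have : NeZero l := ⟨by omega⟩
  isSimpleB_dataII hq hl _ _ _ _ _ _ _ _ _ _ _ _ (dvd_of_dvd_two_mul_of_odd ho) _
    (Or.inr fun _ => coeffII_ne_zero lam1 lam2 (hq.ne_zero (by omega)) hq
      (dvd_of_dvd_two_mul_of_odd ho))

theorem isSimpleB_N4 (he : Even l) (α' ξ lam1 lam2 : 𝕂ˣ) (lam3 : 𝕂) :
    IsSimpleB q (N4 hq hl he α' ξ lam1 lam2 lam3) :=
  isSimpleB_dataI hq hl _ _ _ _ _ _ _ _ _ _ _ _ (half_dvd_of_dvd_two_mul he)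
    (mul_ne_zero (inv_ne_zero ξ.ne_zero) α'.ne_zero) _

theorem isSimpleB_N5 (he : Even l) (β' ξ lam1 lam2 : 𝕂ˣ) :
    IsSimpleB q (N5 hq hl he β' ξ lam1 lam2) :=
  isSimpleB_dataII hq hl _ _ _ _ _ _ _ _ _ _ _ _ (half_dvd_of_dvd_two_mul he) _
    (Or.inl (mul_ne_zero (inv_ne_zero ξ.ne_zero) β'.ne_zero))

theorem isSimpleB_N6 (he : Even l) (ξ lam1 lam2 : 𝕂ˣ) : IsSimpleB q (N6 hq hl he ξ lam1 lam2) :=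
  have : NeZero (l / 2) := ⟨by omega⟩
  isSimpleB_dataII hq hl _ _ _ _ _ _ _ _ _ _ _ _ (half_dvd_of_dvd_two_mul he) _
    (Or.inr fun _ => coeffII_ne_zero lam1 lam2 (hq.ne_zero (by omega)) hq
      (half_dvd_of_dvd_two_mul he))

end N

end BMod

end QuantumPlane

/-! ### The identity of degree 2nl and the PI degree. -/

namespace QuantumPlane

variable {𝕂 : Type*} [Field 𝕂] {q : 𝕂} {n l : ℕ}

/-- The image of `D` under a homomorphism of algebras. -/
def BData.map {R S : Type*} [Ring R] [Algebra 𝕂 R] [Ring S] [Algebra 𝕂 S] (D : BData q R)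
    (f : R →ₐ[𝕂] S) : BData q S where
  k := f D.k
  ki := f D.ki
  x := f D.x
  xi := f D.xi
  y := f D.y
  yi := f D.yi
  φ := f D.φ
  ψ := f D.ψ
  k_ki := by rw [← map_mul, D.k_ki, map_one]
  ki_k := by rw [← map_mul, D.ki_k, map_one]
  x_xi := by rw [← map_mul, D.x_xi, map_one]
  xi_x := by rw [← map_mul, D.xi_x, map_one]
  y_yi := by rw [← map_mul, D.y_yi, map_one]
  yi_y := by rw [← map_mul, D.yi_y, map_one]
  k_x := by rw [← map_mul, D.k_x, map_smul, map_mul]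
  y_k := by rw [← map_mul, D.y_k, map_smul, map_mul]
  x_y := by rw [← map_mul, D.x_y, map_smul, map_mul]
  φ_x := by rw [← map_mul, D.φ_x, map_mul]
  y_φ := by rw [← map_mul, D.y_φ, map_smul, map_mul]
  k_φ := by rw [← map_mul, D.k_φ, map_smul, map_mul]
  ψ_x := by rw [← map_mul, D.ψ_x, map_mul]
  ψ_y := by rw [← map_mul, D.ψ_y, map_smul, map_mul]
  ψ_k := by rw [← map_mul, D.ψ_k, map_smul, map_mul]
  ψ_φ := by rw [← map_mul, ← map_mul, ← map_sub, D.ψ_φ, map_smul, map_mul, map_mul]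

section

variable (hn0 : n ≠ 0) (hl0 : l ≠ 0) (hq0 : q ≠ 0) (hql : q ^ l = 1) {h : ℕ}
    (hqn : q ^ n = q ^ h) (hqh : q ^ h * q ^ h = 1) (ξ lam1 lam2 : 𝕂ˣ) (lam3 c c' : 𝕂)

-- Any one representation of dimension nl with φ invertible can be deformed to a faithful one, so λ₁
-- = λ₂ = 1, λ₃ = 0 will do.
include hn0 hl0 hq0 hql hqn hqh in
theorem hasMonicIdentity_of_dataI (hq2 : q ^ 2 ≠ 1)
    (hw : (c * c') • opX n l ξ ^ (2 * h) = 1) : HasMonicIdentity (A q) (2 * (n * l)) := by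
  have : NeZero n := ⟨hn0⟩
  have : NeZero l := ⟨hl0⟩
  let D := dataI hn0 hl0 hq0 hql hqn hqh ξ 1 1 0 c c' (Or.inl hw)
  -- Right actions land in the opposite endomorphism algebra, and transposition turns this into
  -- matrices.
  let f : (Module.End 𝕂 (Sp 𝕂 n l))ᵐᵒᵖ →ₐ[𝕂] Matrix (ZMod n × ZMod l) (ZMod n × ZMod l) 𝕂 :=
    AlgHom.opComm ((Matrix.transposeAlgEquiv _ 𝕂 𝕂).toAlgHom.comp
      (LinearMap.toMatrixAlgEquiv Finsupp.basisSingleOne).toAlgHom)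
  -- Lowering with all coefficients 1 inverts raising, because cc'X^(2h) = 1 at the place where the
  -- index wraps around.
  let Φ := op (opLower n l ξ c' h fun _ => 1)
  have h1 : D.φ * Φ = 1 := unop_injective (op_ext fun a b => by
    change opLower n l ξ c' h (fun _ => 1) (opRaise n l ξ c h (e a b)) = e a b
    rw [lower_raise (Or.inl hw), one_smul])
  have h2 : Φ * D.φ = 1 := unop_injective (op_ext fun a b => by
    change opRaise n l ξ c h (opLower n l ξ c' h (fun _ => 1) (e a b)) = e a b
    rw [raise_lower (Or.inl hw), one_smul])
  have := (D.map f).hasMonicIdentity hq0 hq2 (Φ := f Φ)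
    (by change f D.φ * f Φ = 1; rw [← map_mul, h1, map_one])
    (by change f Φ * f D.φ = 1; rw [← map_mul, h2, map_one])
  simpa [ZMod.card] using this

end

variable (hq : IsPrimitiveRoot q l) (hl : 3 ≤ l)

include hq hl in
theorem hasMonicIdentity_of_odd : HasMonicIdentity (A q) (2 * (l * l)) :=
  hasMonicIdentity_of_dataI (n := l) (h := 0) (by omega) (by omega) (hq.ne_zero (by omega))
    hq.pow_eq_one (by rw [hq.pow_eq_one, pow_zero]) (by simp) 1 1 1 (pow_two_ne_one hq hl)
    (by simp)

include hq hl in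
theorem hasMonicIdentity_of_even (he : Even l) : HasMonicIdentity (A q) (2 * (l / 2 * l)) :=
  hasMonicIdentity_of_dataI (n := l / 2) (h := l / 2) (by omega) (by omega)
    (hq.ne_zero (by omega)) hq.pow_eq_one rfl (half_pow hq he) 1 1 1 (pow_two_ne_one hq hl)
    (by
      have : NeZero l := ⟨by omega⟩
      rw [Nat.two_mul_div_two_of_even he, X_pow_l, Units.val_one, map_one, mul_one, one_smul])

section

variable [IsAlgClosed 𝕂]

theorem two_mul_finrank_le_of_hasMonicIdentity {d : ℕ} (h : HasMonicIdentity (A q) d) (V : Type*)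
    [AddCommGroup V] [Module 𝕂 V] [Module (A q)ᵐᵒᵖ V] [IsScalarTower 𝕂 (A q)ᵐᵒᵖ V]
    [FiniteDimensional 𝕂 V] [IsSimpleModule (A q)ᵐᵒᵖ V] : 2 * Module.finrank 𝕂 V ≤ d :=
  (h.of_surjective (RingEquiv.opOp (A q)).toRingHom
    (RingEquiv.opOp (A q)).surjective).two_mul_finrank_le

/-- The identity bounds the minimal degree above by 2N, and a simple module of dimension N bounds it
below by 2N. -/
theorem PIdeg_eq {N : ℕ} (h : HasMonicIdentity (A q) (2 * N)) (V : Type*)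
    [AddCommGroup V] [Module 𝕂 V] [Module (A q)ᵐᵒᵖ V] [IsScalarTower 𝕂 (A q)ᵐᵒᵖ V]
    [FiniteDimensional 𝕂 V] [IsSimpleModule (A q)ᵐᵒᵖ V] (hN : Module.finrank 𝕂 V = N) :
    PIdeg (A q) = N := by
  have : minimalDegree (A q) = 2 * N := by
    refine le_antisymm (Nat.sInf_le h) (le_csInf ⟨_, h⟩ fun d hd => ?_)
    rw [← hN]
    exact two_mul_finrank_le_of_hasMonicIdentity hd V
  rw [PIdeg, this]
  omega

theorem PIdeg_of_odd (hq : IsPrimitiveRoot q l) (hl : 3 ≤ l) (ho : Odd l) :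
    PIdeg (A q) = l * l := by
  have : NeZero l := ⟨by omega⟩
  have := (BMod.isSimpleXY hq hl _ (isSimpleB_N1 hq hl ho 1 1 1 1 0)).simple
  exact PIdeg_eq (hasMonicIdentity_of_odd hq hl) (N1 hq hl 1 1 1 1 0) (BMod.finrank hq hl _)

theorem PIdeg_of_even (hq : IsPrimitiveRoot q l) (hl : 3 ≤ l) (he : Even l) :
    PIdeg (A q) = l / 2 * l := by
  have : NeZero l := ⟨by omega⟩
  have : NeZero (l / 2) := ⟨by omega⟩
  have := (BMod.isSimpleXY hq hl _ (isSimpleB_N4 hq hl he 1 1 1 1 0)).simple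
  exact PIdeg_eq (hasMonicIdentity_of_even hq hl he) (N4 hq hl he 1 1 1 1 0)
    (BMod.finrank hq hl _)

end

end QuantumPlane

/-! ### Modules with X and Y invertible as representations of the generators of B. -/

namespace QuantumPlane

variable {𝕂 : Type*} [Field 𝕂] {q : 𝕂}

namespace A

set_option linter.unusedSimpArgs false in
/-- The relations between the generators of `B`. -/
theorem relations (hq : q ≠ 0) (hq2 : q ^ 2 ≠ 1) :
    phi q * of q .X = of q .X * phi q ∧
    of q .Y * phi q = q • (phi q * of q .Y) ∧
    of q .K * phi q = q • (phi q * of q .K) ∧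
    psi q * of q .X = of q .X * psi q ∧
    psi q * of q .Y = q • (of q .Y * psi q) ∧
    psi q * of q .K = q • (of q .K * psi q) ∧
    psi q * phi q - phi q * psi q = (q * (1 - q ^ 2)) • (of q .K * of q .Y * of q .X) := by
  have hs := sub_inv_ne_zero hq hq2
  have e1 := BData.flip hq (X_Y q)
  have e2 := k_X q
  have e3 := k_Y q
  have e4 := ki_X q hq
  have e5 := ki_Y q hq
  have e6 := E_X q
  have e7 := E_Y q
  have e8 := F_X q
  have e9 := F_Y q
  have e10 := BData.flip (pow_ne_zero 2 hq) (k_E q)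
  have e11 := BData.flip (inv_ne_zero (pow_ne_zero 2 hq)) (ki_E q hq)
  have e12 := BData.flip (inv_ne_zero (pow_ne_zero 2 hq)) (k_F q)
  have e13 := BData.flip (pow_ne_zero 2 hq) (ki_F q hq)
  have e14 := F_E q
  have e15 := one_smul_comm (𝕂 := 𝕂) ((ki_k q).trans (k_ki q).symm)
  have a7 (z : A q) : of q .E * (of q .Y * z) = of q .X * z + q⁻¹ • (of q .Y * (of q .E * z)) := by
    rw [← mul_assoc, e7, add_mul, smul_mul_assoc, mul_assoc]
  have a8 (z : A q) : of q .F * (of q .X * z) =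
      of q .Y * (of q .Kinv * z) + of q .X * (of q .F * z) := by
    rw [← mul_assoc, e8, add_mul, mul_assoc, mul_assoc]
  have a9 (z : A q) : of q .F * (of q .Y * z) = of q .Y * (of q .F * z) := by
    rw [← mul_assoc, e9, mul_assoc]
  have c1 (z : A q) : of q .K * (of q .Kinv * z) = z := by rw [← mul_assoc, k_ki, one_mul]
  have c2 (z : A q) : of q .Kinv * (of q .K * z) = z := by rw [← mul_assoc, ki_k, one_mul]
  have hs' : q ^ 2 - 1 ≠ 0 := sub_ne_zero.2 hq2
  refine ⟨?_, ?_, ?_, ?_, ?_, ?_, ?_⟩ <;>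
  simp only [phi_eq, psi_eq, mul_assoc, smul_mul_assoc, mul_smul_comm, mul_add, add_mul, mul_sub,
    sub_mul, smul_add, smul_sub, smul_smul, k_ki, ki_k, c1, c2, e1, e2, e3, e4, e5, e6, e7, e8, e9,
    e10, e11, e12, e13, e14, BData.assoc_rule e1, BData.assoc_rule e2, BData.assoc_rule e3,
    BData.assoc_rule e4, BData.assoc_rule e5, BData.assoc_rule e6, a7, a8, a9,
    BData.assoc_rule e10, BData.assoc_rule e11, BData.assoc_rule e12, BData.assoc_rule e13,
    mul_one, one_mul] <;>
  try match_scalars <;> field_simp <;> try ring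

end A

section ModuleData

variable {M : Type*} [AddCommGroup M] [Module 𝕂 M] [Module (A q)ᵐᵒᵖ M]
  [IsScalarTower 𝕂 (A q)ᵐᵒᵖ M]

variable (q M) in
/-- The right action as a homomorphism to the opposite of the algebra of linear operators. -/
def rightAction : A q →ₐ[𝕂] (Module.End 𝕂 M)ᵐᵒᵖ :=
  AlgHom.opComm.symm (Algebra.lsmul 𝕂 𝕂 M)

theorem rightAction_apply (a : A q) (v : M) : (rightAction q M a).unop v = op a • v :=
  rfl

/-- The inverse of a bijective linear operator. -/
noncomputable def endInv {T : Module.End 𝕂 M} (hT : Function.Bijective T) : Module.End 𝕂 M :=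
  (LinearEquiv.ofBijective T hT).symm

theorem mul_endInv {T : Module.End 𝕂 M} (hT : Function.Bijective T) : T * endInv hT = 1 :=
  LinearMap.ext fun v => (LinearEquiv.ofBijective T hT).apply_symm_apply v

theorem endInv_mul {T : Module.End 𝕂 M} (hT : Function.Bijective T) : endInv hT * T = 1 :=
  LinearMap.ext fun v => (LinearEquiv.ofBijective T hT).symm_apply_apply v

/-- The action of the generators of `B` on a right `A`-module on which `X` and `Y` act
invertibly. -/
noncomputable def moduleData (hq : q ≠ 0) (hq2 : q ^ 2 ≠ 1) (hM : XYInvertible q M) :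
    BData q (Module.End 𝕂 M)ᵐᵒᵖ where
  k := rightAction q M (A.of q .K)
  ki := rightAction q M (A.of q .Kinv)
  x := rightAction q M (A.of q .X)
  xi := op (endInv (T := (rightAction q M (A.of q .X)).unop) hM.1)
  y := rightAction q M (A.of q .Y)
  yi := op (endInv (T := (rightAction q M (A.of q .Y)).unop) hM.2)
  φ := rightAction q M (A.phi q)
  ψ := rightAction q M (A.psi q)
  k_ki := by rw [← map_mul, A.k_ki, map_one]
  ki_k := by rw [← map_mul, A.ki_k, map_one]
  x_xi := unop_injective (endInv_mul _)
  xi_x := unop_injective (mul_endInv _)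
  y_yi := unop_injective (endInv_mul _)
  yi_y := unop_injective (mul_endInv _)
  k_x := by rw [← map_mul, A.k_X, map_smul, map_mul]
  y_k := by
    rw [← map_mul, BData.flip (inv_ne_zero hq) (A.k_Y q), inv_inv, map_smul, map_mul]
  x_y := by rw [← map_mul, A.X_Y, map_smul, map_mul]
  φ_x := by rw [← map_mul, (A.relations hq hq2).1, map_mul]
  y_φ := by rw [← map_mul, (A.relations hq hq2).2.1, map_smul, map_mul]
  k_φ := by rw [← map_mul, (A.relations hq hq2).2.2.1, map_smul, map_mul]
  ψ_x := by rw [← map_mul, (A.relations hq hq2).2.2.2.1, map_mul]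
  ψ_y := by rw [← map_mul, (A.relations hq hq2).2.2.2.2.1, map_smul, map_mul]
  ψ_k := by rw [← map_mul, (A.relations hq hq2).2.2.2.2.2.1, map_smul, map_mul]
  ψ_φ := by
    rw [← map_mul, ← map_mul, ← map_sub, (A.relations hq hq2).2.2.2.2.2.2, map_smul, map_mul,
      map_mul]

/-- No information is lost by passing to K, X, Y, φ, ψ: solving the formulas for φ and ψ recovers
the original actions of E and F. -/
theorem moduleData_toHom (hq : q ≠ 0) (hq2 : q ^ 2 ≠ 1) (hM : XYInvertible q M) :
    (moduleData hq hq2 hM).toHom hq hq2 = rightAction q M := by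
  have ht : 1 - q ^ 2 ≠ 0 := fun h => hq2 (by linear_combination -h)
  have : AlgHom.equalizer ((moduleData hq hq2 hM).toHom hq hq2) (rightAction q M) = ⊤ := by
    refine A.eq_top_of_of_mem fun g => ?_
    rw [AlgHom.mem_equalizer, toHom_of]
    cases g with
    | E =>
      have h : (moduleData hq hq2 hM).x - (moduleData hq hq2 hM).φ =
          (q - q⁻¹) • ((moduleData hq hq2 hM).y * rightAction q M (A.of q .E)) := by
        simp only [moduleData]
        rw [A.phi_eq, map_sub, map_smul, map_mul, sub_sub_cancel]
      rw [BData.act, h, mul_smul_comm, ← mul_assoc, BData.yi_y, one_mul,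
        inv_smul_smul₀ (A.sub_inv_ne_zero hq hq2)]
    | F =>
      have h : (moduleData hq hq2 hM).ψ +
          q ^ 2 • ((moduleData hq hq2 hM).y * (moduleData hq hq2 hM).ki) =
          (1 - q ^ 2) • ((moduleData hq hq2 hM).x * rightAction q M (A.of q .F)) := by
        simp only [moduleData]
        rw [A.psi_eq, map_sub, map_smul, map_mul, map_smul, map_mul, sub_add_cancel]
      rw [BData.act, h, mul_smul_comm, ← mul_assoc, BData.xi_x, one_mul, inv_smul_smul₀ ht]
    | K => rfl
    | Kinv => rfl
    | X => rfl
    | Y => rfl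
  refine AlgHom.ext fun a => ?_
  have ha : a ∈ AlgHom.equalizer ((moduleData hq hq2 hM).toHom hq hq2) (rightAction q M) :=
    this ▸ Algebra.mem_top
  exact ha

end ModuleData

section Intertwine

variable {V W : Type*} [AddCommGroup V] [Module 𝕂 V] [AddCommGroup W] [Module 𝕂 W]

/-- A linear map that commutes with `K`, `X`, `Y`, `φ`, `ψ` commutes with `A`. -/
theorem BData.map_toHom (hq : q ≠ 0) (hq2 : q ^ 2 ≠ 1) {D : BData q (Module.End 𝕂 V)ᵐᵒᵖ}
    {D' : BData q (Module.End 𝕂 W)ᵐᵒᵖ} {f : V →ₗ[𝕂] W}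
    (hk : ∀ v, f (D.k.unop v) = D'.k.unop (f v)) (hx : ∀ v, f (D.x.unop v) = D'.x.unop (f v))
    (hy : ∀ v, f (D.y.unop v) = D'.y.unop (f v)) (hφ : ∀ v, f (D.φ.unop v) = D'.φ.unop (f v))
    (hψ : ∀ v, f (D.ψ.unop v) = D'.ψ.unop (f v)) (a : A q) (v : V) :
    f ((D.toHom hq hq2 a).unop v) = (D'.toHom hq hq2 a).unop (f v) := by
  -- Intertwining an invertible operator implies intertwining its inverse; this covers K⁻¹ and the
  -- X⁻¹, Y⁻¹ in the formulas for F, E.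
  have inv {T S : (Module.End 𝕂 V)ᵐᵒᵖ} {T' S' : (Module.End 𝕂 W)ᵐᵒᵖ} (h1 : S * T = 1)
      (h2 : T' * S' = 1) (h : ∀ v, f (T.unop v) = T'.unop (f v)) (v : V) :
      f (S.unop v) = S'.unop (f v) := by
    have e1 : T.unop (S.unop v) = v := by
      rw [← Module.End.mul_apply, ← unop_mul, h1, unop_one, Module.End.one_apply]
    have e2 (w : W) : S'.unop (T'.unop w) = w := by
      rw [← Module.End.mul_apply, ← unop_mul, h2, unop_one, Module.End.one_apply]
    rw [← e2 (f (S.unop v)), ← h, e1]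
  have hki := inv D.ki_k D'.k_ki hk
  have hxi := inv D.xi_x D'.x_xi hx
  have hyi := inv D.yi_y D'.y_yi hy
  let T : Subalgebra 𝕂 (A q) :=
    { carrier := {a | ∀ v, f ((D.toHom hq hq2 a).unop v) = (D'.toHom hq hq2 a).unop (f v)}
      mul_mem' := fun {a b} ha hb v => by
        simp only [map_mul, unop_mul, Module.End.mul_apply]
        rw [hb, ha]
      add_mem' := fun {a b} ha hb v => by
        simp only [map_add, unop_add, LinearMap.add_apply]
        rw [hb, ha]
      algebraMap_mem' := fun r v => by
        simp [MulOpposite.algebraMap_apply] }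
  have hT : T = ⊤ := A.eq_top_of_of_mem fun g v => by
    rw [toHom_of, toHom_of]
    cases g with
    | E => simp [act, hyi, hx, hφ]
    | F => simp [act, hxi, hψ, hy, hki]
    | K => exact hk v
    | Kinv => exact hki v
    | X => exact hx v
    | Y => exact hy v
  exact (hT ▸ Algebra.mem_top : a ∈ T) v

end Intertwine

end QuantumPlane

/-! ### Central elements φ^nX^h and ψ^nX^h. -/

namespace QuantumPlane

variable {𝕂 : Type*} [Field 𝕂] {q : 𝕂}

namespace BData

variable {R : Type*} [Ring R] [Algebra 𝕂 R] (D : BData q R)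

/-- `z` commutes with the generators of `B`. -/
structure Central (z : R) : Prop where
  k : D.k * z = z * D.k
  x : D.x * z = z * D.x
  y : D.y * z = z * D.y
  φ : D.φ * z = z * D.φ
  ψ : D.ψ * z = z * D.ψ

theorem skew_mul {a b c : R} {s t : 𝕂} (h : a * b = s • (b * a)) (h' : a * c = t • (c * a))
    (hst : s * t = 1) : a * (b * c) = b * c * a := by
  rw [assoc_rule h, h', mul_smul_comm, smul_smul, hst, one_smul, mul_assoc]

variable {D} {n l h : ℕ}

theorem central_x_pow (hq : q ≠ 0) (hql : q ^ l = 1) : D.Central (D.x ^ l) where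
  k := by rw [mul_pow_of_skew D.k_x, hql, one_smul]
  x := ((Commute.refl D.x).pow_right l).eq
  y := by rw [mul_pow_of_skew (flip hq D.x_y), inv_pow, hql, inv_one, one_smul]
  φ := (Commute.pow_right D.φ_x l).eq
  ψ := (Commute.pow_right D.ψ_x l).eq

theorem pow_two_pow_eq_one (hqn : q ^ n = q ^ h) (hqh : q ^ h * q ^ h = 1) :
    (q ^ 2) ^ n = 1 := by
  rw [← pow_mul, mul_comm, pow_mul, hqn, sq, hqh]

/-- φ^n commutes with K and Y only up to q^n = q^h, and X^h supplies the compensating factor. For ψ,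
the correction kyx scales by q² past φ, and (q²)^n = 1 with q² ≠ 1 kills the geometric sum. -/
theorem central_φ_pow (hq : q ≠ 0) (hq2 : q ^ 2 ≠ 1) (hn : n ≠ 0) (hqn : q ^ n = q ^ h)
    (hqh : q ^ h * q ^ h = 1) : D.Central (D.φ ^ n * D.x ^ h) where
  k := skew_mul (mul_pow_of_skew D.k_φ n) (mul_pow_of_skew D.k_x h) (by rw [hqn, hqh])
  x := ((Commute.pow_right D.φ_x.symm n).mul_right ((Commute.refl D.x).pow_right h)).eq
  y := skew_mul (mul_pow_of_skew D.y_φ n) (mul_pow_of_skew (flip hq D.x_y) h) (by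
    rw [hqn, inv_pow, mul_inv_cancel₀ (pow_ne_zero h hq)])
  φ := (((Commute.refl D.φ).pow_right n).mul_right (Commute.pow_right D.φ_x h)).eq
  ψ := by
    have hw : (q * (1 - q ^ 2)) • (D.k * D.y * D.x) * D.φ =
        q ^ 2 • (D.φ * (q * (1 - q ^ 2)) • (D.k * D.y * D.x)) := by
      rw [smul_mul_assoc, mul_smul_comm, mul_assoc, ← D.φ_x, ← mul_assoc, mul_assoc D.k, D.y_φ,
        mul_smul_comm, ← mul_assoc, D.k_φ]
      simp only [smul_mul_assoc, smul_smul, mul_assoc]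
      congr 1; ring
    have hψ : D.ψ * D.φ = (1 : 𝕂) • (D.φ * D.ψ) + (q * (1 - q ^ 2)) • (D.k * D.y * D.x) + 0 := by
      rw [← D.ψ_φ]; module
    have h1 := pow_two_pow_eq_one hqn hqh
    exact skew_mul (mul_pow_of_skew_add_eq hn hψ hw (t₂ := q ^ 2) (by simp) hq2.symm hq2.symm
      (by rw [h1, one_pow]) (by rw [h1, one_pow]))
      (mul_pow_of_skew (s := (1 : 𝕂)) (A.one_smul_comm D.ψ_x) h) (by rw [one_pow, one_pow, one_mul])

theorem central_ψ_pow (hq : q ≠ 0) (hq2 : q ^ 2 ≠ 1) (hn : n ≠ 0) (hqn : q ^ n = q ^ h)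
    (hqh : q ^ h * q ^ h = 1) : D.Central (D.ψ ^ n * D.x ^ h) where
  k := skew_mul (mul_pow_of_skew (flip hq D.ψ_k) n) (mul_pow_of_skew D.k_x h) (by
    rw [inv_pow, hqn, inv_mul_cancel₀ (pow_ne_zero h hq)])
  x := ((Commute.pow_right D.ψ_x.symm n).mul_right ((Commute.refl D.x).pow_right h)).eq
  y := skew_mul (mul_pow_of_skew (flip hq D.ψ_y) n) (mul_pow_of_skew (flip hq D.x_y) h) (by
    rw [inv_pow, inv_pow, hqn, ← mul_inv, hqh, inv_one])
  ψ := (((Commute.refl D.ψ).pow_right n).mul_right (Commute.pow_right D.ψ_x h)).eq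
  φ := by
    have hw : (-(q * (1 - q ^ 2))) • (D.k * D.y * D.x) * D.ψ =
        (q ^ 2)⁻¹ • (D.ψ * (-(q * (1 - q ^ 2))) • (D.k * D.y * D.x)) := by
      rw [smul_mul_assoc, mul_smul_comm, mul_assoc, ← D.ψ_x, ← mul_assoc, mul_assoc D.k,
        flip hq D.ψ_y, mul_smul_comm, ← mul_assoc, flip hq D.ψ_k]
      simp only [smul_mul_assoc, smul_smul, mul_assoc]
      congr 1; field_simp
    have hφ : D.φ * D.ψ = (1 : 𝕂) • (D.ψ * D.φ) + (-(q * (1 - q ^ 2))) • (D.k * D.y * D.x) + 0 := by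
      rw [neg_smul, ← D.ψ_φ]; module
    have h1 := pow_two_pow_eq_one hqn hqh
    have h2 : (1 : 𝕂) ≠ (q ^ 2)⁻¹ := fun h => hq2 (by rw [← inv_inv (q ^ 2), ← h, inv_one])
    exact skew_mul (mul_pow_of_skew_add_eq hn hφ hw (t₂ := (q ^ 2)⁻¹) (by simp) h2 h2
      (by rw [inv_pow, h1, one_pow, inv_one]) (by rw [inv_pow, h1, one_pow, inv_one]))
      (mul_pow_of_skew (s := (1 : 𝕂)) (A.one_smul_comm D.φ_x) h) (by rw [one_pow, one_pow, one_mul])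

end BData

/-! ### The linear map from a model to a module. -/

section ModelMap

variable {M : Type*} [AddCommGroup M] [Module 𝕂 M] {n l : ℕ}

theorem sp_hom_ext {f g : Sp 𝕂 n l →ₗ[𝕂] M} (h : ∀ a b, f (e a b) = g (e a b)) : f = g :=
  Finsupp.lhom_ext' fun i => LinearMap.ext_ring (h i.1 i.2)

/-- The linear map `e(a,b) ↦ vrᵃxᵇ`. -/
noncomputable def modelMap (n l : ℕ) (x r : Module.End 𝕂 M) (v : M) : Sp 𝕂 n l →ₗ[𝕂] M :=
  Finsupp.linearCombination 𝕂 fun i => (x ^ i.2.val) ((r ^ i.1.val) v)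

theorem modelMap_e (x r : Module.End 𝕂 M) (v : M) (a : ZMod n) (b : ZMod l) :
    modelMap n l x r v (e a b) = (x ^ b.val) ((r ^ a.val) v) := by
  simp [modelMap]

theorem apply_pow_pow {x r T : Module.End 𝕂 M} {v : M} {s t μ : 𝕂} (hx : T * x = s • (x * T))
    (hr : T * r = t • (r * T)) (hv : T v = μ • v) (a b : ℕ) :
    T ((x ^ b) ((r ^ a) v)) = (μ * t ^ a * s ^ b) • (x ^ b) ((r ^ a) v) := by
  have h1 (w : M) : T ((x ^ b) w) = s ^ b • (x ^ b) (T w) :=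
    LinearMap.congr_fun (mul_pow_of_skew hx b) w
  have h2 : T ((r ^ a) v) = t ^ a • (r ^ a) (T v) :=
    LinearMap.congr_fun (mul_pow_of_skew hr a) v
  rw [h1, h2, hv, map_smul, map_smul, map_smul, smul_smul, smul_smul]
  congr 1; ring

variable [NeZero l] {x r T : Module.End 𝕂 M} {v : M} {ξ lam : 𝕂ˣ} {ε : ℤ} {c c' : 𝕂} {h : ℕ}
  {d : ZMod n → 𝕂}

theorem modelMap_X (hx : x ^ l = algebraMap 𝕂 _ (ξ : 𝕂)) (w : Sp 𝕂 n l) :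
    modelMap n l x r v (opX n l ξ w) = x (modelMap n l x r v w) := by
  refine LinearMap.congr_fun (f := (modelMap n l x r v).comp (opX n l ξ))
    (g := x.comp (modelMap n l x r v)) (sp_hom_ext fun a b => ?_) w
  rw [LinearMap.comp_apply, LinearMap.comp_apply, opX, basisOp_e]
  split_ifs with hb
  · have h1 : b.val + 1 = l := by
      have := val_neg_one' (m := l)
      rw [← hb] at this; omega
    rw [map_smul, modelMap_e, modelMap_e, ZMod.val_zero, pow_zero, Module.End.one_apply,
      ← Module.End.mul_apply x, ← pow_succ', h1, hx, Module.algebraMap_end_apply]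
  · rw [modelMap_e, modelMap_e, val_succ hb, pow_succ', Module.End.mul_apply]

theorem modelMap_X_pow (hx : x ^ l = algebraMap 𝕂 _ (ξ : 𝕂)) (m : ℕ) (w : Sp 𝕂 n l) :
    modelMap n l x r v ((opX n l ξ ^ m) w) = (x ^ m) (modelMap n l x r v w) := by
  induction m generalizing w with
  | zero => rfl
  | succ m ih => rw [pow_succ, pow_succ, Module.End.mul_apply, ih, modelMap_X hx,
      Module.End.mul_apply]

omit [NeZero l] in
theorem modelMap_K (hq : q ≠ 0) (hTx : T * x = q⁻¹ • (x * T)) (hTr : T * r = q ^ ε • (r * T))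
    (hv : T v = (lam : 𝕂) • v) (w : Sp 𝕂 n l) :
    modelMap n l x r v (opK n l q lam ε w) = T (modelMap n l x r v w) := by
  refine LinearMap.congr_fun (f := (modelMap n l x r v).comp (opK n l q lam ε))
    (g := T.comp (modelMap n l x r v)) (sp_hom_ext fun a b => ?_) w
  rw [LinearMap.comp_apply, LinearMap.comp_apply, K_e, map_smul, modelMap_e,
    apply_pow_pow hTx hTr hv, zpow_sub₀ hq, zpow_mul, zpow_natCast, zpow_natCast, inv_pow,
    mul_assoc, div_eq_mul_inv]

/-- After applying the injective `x`, the claim concerns the diagonal operator `x * y`, so the case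
distinction at b = 0 disappears. -/
theorem modelMap_Y {y : Module.End 𝕂 M} (hq : q ≠ 0) (hx : x ^ l = algebraMap 𝕂 _ (ξ : 𝕂))
    (hyx : y * x = q • (x * y)) (hTr : x * y * r = q ^ ε • (r * (x * y)))
    (hv : x (y v) = (lam : 𝕂) • v) (hinj : Function.Injective x) (w : Sp 𝕂 n l) :
    modelMap n l x r v (opY n l q ξ lam ε w) = y (modelMap n l x r v w) := by
  refine LinearMap.congr_fun (f := (modelMap n l x r v).comp (opY n l q ξ lam ε))
    (g := y.comp (modelMap n l x r v)) (sp_hom_ext fun a b => hinj ?_) w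
  have hTx : x * y * x = q • (x * (x * y)) := by rw [mul_assoc, hyx, mul_smul_comm]
  have := apply_pow_pow hTx hTr hv a.val b.val
  rw [LinearMap.comp_apply, LinearMap.comp_apply, ← modelMap_X hx, X_Y_e, map_smul, modelMap_e,
    ← Module.End.mul_apply x, this, zpow_add₀ hq, zpow_mul, zpow_natCast, zpow_natCast, mul_assoc]

theorem modelMap_raise [NeZero n] (hx : x ^ l = algebraMap 𝕂 _ (ξ : 𝕂)) (hxr : Commute x r)
    (hr : r ^ n = c • x ^ h) (w : Sp 𝕂 n l) :
    modelMap n l x r v (opRaise n l ξ c h w) = r (modelMap n l x r v w) := by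
  refine LinearMap.congr_fun (f := (modelMap n l x r v).comp (opRaise n l ξ c h))
    (g := r.comp (modelMap n l x r v)) (sp_hom_ext fun a b => ?_) w
  have hc (w : M) : r ((x ^ b.val) w) = (x ^ b.val) (r w) :=
    LinearMap.congr_fun (hxr.symm.pow_right b.val).eq w
  rw [LinearMap.comp_apply, LinearMap.comp_apply, opRaise, basisOp_e]
  split_ifs with ha
  · have h1 : a.val + 1 = n := by
      have := val_neg_one' (m := n)
      rw [← ha] at this; omega
    rw [map_smul, modelMap_X_pow hx, modelMap_e, modelMap_e, hc, ZMod.val_zero, pow_zero,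
      Module.End.one_apply, ← Module.End.mul_apply r, ← pow_succ', h1, hr, LinearMap.smul_apply,
      map_smul, ← Module.End.mul_apply, ← pow_add, ← Module.End.mul_apply, ← pow_add, add_comm]
  · rw [modelMap_e, modelMap_e, val_succ ha, pow_succ' r, Module.End.mul_apply, hc]

/-- As raising is injective, lowering is determined by its composite with raising, which is
diagonal. The wrap-around needs no separate treatment. -/
theorem modelMap_lower_of_injective [NeZero n] (hx : x ^ l = algebraMap 𝕂 _ (ξ : 𝕂))
    (hxr : Commute x r) (hr : r ^ n = c • x ^ h) (hinj : Function.Injective r)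
    (hw : (c * c') • opX n l ξ ^ (2 * h) = 1 ∨ d 0 = 0)
    (hT : ∀ a b, r (T (modelMap n l x r v (e a b))) = d a • modelMap n l x r v (e a b))
    (w : Sp 𝕂 n l) :
    modelMap n l x r v (opLower n l ξ c' h d w) = T (modelMap n l x r v w) := by
  refine LinearMap.congr_fun (f := (modelMap n l x r v).comp (opLower n l ξ c' h d))
    (g := T.comp (modelMap n l x r v)) (sp_hom_ext fun a b => hinj ?_) w
  rw [LinearMap.comp_apply, LinearMap.comp_apply, hT, ← modelMap_raise hx hxr hr,
    raise_lower hw, map_smul]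

-- The variant for a vector killed by the lowering operator: raising may be nilpotent, but `d 0 = 0`
-- makes the wrap-around term vanish.
omit [NeZero l] in
theorem modelMap_lower_of_zero (hd : d 0 = 0)
    (hT0 : ∀ b, T (modelMap n l x r v (e 0 b)) = 0)
    (hT : ∀ a ≠ 0, ∀ b, T (modelMap n l x r v (e a b)) = d a • modelMap n l x r v (e (a - 1) b))
    (w : Sp 𝕂 n l) :
    modelMap n l x r v (opLower n l ξ c' h d w) = T (modelMap n l x r v w) := by
  refine LinearMap.congr_fun (f := (modelMap n l x r v).comp (opLower n l ξ c' h d))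
    (g := T.comp (modelMap n l x r v)) (sp_hom_ext fun a b => ?_) w
  rw [LinearMap.comp_apply, LinearMap.comp_apply, opLower, basisOp_e]
  split_ifs with ha
  · rw [hd, mul_zero, zero_smul, map_zero, ha, hT0]
  · rw [map_smul, hT a ha]

end ModelMap

end QuantumPlane

/-! ### Eigenvectors and homomorphisms from the models. -/

theorem Module.End.exists_inf_eigenspace_ne_bot {K M : Type*} [Field K] [IsAlgClosed K]
    [AddCommGroup M] [Module K M] [FiniteDimensional K M] {W : Submodule K M} (hW : W ≠ ⊥)
    {T : Module.End K M} (hT : ∀ v ∈ W, T v ∈ W) : ∃ μ, W ⊓ T.eigenspace μ ≠ ⊥ := by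
  have : Nontrivial W := (Submodule.nontrivial_iff_ne_bot).2 hW
  obtain ⟨μ, hμ⟩ := Module.End.exists_eigenvalue (T.restrict hT)
  obtain ⟨v, hv⟩ := hμ.exists_hasEigenvector
  refine ⟨μ, (Submodule.ne_bot_iff _).2 ⟨v, ⟨v.2, ?_⟩, fun h => hv.2 (Subtype.ext h)⟩⟩
  exact Module.End.mem_eigenspace_iff.2 (congrArg Subtype.val hv.apply_eq_smul)

/-- Stability under a commuting operator survives intersection with an eigenspace, so joint
eigenvectors can be found one operator at a time. -/
theorem Module.End.apply_mem_inf_eigenspace {K M : Type*} [Field K] [AddCommGroup M] [Module K M]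
    {W : Submodule K M} {S T : Module.End K M} (hS : ∀ v ∈ W, S v ∈ W) (h : Commute S T) (μ : K) :
    ∀ v ∈ W ⊓ T.eigenspace μ, S v ∈ W ⊓ T.eigenspace μ := fun v hv => by
  refine ⟨hS v hv.1, Module.End.mem_eigenspace_iff.2 ?_⟩
  rw [← Module.End.mul_apply, ← h.eq, Module.End.mul_apply, Module.End.mem_eigenspace_iff.1 hv.2,
    map_smul]

namespace QuantumPlane

variable {𝕂 : Type*} [Field 𝕂] {q : 𝕂} {n l : ℕ}

namespace BData

variable {M : Type*} [AddCommGroup M] [Module 𝕂 M] (D : BData q (Module.End 𝕂 M)ᵐᵒᵖ)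

theorem unop_k_x (hq : q ≠ 0) : D.k.unop * D.x.unop = q⁻¹ • (D.x.unop * D.k.unop) :=
  flip hq (congrArg unop D.k_x :)

theorem unop_k_φ (hq : q ≠ 0) : D.k.unop * D.φ.unop = q⁻¹ • (D.φ.unop * D.k.unop) :=
  flip hq (congrArg unop D.k_φ :)

theorem unop_k_ψ : D.k.unop * D.ψ.unop = q • (D.ψ.unop * D.k.unop) :=
  congrArg unop D.ψ_k

theorem unop_y_x : D.y.unop * D.x.unop = q • (D.x.unop * D.y.unop) :=
  congrArg unop D.x_y

theorem unop_x_φ : D.x.unop * D.φ.unop = D.φ.unop * D.x.unop :=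
  congrArg unop D.φ_x

theorem unop_x_ψ : D.x.unop * D.ψ.unop = D.ψ.unop * D.x.unop :=
  congrArg unop D.ψ_x

theorem unop_k_xy (hq : q ≠ 0) : Commute D.k.unop (D.x.unop * D.y.unop) :=
  skew_mul (D.unop_k_x hq) (congrArg unop D.y_k) (inv_mul_cancel₀ hq)

theorem unop_xy_φ (hq : q ≠ 0) : D.x.unop * D.y.unop * D.φ.unop =
    q⁻¹ • (D.φ.unop * (D.x.unop * D.y.unop)) := by
  have h : D.y.unop * D.φ.unop = q⁻¹ • (D.φ.unop * D.y.unop) := flip hq (congrArg unop D.y_φ :)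
  rw [mul_assoc, h, mul_smul_comm, ← mul_assoc, D.unop_x_φ, mul_assoc]

theorem unop_xy_ψ : D.x.unop * D.y.unop * D.ψ.unop =
    q • (D.ψ.unop * (D.x.unop * D.y.unop)) := by
  have h : D.y.unop * D.ψ.unop = q • (D.ψ.unop * D.y.unop) := congrArg unop D.ψ_y
  rw [mul_assoc, h, mul_smul_comm, ← mul_assoc, D.unop_x_ψ, mul_assoc]

theorem unop_φ_ψ (v : M) : D.φ.unop (D.ψ.unop v) = D.ψ.unop (D.φ.unop v) +
    (q * (1 - q ^ 2)) • D.x.unop (D.y.unop (D.k.unop v)) :=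
  sub_eq_iff_eq_add'.1 (LinearMap.congr_fun (congrArg unop D.ψ_φ) v)

theorem x_injective : Function.Injective D.x.unop := fun v w h => by
  have (u : M) : D.xi.unop (D.x.unop u) = u := LinearMap.congr_fun (congrArg unop D.x_xi) u
  rw [← this v, h, this]

theorem y_injective : Function.Injective D.y.unop := fun v w h => by
  have (u : M) : D.yi.unop (D.y.unop u) = u := LinearMap.congr_fun (congrArg unop D.y_yi) u
  rw [← this v, h, this]

theorem k_injective : Function.Injective D.k.unop := fun v w h => by
  have (u : M) : D.ki.unop (D.k.unop u) = u := LinearMap.congr_fun (congrArg unop D.k_ki) u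
  rw [← this v, h, this]

variable {D} {v : M} {lam1 lam2 : 𝕂ˣ} {lam3 : 𝕂}

theorem xyk_pow_φ (hq : q ≠ 0) (hk : D.k.unop v = (lam1 : 𝕂) • v)
    (hxy : D.x.unop (D.y.unop v) = (lam2 : 𝕂) • v) (a : ℕ) :
    D.x.unop (D.y.unop (D.k.unop ((D.φ.unop ^ a) v))) =
      (lam1 * lam2 * q ^ (-2 * a : ℤ) : 𝕂) • (D.φ.unop ^ a) v := by
  have h1 := apply_pow_pow (D.unop_k_x hq) (D.unop_k_φ hq) hk a 0
  have hs : D.x.unop * D.y.unop * D.x.unop = q • (D.x.unop * (D.x.unop * D.y.unop)) := by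
    rw [mul_assoc, D.unop_y_x, mul_smul_comm]
  have h2 := apply_pow_pow hs (D.unop_xy_φ hq) hxy a 0
  simp only [pow_zero, Module.End.one_apply, mul_one, Module.End.mul_apply] at h1 h2
  rw [h1, map_smul, map_smul, h2, smul_smul]
  congr 1
  have : q ^ (-2 * a : ℤ) = q⁻¹ ^ a * q⁻¹ ^ a := by
    rw [← mul_pow, ← sq, ← pow_mul, zpow_mul, zpow_natCast, pow_mul, zpow_neg, inv_pow, inv_pow q,
      inv_pow]
    norm_cast
  rw [this]; ring

/-- Each further φ changes the eigenvalue of ψφ by the commutator, which acts on vφ^a as a multiple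
of q^(-2a). Summing the changes produces `coeffI`. The unopped operators compose in reverse order,
so `φ (ψ v)` is vψφ. -/
theorem φ_ψ_pow_φ (hq : q ≠ 0) (hk : D.k.unop v = (lam1 : 𝕂) • v)
    (hxy : D.x.unop (D.y.unop v) = (lam2 : 𝕂) • v) (hφψ : D.φ.unop (D.ψ.unop v) = lam3 • v)
    (a : ℕ) : D.φ.unop (D.ψ.unop ((D.φ.unop ^ a) v)) =
      (lam3 - q ^ 3 * (q ^ (-2 * a : ℤ) - 1) * lam1 * lam2 : 𝕂) • (D.φ.unop ^ a) v := by
  induction a with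
  | zero => simp [hφψ]
  | succ a ih =>
    have h1 := D.unop_φ_ψ ((D.φ.unop ^ a) v)
    rw [ih, xyk_pow_φ hq hk hxy, smul_smul] at h1
    have h2 := eq_sub_of_add_eq h1.symm
    rw [← sub_smul] at h2
    rw [pow_succ', Module.End.mul_apply, h2, map_smul]
    congr 1
    have : q ^ (-2 * ((a + 1 : ℕ) : ℤ)) = q ^ (-2 * a : ℤ) * (q ^ 2)⁻¹ := by
      push_cast
      rw [mul_add, zpow_add₀ hq, mul_one, zpow_neg]; norm_cast
    rw [this]
    field_simp
    ring

theorem xyk_pow_ψ (hq : q ≠ 0) (hk : D.k.unop v = (lam1 : 𝕂) • v)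
    (hxy : D.x.unop (D.y.unop v) = (lam2 : 𝕂) • v) (a : ℕ) :
    D.x.unop (D.y.unop (D.k.unop ((D.ψ.unop ^ a) v))) =
      (lam1 * lam2 * q ^ (2 * a) : 𝕂) • (D.ψ.unop ^ a) v := by
  have h1 := apply_pow_pow (D.unop_k_x hq) D.unop_k_ψ hk a 0
  have hs : D.x.unop * D.y.unop * D.x.unop = q • (D.x.unop * (D.x.unop * D.y.unop)) := by
    rw [mul_assoc, D.unop_y_x, mul_smul_comm]
  have h2 := apply_pow_pow hs D.unop_xy_ψ hxy a 0
  simp only [pow_zero, Module.End.one_apply, mul_one, Module.End.mul_apply] at h1 h2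
  rw [h1, map_smul, map_smul, h2, smul_smul]
  congr 1
  ring

/-- Each ψ adds a commutator term q(1 - q²)λ₁λ₂q^(2a), and the sum telescopes from vφ = 0. -/
theorem φ_pow_ψ (hq : q ≠ 0) (hk : D.k.unop v = (lam1 : 𝕂) • v)
    (hxy : D.x.unop (D.y.unop v) = (lam2 : 𝕂) • v) (hφ : D.φ.unop v = 0)
    (a : ℕ) : D.φ.unop ((D.ψ.unop ^ (a + 1)) v) =
      (q * (1 - q ^ (2 * (a + 1))) * lam1 * lam2 : 𝕂) • (D.ψ.unop ^ a) v := by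
  induction a with
  | zero =>
    have := xyk_pow_ψ hq hk hxy 0
    simp only [pow_zero, Module.End.one_apply, mul_zero, mul_one] at this
    rw [zero_add, pow_one, pow_zero, Module.End.one_apply, D.unop_φ_ψ, hφ, map_zero, zero_add,
      this, smul_smul]
    congr 1; ring
  | succ a ih =>
    rw [pow_succ', Module.End.mul_apply, D.unop_φ_ψ, ih, xyk_pow_ψ hq hk hxy, map_smul,
      ← Module.End.mul_apply, ← pow_succ', smul_smul, ← add_smul]
    congr 1; ring

end BData

section Equiv

variable {M : Type*} [AddCommGroup M] [Module 𝕂 M] [Module (A q)ᵐᵒᵖ M]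
  [IsScalarTower 𝕂 (A q)ᵐᵒᵖ M]

/-- Intertwining the generators of B suffices for A-linearity, and by Schur's lemma a nonzero map
between simple modules is bijective. -/
theorem nonempty_equiv_BMod (hq : IsPrimitiveRoot q l) (hl : 3 ≤ l) (hq0 : q ≠ 0) (hq2 : q ^ 2 ≠ 1)
    {D : BData q (Module.End 𝕂 (Sp 𝕂 n l))ᵐᵒᵖ} (hM : IsSimpleXY q M)
    (hN : IsSimpleXY q (BMod hq hl D)) {f : Sp 𝕂 n l →ₗ[𝕂] M} (hf : f ≠ 0)
    (hk : ∀ v, f (D.k.unop v) = (moduleData hq0 hq2 hM.invertible).k.unop (f v))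
    (hx : ∀ v, f (D.x.unop v) = (moduleData hq0 hq2 hM.invertible).x.unop (f v))
    (hy : ∀ v, f (D.y.unop v) = (moduleData hq0 hq2 hM.invertible).y.unop (f v))
    (hφ : ∀ v, f (D.φ.unop v) = (moduleData hq0 hq2 hM.invertible).φ.unop (f v))
    (hψ : ∀ v, f (D.ψ.unop v) = (moduleData hq0 hq2 hM.invertible).ψ.unop (f v)) :
    Nonempty (M ≃ₗ[(A q)ᵐᵒᵖ] BMod hq hl D) := by
  let g : BMod hq hl D →ₗ[(A q)ᵐᵒᵖ] M :=
    { toFun := f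
      map_add' := f.map_add
      map_smul' := fun a v => by
        have := BData.map_toHom hq0 hq2 hk hx hy hφ hψ a.unop v
        rw [moduleData_toHom] at this
        exact this }
  have := hM.simple
  have := hN.simple
  have hg : g ≠ 0 := fun h => hf (LinearMap.ext fun v => LinearMap.congr_fun h v)
  exact ⟨(LinearEquiv.ofBijective g (LinearMap.bijective_of_ne_zero hg)).symm⟩

theorem modelMap_ne_zero [NeZero n] [NeZero l] {x r : Module.End 𝕂 M} {v : M} (hv : v ≠ 0) :
    modelMap n l x r v ≠ 0 := fun h => hv (by
  have := LinearMap.congr_fun h (e 0 0)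
  rw [modelMap_e] at this
  simpa using this)

variable (hq : IsPrimitiveRoot q l) (hl : 3 ≤ l) (hM : IsSimpleXY q M)
  {h : ℕ} (hn0 : n ≠ 0) (hl0 : l ≠ 0) (hq0 : q ≠ 0) (hq2 : q ^ 2 ≠ 1) (hql : q ^ l = 1)
  (hqn : q ^ n = q ^ h) (hqh : q ^ h * q ^ h = 1) {ξ lam1 lam2 : 𝕂ˣ} {lam3 c c' : 𝕂}
  (hnl : ∀ m : ℤ, (l : ℤ) ∣ 2 * m → (n : ℤ) ∣ m) {v : M} (hv : v ≠ 0)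

-- The vectors vφ^aX^b obey the formulas of the model: the eigenvalues of v give K, Y and ψ, while
-- `hx` and `hr` govern the wrap-around in b and in a.
include hnl hv in
theorem nonempty_equiv_dataI (hc : c ≠ 0)
    (hw : (c * c') • opX n l ξ ^ (2 * h) = 1 ∨ coeffI n q lam1 lam2 lam3 0 = 0)
    (hk : (moduleData hq0 hq2 hM.invertible).k.unop v = (lam1 : 𝕂) • v)
    (hxy : (moduleData hq0 hq2 hM.invertible).x.unop
      ((moduleData hq0 hq2 hM.invertible).y.unop v) = (lam2 : 𝕂) • v)
    (hφψ : (moduleData hq0 hq2 hM.invertible).φ.unop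
      ((moduleData hq0 hq2 hM.invertible).ψ.unop v) = lam3 • v)
    (hx : (moduleData hq0 hq2 hM.invertible).x.unop ^ l = algebraMap 𝕂 _ (ξ : 𝕂))
    (hr : (moduleData hq0 hq2 hM.invertible).φ.unop ^ n =
      c • (moduleData hq0 hq2 hM.invertible).x.unop ^ h) :
    Nonempty (M ≃ₗ[(A q)ᵐᵒᵖ]
      BMod hq hl (dataI hn0 hl0 hq0 hql hqn hqh ξ lam1 lam2 lam3 c c' hw)) := by
  have : NeZero n := ⟨hn0⟩
  have : NeZero l := ⟨hl0⟩
  set D := moduleData hq0 hq2 hM.invertible with hD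
  -- φ^n is a nonzero multiple of the injective X^h.
  have hinj : Function.Injective D.φ.unop := by
    have h1 : Function.Injective (D.φ.unop ^ n) := by
      rw [hr]
      intro u u' huu
      have := smul_right_injective M hc huu
      rw [Module.End.coe_pow] at this
      exact D.x_injective.iterate h this
    obtain ⟨m, rfl⟩ := Nat.exists_eq_succ_of_ne_zero hn0
    rw [Nat.succ_eq_add_one, pow_succ] at h1
    exact Function.Injective.of_comp h1
  refine nonempty_equiv_BMod hq hl hq0 hq2 hM
    (BMod.isSimpleXY hq hl _ (isSimpleB_dataI hq hl _ _ _ _ _ _ _ _ _ _ _ _ hnl hc hw))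
    (f := modelMap n l D.x.unop D.φ.unop v) (modelMap_ne_zero hv) ?_ ?_ ?_ ?_ ?_
  · refine modelMap_K hq0 (D.unop_k_x hq0) ?_ hk
    rw [zpow_neg_one]; exact D.unop_k_φ hq0
  · exact modelMap_X hx
  · refine modelMap_Y hq0 hx D.unop_y_x ?_ hxy D.x_injective
    rw [zpow_neg_one]; exact D.unop_xy_φ hq0
  · exact modelMap_raise hx D.unop_x_φ hr
  · refine modelMap_lower_of_injective hx D.unop_x_φ hr hinj hw fun a b => ?_
    have h1 : D.ψ.unop ((D.x.unop ^ b.val) ((D.φ.unop ^ a.val) v)) =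
        (D.x.unop ^ b.val) (D.ψ.unop ((D.φ.unop ^ a.val) v)) :=
      LinearMap.congr_fun (Commute.pow_right (Eq.symm D.unop_x_ψ) b.val).eq _
    have h2 (w : M) : D.φ.unop ((D.x.unop ^ b.val) w) = (D.x.unop ^ b.val) (D.φ.unop w) :=
      LinearMap.congr_fun (Commute.pow_right (Eq.symm D.unop_x_φ) b.val).eq _
    rw [modelMap_e, h1, h2, BData.φ_ψ_pow_φ hq0 hk hxy hφψ, map_smul, coeffI]

-- The same with the vectors vψ^aX^b. Here vφ = 0 replaces the eigenvalue λ₃, and c = 0 is allowed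
-- because simplicity of the model rests on the nonzero lowering coefficients.
include hnl hv in
theorem nonempty_equiv_dataII
    (hw : (c * c') • opX n l ξ ^ (2 * h) = 1 ∨
      coeffII n q lam1 lam2 (q * (1 - q ^ 2) * lam1 * lam2) 0 = 0)
    (hk : (moduleData hq0 hq2 hM.invertible).k.unop v = (lam1 : 𝕂) • v)
    (hxy : (moduleData hq0 hq2 hM.invertible).x.unop
      ((moduleData hq0 hq2 hM.invertible).y.unop v) = (lam2 : 𝕂) • v)
    (hφ : (moduleData hq0 hq2 hM.invertible).φ.unop v = 0)
    (hx : (moduleData hq0 hq2 hM.invertible).x.unop ^ l = algebraMap 𝕂 _ (ξ : 𝕂))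
    (hr : (moduleData hq0 hq2 hM.invertible).ψ.unop ^ n =
      c • (moduleData hq0 hq2 hM.invertible).x.unop ^ h) :
    Nonempty (M ≃ₗ[(A q)ᵐᵒᵖ] BMod hq hl (dataII hn0 hl0 hq0 hql hqn hqh ξ lam1 lam2
      (q * (1 - q ^ 2) * lam1 * lam2) c c' hw)) := by
  have : NeZero n := ⟨hn0⟩
  have : NeZero l := ⟨hl0⟩
  set D := moduleData hq0 hq2 hM.invertible with hD
  refine nonempty_equiv_BMod hq hl hq0 hq2 hM
    (BMod.isSimpleXY hq hl _ (isSimpleB_dataII hq hl _ _ _ _ _ _ _ _ _ _ _ _ hnl hw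
      (Or.inr fun _ => coeffII_ne_zero lam1 lam2 hq0 hq hnl)))
    (f := modelMap n l D.x.unop D.ψ.unop v) (modelMap_ne_zero hv) ?_ ?_ ?_ ?_ ?_
  · refine modelMap_K hq0 (D.unop_k_x hq0) ?_ hk
    rw [zpow_one]; exact D.unop_k_ψ
  · exact modelMap_X hx
  · refine modelMap_Y hq0 hx D.unop_y_x ?_ hxy D.x_injective
    rw [zpow_one]; exact D.unop_xy_ψ
  · have h2 (b : ℕ) (w : M) : D.φ.unop ((D.x.unop ^ b) w) = (D.x.unop ^ b) (D.φ.unop w) :=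
      LinearMap.congr_fun (Commute.pow_right (Eq.symm D.unop_x_φ) b).eq _
    refine modelMap_lower_of_zero (coeffII_zero hq0) (fun b => ?_) fun a ha b => ?_
    · rw [modelMap_e, h2, ZMod.val_zero, pow_zero, Module.End.one_apply, hφ, map_zero]
    · rw [modelMap_e, modelMap_e, h2, val_pred ha, BData.φ_pow_ψ hq0 hk hxy hφ, map_smul,
        coeffII_eq _ _ hq0, val_pred ha]
      norm_cast
  · exact modelMap_raise hx D.unop_x_ψ hr

end Equiv

end QuantumPlane

theorem LinearEquiv.smul_eq_zero_of_forall {R M N : Type*} [Ring R] [AddCommGroup M]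
    [AddCommGroup N] [Module R M] [Module R N] (E : M ≃ₗ[R] N) {r : R} (h : ∀ m : M, r • m = 0)
    (w : N) : r • w = 0 := by
  rw [← E.apply_symm_apply w, ← map_smul, h, map_zero]

/-! ### Classification of the simple modules with X and Y invertible. -/

namespace QuantumPlane

variable {𝕂 : Type*} [Field 𝕂] [IsAlgClosed 𝕂] {q : 𝕂} {n l h : ℕ}

section Classification

variable {M : Type*} [AddCommGroup M] [Module 𝕂 M] [FiniteDimensional 𝕂 M]

/-- K, YX and ψφ commute pairwise because their q-factors cancel; the eigenvalues of K and YX are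
nonzero by injectivity. The subspace `W` is either the whole module or ker φ. -/
theorem BData.exists_eigenvector (hq : q ≠ 0) (D : BData q (Module.End 𝕂 M)ᵐᵒᵖ)
    {W : Submodule 𝕂 M} (hW : W ≠ ⊥) (hk : ∀ v ∈ W, D.k.unop v ∈ W)
    (hxy : ∀ v ∈ W, (D.x.unop * D.y.unop) v ∈ W)
    (hφψ : ∀ v ∈ W, (D.φ.unop * D.ψ.unop) v ∈ W) :
    ∃ (lam1 lam2 : 𝕂ˣ) (lam3 : 𝕂) (v : M), v ∈ W ∧ v ≠ 0 ∧ D.k.unop v = (lam1 : 𝕂) • v ∧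
      D.x.unop (D.y.unop v) = (lam2 : 𝕂) • v ∧ D.φ.unop (D.ψ.unop v) = lam3 • v := by
  have h12 := D.unop_k_xy hq
  have h13 : Commute D.k.unop (D.φ.unop * D.ψ.unop) :=
    skew_mul (D.unop_k_φ hq) D.unop_k_ψ (inv_mul_cancel₀ hq)
  have h23 : Commute (D.x.unop * D.y.unop) (D.φ.unop * D.ψ.unop) :=
    skew_mul (D.unop_xy_φ hq) D.unop_xy_ψ (inv_mul_cancel₀ hq)
  obtain ⟨μ1, hW1⟩ := Module.End.exists_inf_eigenspace_ne_bot hW hk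
  obtain ⟨μ2, hW2⟩ := Module.End.exists_inf_eigenspace_ne_bot hW1
    (Module.End.apply_mem_inf_eigenspace hxy h12.symm μ1)
  obtain ⟨μ3, hW3⟩ := Module.End.exists_inf_eigenspace_ne_bot hW2
    (Module.End.apply_mem_inf_eigenspace
      (Module.End.apply_mem_inf_eigenspace hφψ h13.symm μ1) h23.symm μ2)
  obtain ⟨v, ⟨⟨⟨hv, h1⟩, h2⟩, h3⟩, hv0⟩ := (Submodule.ne_bot_iff _).1 hW3
  have h1 := Module.End.mem_eigenspace_iff.1 h1
  have h2 := Module.End.mem_eigenspace_iff.1 h2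
  have h3 := Module.End.mem_eigenspace_iff.1 h3
  have hμ1 : μ1 ≠ 0 := fun h => hv0 (D.k_injective (by rw [h1, h, zero_smul, map_zero]))
  have hμ2 : μ2 ≠ 0 := fun h => hv0 (D.y_injective (D.x_injective (by
    rw [← Module.End.mul_apply, h2, h, zero_smul, map_zero, map_zero])))
  exact ⟨Units.mk0 μ1 hμ1, Units.mk0 μ2 hμ2, μ3, v, hv, hv0, h1, h2, h3⟩

variable [Module (A q)ᵐᵒᵖ M] [IsScalarTower 𝕂 (A q)ᵐᵒᵖ M]

/-- Central elements act as scalars on simple modules. -/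
theorem exists_scalar_of_central (hq : q ≠ 0) (hq2 : q ^ 2 ≠ 1) (hM : IsSimpleXY q M)
    {z : (Module.End 𝕂 M)ᵐᵒᵖ} (hz : (moduleData hq hq2 hM.invertible).Central z) :
    ∃ c : 𝕂, z.unop = algebraMap 𝕂 _ c := by
  have := hM.simple
  let g : Module.End (A q)ᵐᵒᵖ M :=
    { toFun := z.unop
      map_add' := z.unop.map_add
      map_smul' := fun a v => by
        have cm {t : (Module.End 𝕂 M)ᵐᵒᵖ} (h : t * z = z * t) (v : M) :
            z.unop (t.unop v) = t.unop (z.unop v) := LinearMap.congr_fun (congrArg unop h) v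
        have := BData.map_toHom hq hq2 (f := z.unop) (cm hz.k) (cm hz.x) (cm hz.y) (cm hz.φ)
          (cm hz.ψ) a.unop v
        rw [moduleData_toHom] at this
        exact this }
  obtain ⟨c, hc⟩ := (IsSimpleModule.algebraMap_end_bijective_of_isAlgClosed
    (A := (A q)ᵐᵒᵖ) (V := M) 𝕂).2 g
  exact ⟨c, LinearMap.ext fun v => (LinearMap.congr_fun hc v).symm⟩

/-- The two families of simple modules on which `X` and `Y` act invertibly. -/
theorem IsSimpleXY.cases (hq : q ≠ 0) (hq2 : q ^ 2 ≠ 1) (hM : IsSimpleXY q M) (hn : n ≠ 0)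
    (hql : q ^ l = 1) (hqn : q ^ n = q ^ h) (hqh : q ^ h * q ^ h = 1) {D : BData q (Module.End 𝕂 M)ᵐᵒᵖ}
    (hD : D = moduleData hq hq2 hM.invertible) :
    ∃ ξ : 𝕂ˣ, D.x.unop ^ l = algebraMap 𝕂 _ (ξ : 𝕂) ∧
      ((∃ γ : 𝕂ˣ, D.x.unop ^ h * D.φ.unop ^ n = algebraMap 𝕂 _ (γ : 𝕂) ∧
        ∃ (lam1 lam2 : 𝕂ˣ) (lam3 : 𝕂) (v : M), v ≠ 0 ∧ D.k.unop v = (lam1 : 𝕂) • v ∧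
          D.x.unop (D.y.unop v) = (lam2 : 𝕂) • v ∧ D.φ.unop (D.ψ.unop v) = lam3 • v) ∨
      (D.φ.unop ^ n = 0 ∧ ∃ β : 𝕂, D.x.unop ^ h * D.ψ.unop ^ n = algebraMap 𝕂 _ β ∧
        ∃ (lam1 lam2 : 𝕂ˣ) (v : M), v ≠ 0 ∧ D.k.unop v = (lam1 : 𝕂) • v ∧
          D.x.unop (D.y.unop v) = (lam2 : 𝕂) • v ∧ D.φ.unop v = 0)) := by
  have := hM.simple
  have := IsSimpleModule.nontrivial (A q)ᵐᵒᵖ M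
  have hxp (m : ℕ) : Function.Injective (D.x.unop ^ m) := by
    rw [Module.End.coe_pow]; exact D.x_injective.iterate m
  have sc {z : (Module.End 𝕂 M)ᵐᵒᵖ} (hz : D.Central z) : ∃ c : 𝕂, z.unop = algebraMap 𝕂 _ c := by
    subst hD; exact exists_scalar_of_central hq hq2 hM hz
  -- Three central elements, hence three scalars. Only the one of X^l is certainly nonzero; whether
  -- γ vanishes decides between the two families.
  obtain ⟨ξ, hξ⟩ := sc (D.central_x_pow hq hql)
  obtain ⟨γ, hγ⟩ := sc (D.central_φ_pow hq hq2 hn hqn hqh)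
  obtain ⟨β, hβ⟩ := sc (D.central_ψ_pow hq hq2 hn hqn hqh)
  simp only [unop_mul, unop_pow] at hξ hγ hβ
  obtain ⟨m, hm⟩ := exists_ne (0 : M)
  have hξ0 : ξ ≠ 0 := by
    rintro rfl
    rw [map_zero] at hξ
    exact hm (hxp l (by rw [hξ, LinearMap.zero_apply, LinearMap.zero_apply]))
  refine ⟨Units.mk0 ξ hξ0, hξ, ?_⟩
  by_cases hγ0 : γ = 0
  · right
    -- Cancelling the injective X^h shows that φ is nilpotent, so it has a nonzero kernel.
    have hφn : D.φ.unop ^ n = 0 := LinearMap.ext fun v => hxp h (by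
      rw [← Module.End.mul_apply, hγ, hγ0, map_zero, LinearMap.zero_apply]; simp)
    refine ⟨hφn, β, hβ, ?_⟩
    have hker : D.φ.unop.ker ≠ ⊥ := fun hk => by
      have hinj : Function.Injective (D.φ.unop ^ n) := by
        rw [Module.End.coe_pow]; exact (LinearMap.ker_eq_bot.1 hk).iterate n
      exact hm (hinj (by rw [hφn, LinearMap.zero_apply, LinearMap.zero_apply]))
    have hs {T : Module.End 𝕂 M} (hT : T * D.φ.unop = q⁻¹ • (D.φ.unop * T)) (v : M)
        (hv : v ∈ D.φ.unop.ker) : T v ∈ D.φ.unop.ker := by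
      rw [LinearMap.mem_ker] at hv ⊢
      have h1 := LinearMap.congr_fun (BData.flip (inv_ne_zero hq) hT) v
      rw [Module.End.mul_apply, LinearMap.smul_apply, Module.End.mul_apply, hv, map_zero,
        smul_zero] at h1
      exact h1
    -- ker φ is stable: K and YX commute with φ up to a scalar, and there ψφ equals the commutator
    -- q(1 - q²)KYX. The third eigenvalue is discarded, since it is determined by the other two.
    obtain ⟨lam1, lam2, -, v, hv, hv0, h1, h2, -⟩ := D.exists_eigenvector hq hker
      (hs (D.unop_k_φ hq)) (hs (D.unop_xy_φ hq)) (fun v hv => by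
        rw [LinearMap.mem_ker] at hv
        have h1 := hs (D.unop_xy_φ hq) (D.k.unop v) (hs (D.unop_k_φ hq) v hv)
        rw [Module.End.mul_apply, D.unop_φ_ψ, hv, map_zero, zero_add]
        exact Submodule.smul_mem _ _ h1)
    exact ⟨lam1, lam2, v, hv0, h1, h2, hv⟩
  · left
    refine ⟨Units.mk0 γ hγ0, hγ, ?_⟩
    obtain ⟨lam1, lam2, lam3, v, -, h⟩ := D.exists_eigenvector hq (W := ⊤) top_ne_bot
      (fun _ _ => trivial) (fun _ _ => trivial) (fun _ _ => trivial)
    exact ⟨lam1, lam2, lam3, v, h⟩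

theorem IsSimpleXY.classification_odd (hq : IsPrimitiveRoot q l) (hl : 3 ≤ l) (ho : Odd l)
    (hM : IsSimpleXY q M) :
    (∃ (α ξ lam1 lam2 : 𝕂ˣ) (lam3 : 𝕂),
        Nonempty (M ≃ₗ[(A q)ᵐᵒᵖ] N1 hq hl α ξ lam1 lam2 lam3)) ∨
      (∃ (β ξ lam1 lam2 : 𝕂ˣ) (lam3 : 𝕂),
        (∀ v : N2 hq hl β ξ lam1 lam2 lam3, MulOpposite.op (A.phi q ^ l) • v = 0) ∧
        Nonempty (M ≃ₗ[(A q)ᵐᵒᵖ] N2 hq hl β ξ lam1 lam2 lam3)) ∨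
      (∃ ξ lam1 lam2 : 𝕂ˣ, Nonempty (M ≃ₗ[(A q)ᵐᵒᵖ] N3 hq hl ξ lam1 lam2)) := by
  have hq0 : q ≠ 0 := hq.ne_zero (by omega)
  have hq2 := pow_two_ne_one hq hl
  have hnl := dvd_of_dvd_two_mul_of_odd ho
  obtain ⟨ξ, hx, ⟨γ, hγ, lam1, lam2, lam3, v, hv, h1, h2, h3⟩ |
    ⟨hφ, β, hβ, lam1, lam2, v, hv, h1, h2, h3⟩⟩ := hM.cases hq0 hq2 (n := l) (h := 0)
      (by omega) hq.pow_eq_one (by rw [hq.pow_eq_one, pow_zero]) (by simp) rfl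
  · left
    refine ⟨γ, ξ, lam1, lam2, lam3, nonempty_equiv_dataI hq hl hM _ _ hq0 hq2 _ _ _ hnl hv
      γ.ne_zero _ h1 h2 h3 hx ?_⟩
    rw [pow_zero, one_mul] at hγ
    rw [hγ, pow_zero, Algebra.algebraMap_eq_smul_one]
  · right
    rw [pow_zero, one_mul] at hβ
    by_cases hβ0 : β = 0
    · right
      refine ⟨ξ, lam1, lam2, nonempty_equiv_dataII hq hl hM _ _ hq0 hq2 _ _ _ hnl hv
        _ h1 h2 h3 hx ?_⟩
      rw [hβ, hβ0, map_zero, zero_smul]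
    · left
      obtain ⟨E⟩ := nonempty_equiv_dataII hq hl hM (h := 0) (c := β) (c' := β⁻¹) (by omega) (by omega) hq0
        hq2 hq.pow_eq_one (by rw [hq.pow_eq_one, pow_zero]) (by simp) hnl hv
        (Or.inl (by simp [hβ0])) h1 h2 h3 hx
        (by rw [hβ, pow_zero, Algebra.algebraMap_eq_smul_one])
      -- The value of λ₃ is the one forced by uφ = 0, and φ^l = 0 is carried over from M by the
      -- isomorphism.
      refine ⟨Units.mk0 β hβ0, ξ, lam1, lam2, q * (1 - q ^ 2) * lam1 * lam2, fun w => ?_, ⟨E⟩⟩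
      have hz (m : M) : op (A.phi q ^ l) • m = 0 := by
        rw [← rightAction_apply, map_pow, unop_pow]
        exact LinearMap.congr_fun hφ m
      exact E.smul_eq_zero_of_forall hz w

theorem IsSimpleXY.classification_even (hq : IsPrimitiveRoot q l) (hl : 3 ≤ l) (he : Even l)
    (hM : IsSimpleXY q M) :
    (∃ (α' ξ lam1 lam2 : 𝕂ˣ) (lam3 : 𝕂),
        Nonempty (M ≃ₗ[(A q)ᵐᵒᵖ] N4 hq hl he α' ξ lam1 lam2 lam3)) ∨
      (∃ β' ξ lam1 lam2 : 𝕂ˣ, Nonempty (M ≃ₗ[(A q)ᵐᵒᵖ] N5 hq hl he β' ξ lam1 lam2)) ∨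
      (∃ ξ lam1 lam2 : 𝕂ˣ, Nonempty (M ≃ₗ[(A q)ᵐᵒᵖ] N6 hq hl he ξ lam1 lam2)) := by
  have hq0 : q ≠ 0 := hq.ne_zero (by omega)
  have hq2 := pow_two_ne_one hq hl
  have hnl := half_dvd_of_dvd_two_mul he
  obtain ⟨ξ, hx, H⟩ := hM.cases hq0 hq2 (n := l / 2) (h := l / 2)
    (by omega) hq.pow_eq_one rfl (half_pow hq he) rfl
  set D := moduleData hq0 hq2 hM.invertible
  -- Multiplying by X^(l/2) once more turns the left side into X^l T = ξT, which explains the factor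
  -- ξ⁻¹ in N₄ and N₅.
  have key {T : Module.End 𝕂 M} {γ : 𝕂} (hT : D.x.unop ^ (l / 2) * T = algebraMap 𝕂 _ γ) :
      T = ((ξ : 𝕂)⁻¹ * γ) • D.x.unop ^ (l / 2) := by
    have h1 := congrArg (fun S => D.x.unop ^ (l / 2) * S) hT
    simp only [← mul_assoc, ← pow_add, ← two_mul, Nat.two_mul_div_two_of_even he, hx] at h1
    rw [← Algebra.smul_def, ← Algebra.commutes, ← Algebra.smul_def] at h1
    rw [mul_smul, ← h1, inv_smul_smul₀ ξ.ne_zero]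
  obtain ⟨γ, hγ, lam1, lam2, lam3, v, hv, h1, h2, h3⟩ |
    ⟨-, β, hβ, lam1, lam2, v, hv, h1, h2, h3⟩ := H
  · left
    exact ⟨γ, ξ, lam1, lam2, lam3, nonempty_equiv_dataI hq hl hM _ _ hq0 hq2 _ _ _ hnl hv
      (mul_ne_zero (inv_ne_zero ξ.ne_zero) γ.ne_zero) _ h1 h2 h3 hx (key hγ)⟩
  · right
    by_cases hβ0 : β = 0
    · right
      refine ⟨ξ, lam1, lam2, nonempty_equiv_dataII hq hl hM _ _ hq0 hq2 _ _ _ hnl hv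
        _ h1 h2 h3 hx ?_⟩
      rw [key hβ, hβ0, mul_zero]
    · left
      exact ⟨Units.mk0 β hβ0, ξ, lam1, lam2, nonempty_equiv_dataII hq hl hM _ _ hq0 hq2 _ _ _ hnl
        hv _ h1 h2 h3 hx (key hβ)⟩

end Classification

end QuantumPlane

/-! ### The main theorem. -/

theorem mainTheorem3 {𝕂 : Type*} [Field 𝕂] [IsAlgClosed 𝕂] {l : ℕ} {q : 𝕂}
    (hq : IsPrimitiveRoot q l) (hl : 3 ≤ l) :
    -- the modules `N₁, …, N₆` are simple `B`-modules, and simple `A`-modules with `X`, `Y` invertible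
    (Odd l →
      (∀ (α ξ lam1 lam2 : 𝕂ˣ) (lam3 : 𝕂),
        IsSimpleB q (N1 hq hl α ξ lam1 lam2 lam3) ∧
        IsSimpleXY q (N1 hq hl α ξ lam1 lam2 lam3)) ∧
      (∀ (β ξ lam1 lam2 : 𝕂ˣ) (lam3 : 𝕂),
        IsSimpleB q (N2 hq hl β ξ lam1 lam2 lam3) ∧
        IsSimpleXY q (N2 hq hl β ξ lam1 lam2 lam3)) ∧
      (∀ ξ lam1 lam2 : 𝕂ˣ,
        IsSimpleB q (N3 hq hl ξ lam1 lam2) ∧ IsSimpleXY q (N3 hq hl ξ lam1 lam2))) ∧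
    (∀ he : Even l,
      (∀ (α' ξ lam1 lam2 : 𝕂ˣ) (lam3 : 𝕂),
        IsSimpleB q (N4 hq hl he α' ξ lam1 lam2 lam3) ∧
        IsSimpleXY q (N4 hq hl he α' ξ lam1 lam2 lam3)) ∧
      (∀ β' ξ lam1 lam2 : 𝕂ˣ,
        IsSimpleB q (N5 hq hl he β' ξ lam1 lam2) ∧ IsSimpleXY q (N5 hq hl he β' ξ lam1 lam2)) ∧
      (∀ ξ lam1 lam2 : 𝕂ˣ,
        IsSimpleB q (N6 hq hl he ξ lam1 lam2) ∧ IsSimpleXY q (N6 hq hl he ξ lam1 lam2))) ∧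
    -- the classification, and the dimensions
    (∀ (M : Type*) [AddCommGroup M] [Module 𝕂 M] [Module (A q)ᵐᵒᵖ M]
        [IsScalarTower 𝕂 (A q)ᵐᵒᵖ M], IsSimpleXY q M →
      IsSimpleB q M ∧
      ((Odd l ∧
        ((∃ (α ξ lam1 lam2 : 𝕂ˣ) (lam3 : 𝕂),
            Nonempty (M ≃ₗ[(A q)ᵐᵒᵖ] N1 hq hl α ξ lam1 lam2 lam3)) ∨
          (∃ (β ξ lam1 lam2 : 𝕂ˣ) (lam3 : 𝕂),
            (∀ v : N2 hq hl β ξ lam1 lam2 lam3, MulOpposite.op (A.phi q ^ l) • v = 0) ∧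
            Nonempty (M ≃ₗ[(A q)ᵐᵒᵖ] N2 hq hl β ξ lam1 lam2 lam3)) ∨
          (∃ ξ lam1 lam2 : 𝕂ˣ, Nonempty (M ≃ₗ[(A q)ᵐᵒᵖ] N3 hq hl ξ lam1 lam2)))) ∨
       (∃ he : Even l,
          (∃ (α' ξ lam1 lam2 : 𝕂ˣ) (lam3 : 𝕂),
            Nonempty (M ≃ₗ[(A q)ᵐᵒᵖ] N4 hq hl he α' ξ lam1 lam2 lam3)) ∨
          (∃ β' ξ lam1 lam2 : 𝕂ˣ, Nonempty (M ≃ₗ[(A q)ᵐᵒᵖ] N5 hq hl he β' ξ lam1 lam2)) ∨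
          (∃ ξ lam1 lam2 : 𝕂ˣ, Nonempty (M ≃ₗ[(A q)ᵐᵒᵖ] N6 hq hl he ξ lam1 lam2)))) ∧
      FiniteDimensional 𝕂 M ∧ Module.finrank 𝕂 M = PIdeg (A q) ∧
      (∀ (V : Type*) [AddCommGroup V] [Module 𝕂 V] [Module (A q)ᵐᵒᵖ V]
          [IsScalarTower 𝕂 (A q)ᵐᵒᵖ V], IsSimpleModule (A q)ᵐᵒᵖ V →
        FiniteDimensional 𝕂 V ∧ Module.finrank 𝕂 V ≤ Module.finrank 𝕂 M)) ∧
    -- the value of the PI degree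
    PIdeg (A q) = if Odd l then l ^ 2 else l ^ 2 / 2 := by
  have hq0 : q ≠ 0 := hq.ne_zero (by omega)
  have hq2 := pow_two_ne_one hq hl
  have hN {n : ℕ} {D : BData q (Module.End 𝕂 (Sp 𝕂 n l))ᵐᵒᵖ} (h : IsSimpleB q (BMod hq hl D)) :
      IsSimpleB q (BMod hq hl D) ∧ IsSimpleXY q (BMod hq hl D) :=
    ⟨h, BMod.isSimpleXY hq hl D h⟩
  have hl0 : NeZero l := ⟨by omega⟩
  have hl2 : NeZero (l / 2) := ⟨by omega⟩
  refine ⟨fun ho => ⟨fun α ξ lam1 lam2 lam3 => hN (isSimpleB_N1 hq hl ho α ξ lam1 lam2 lam3),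
    fun β ξ lam1 lam2 lam3 => hN (isSimpleB_N2 hq hl ho β ξ lam1 lam2 lam3),
    fun ξ lam1 lam2 => hN (isSimpleB_N3 hq hl ho ξ lam1 lam2)⟩,
    fun he => ⟨fun α' ξ lam1 lam2 lam3 => hN (isSimpleB_N4 hq hl he α' ξ lam1 lam2 lam3),
    fun β' ξ lam1 lam2 => hN (isSimpleB_N5 hq hl he β' ξ lam1 lam2),
    fun ξ lam1 lam2 => hN (isSimpleB_N6 hq hl he ξ lam1 lam2)⟩, ?_, ?_⟩
  · intro M _ _ _ _ hM
    have := hM.simple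
    have : FiniteDimensional 𝕂 M := A.finiteDimensional_of_isSimpleModule hq hl M
    rcases Nat.even_or_odd l with he | ho
    -- All models for a given parity have the same dimension nl, so that of M follows from the
    -- classification.
    · have hd : Module.finrank 𝕂 M = l / 2 * l := by
        rcases hM.classification_even hq hl he with ⟨_, _, _, _, _, ⟨E⟩⟩ | ⟨_, _, _, _, ⟨E⟩⟩ |
          ⟨_, _, _, ⟨E⟩⟩ <;>
        exact (E.restrictScalars 𝕂).finrank_eq.trans (BMod.finrank hq hl _)
      refine ⟨isSimpleB_of_isSimpleModule hq0 hq2 hM,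
        Or.inr ⟨he, hM.classification_even hq hl he⟩, this,
        hd.trans (PIdeg_of_even hq hl he).symm, fun V _ _ _ _ hV => ?_⟩
      have : FiniteDimensional 𝕂 V := A.finiteDimensional_of_isSimpleModule hq hl V
      refine ⟨this, ?_⟩
      -- The identity of degree 2nl bounds every simple module, with no assumption on the action of
      -- X and Y.
      have := two_mul_finrank_le_of_hasMonicIdentity (hasMonicIdentity_of_even hq hl he) V
      omega
    · have hd : Module.finrank 𝕂 M = l * l := by
        rcases hM.classification_odd hq hl ho with ⟨_, _, _, _, _, ⟨E⟩⟩ | ⟨_, _, _, _, _, _, ⟨E⟩⟩ |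
          ⟨_, _, _, ⟨E⟩⟩ <;>
        exact (E.restrictScalars 𝕂).finrank_eq.trans (BMod.finrank hq hl _)
      refine ⟨isSimpleB_of_isSimpleModule hq0 hq2 hM,
        Or.inl ⟨ho, hM.classification_odd hq hl ho⟩, this,
        hd.trans (PIdeg_of_odd hq hl ho).symm, fun V _ _ _ _ hV => ?_⟩
      have : FiniteDimensional 𝕂 V := A.finiteDimensional_of_isSimpleModule hq hl V
      refine ⟨this, ?_⟩
      have := two_mul_finrank_le_of_hasMonicIdentity (hasMonicIdentity_of_odd hq hl) V
      omega
  · split_ifs with ho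
    · rw [PIdeg_of_odd hq hl ho, sq]
    · have he := Nat.not_odd_iff_even.1 ho
      rw [PIdeg_of_even hq hl he, sq, Nat.div_mul_right_comm he.two_dvd]
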